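/- **Setting.** A node stream starts from the empty graph. At each time $t=1,\dots,T$ an adversary, who sees the realized stream so far but not the coins of the algorithm, either inserts a new node together with its edges to present nodes of its choice, or (if some node is present) asks for a deletion, upon which a uniformly random present node is deleted with its edges. At most $n\ge 2$ nodes arrive in total. $G_t$ is the graph after $t$ updates, $N(u)$ the neighborhood of $u$ in $G_t$, $d(u)=|N(u)|$; below $\log=\log_2$, and sample sizes are rounded up. The graph is accessed by degree queries, edge queries and neighborhood sample queries (a uniformly random neighbor of a given node), each of cost $\lfloor\log |V(G_t)|\rfloor+1$. "Sample $k$ neighbors" means $k$ independent sample queries, taken as a set. Loops over sets run in an arbitrary fixed order. **Tests** (parameter $\varepsilon$). $\mathrm{Agree}(u,v)$: with $k=300\log n/\varepsilon$, draw $k$ random neighbors $r_i$ of $u$ and $s_i$ of $v$; answer yes iff fewer than $0.4\varepsilon k$ of the $r_i$ are outside $N(v)$ and fewer than $0.4\varepsilon k$ of the $s_i$ are outside $N(u)$. $\mathrm{Heavy}(u)$: with $k=1200\log n/\varepsilon$, draw $k$ random neighbors $v_i$ of $u$; answer yes iff fewer than $1.2\varepsilon k$ of the calls $\mathrm{Agree}(u,v_i)$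 answer no. **Algorithm.** It stores sets $I_u^i$ ($0\le i\le\lfloor\log n\rfloor$) for each node $u$, an anchor set $\Phi$ and a sparse graph $\tilde G\subseteq G_t$, all initially empty. $B_u^i$ is the set of present $v$ with $u\in I_v^i$, and $\Phi_u$ the set of anchors adjacent to $u$ in $\tilde G$. "$w$ refreshes" means: $w$ samples $10^{10}\log n/\varepsilon$ neighbors and stores the sample as $I_w^{i}$, $i=\lfloor\log d(w)\rfloor$ ($i=0$ if $d(w)=0$). After an arrival of $u$: $u$ refreshes and $R_0$ is its sample. After a deletion of $u$: $R_0=\bigcup_i B^i_u$, and $u$ is removed from $\Phi$ and $\tilde G$ and its stored samples are discarded. Then all nodes of $R_0$ refresh, $R_1$ being the union of their samples; all nodes of $R_1$ refresh, $R_2$ being the union of their samples; all nodes of $R_2$ refresh. Let $\mathcal I_t=R_0\cup R_1$, together with $u$ if $u$ arrived. For each $u\in\mathcal I_t$ do: 1. *Clean*: for each $w\in\Phi_u$, compute $\mathrm{Agree}(w,u)$ and $\mathrm{Heavy}(w)$ and delete $wu$ from $\tilde G$ unless both answer yes; then, if more than an $\varepsilon$ fraction of the edges that $w$ had in $\tilde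 G$ when it last entered $\Phi$ are lost, delete $w$ from $\Phi$ and all its edges from $\tilde G$. 2. *Anchor*: draw $X_u\sim\mathrm{Bernoulli}(\min\{1,10^7\log n/(\varepsilon d(u))\})$ (with probability $1$ if $d(u)=0$); if $u\in\Phi$, delete from $\tilde G$ all edges $uv$ with $v\notin\Phi$; compute $\mathrm{Heavy}(u)$; if it answers yes and $X_u=1$, compute $\mathrm{Agree}(u,v)$ for all $v\in N(u)$ and add to $\tilde G$ the edges $uv$ for which it answers yes. 3. *Connect*: sample a set $J$ of $10^5\log n/\varepsilon$ neighbors of $u$; for all $w\in J$ and $r\in\Phi_w$ compute $\mathrm{Heavy}(r)$ and $\mathrm{Agree}(r,u)$; if both answer yes and $ru$ is an edge of $G_t$, add $ru$ to $\tilde G$. At the end of the iteration the $u\in\mathcal I_t$ with $X_u=1$ enter (or re-enter) $\Phi$, those with $X_u=0$ leave it, and edges of $\tilde G$ without an endpoint in $\Phi$ are dropped. **Costs.** $Q_t$ is the number of calls of Agree and Heavy at time $t$ (including the calls of Agree inside Heavy), $D_t$ the total cost of the database queries at time $t$ (listing $N(u)$ in Anchor costs one query per neighbor), and $W_t$ is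 $D_t$ plus the number of other operations at time $t$ (updates of the stored sets, notifications, additions and deletions of edges of $\tilde G$, coin flips, comparisons). **Theorem.** There are an absolute constant $k$ and $\varepsilon_0>0$ such that for every $\varepsilon\in(0,\varepsilon_0)$ there is a constant $C=C(\varepsilon)$ such that for all $n\ge2$, all $T$ and every adversary as above, $$\mathbf E[Q_t]\le C(\log n)^k\quad\text{and}\quad \mathbf E[D_t]\le C(\log n)^k\quad(1\le t\le T),\qquad \mathbf E\Big[\sum_{t=1}^{T}W_t\Big]\le T\cdot C(\log n)^k .$$ That is, the expected work is $O(\operatorname{polylog} n)$ per node insertion or deletion. -/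

import Mathlib

open scoped ENNReal

noncomputable section

namespace DynCC

/-- A finite graph whose nodes are natural numbers: the node set together with the (positive)
edges.  All graphs that occur have their edges between nodes of `verts`. -/
structure NodeGraph where
  verts : Finset ℕ
  graph : SimpleGraph ℕ

namespace NodeGraph

open Classical in
/-- The neighborhood `N_G(u)`. -/
def nbhd (G : NodeGraph) (u : ℕ) : Finset ℕ := G.verts.filter (fun v => G.graph.Adj u v)

/-- The degree `|N_G(u)|`. -/
def deg (G : NodeGraph) (u : ℕ) : ℕ := (G.nbhd u).card

/-- The graph without nodes. -/
def empty : NodeGraph := ⟨∅, ⊥⟩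

/-- Arrival of the node `v`, which reveals its edges to the nodes of `S` that are present. -/
def insertNode (G : NodeGraph) (v : ℕ) (S : Finset ℕ) : NodeGraph where
  verts := insert v G.verts
  graph := G.graph ⊔ SimpleGraph.fromEdgeSet {e | ∃ w ∈ S ∩ G.verts, e = s(v, w)}

/-- Deletion of the node `v` together with its edges. -/
def deleteNode (G : NodeGraph) (v : ℕ) : NodeGraph where
  verts := G.verts.erase v
  graph := G.graph.deleteIncidenceSet v

end NodeGraph

/-! ### The node stream -/

/-- What has happened at one time of the stream: a new node arrived and announced the neighbor
set `S`, or the node `v` was deleted. -/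
inductive Event where
  | arrival (S : Finset ℕ)
  | deletion (v : ℕ)

/-- The realized stream so far, most recent event first. -/
abbrev History := List Event

/-- The number of nodes that have arrived so far; it is also the name of the next node, so the
nodes are named `0, 1, 2, …` in the order of their arrival and names are never used again. -/
def arrivals : History → ℕ
  | [] => 0
  | .arrival _ :: h => arrivals h + 1
  | .deletion _ :: h => arrivals h

/-- The graph `G_t` after the events of the history. -/
def graphOf : History → NodeGraph
  | [] => NodeGraph.empty
  | .arrival S :: h => (graphOf h).insertNode (arrivals h) S
  | .deletion v :: h => (graphOf h).deleteNode v

/-- A move of the adversary: to insert a node with a neighbor set of its choice, or to ask for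
the deletion of a (uniformly random) node. -/
inductive Request where
  | insert (S : Finset ℕ)
  | delete

/-- The adversary sees the realized stream, including which nodes were deleted, but not the
coins of the algorithm. -/
abbrev Adversary := History → Request

/-- The histories that the adversary together with the random deletions can produce. -/
inductive Adversary.Reachable (adv : Adversary) : History → Prop
  | start : Adversary.Reachable adv []
  | arrive (h : History) (S : Finset ℕ) (hh : Adversary.Reachable adv h)
      (hr : adv h = .insert S) : Adversary.Reachable adv (.arrival S :: h)
  | remove (h : History) (v : ℕ) (hh : Adversary.Reachable adv h)
      (hr : adv h = .delete) (hv : v ∈ (graphOf h).verts) :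
      Adversary.Reachable adv (.deletion v :: h)

/-- During the first `T` updates at most `n` nodes arrive, and a deletion is requested only when
some node is present. -/
def Adversary.Admissible (adv : Adversary) (n T : ℕ) : Prop :=
  ∀ h : History, adv.Reachable h → h.length < T →
    match adv h with
    | .insert _ => arrivals h < n
    | .delete => (graphOf h).verts.Nonempty

/-! ### Randomized computations with cost -/

/-- `calcs` counts the agreement and heaviness computations, `query` is the cost of the database
queries, `ops` counts the other operations. -/
structure Cost where
  calcs : ℕ
  query : ℕ
  ops : ℕ

namespace Cost

/-- No cost. -/
def zero : Cost := ⟨0, 0, 0⟩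

/-- Costs add up. -/
def add (a b : Cost) : Cost := ⟨a.calcs + b.calcs, a.query + b.query, a.ops + b.ops⟩

/-- The complexity of all operations: queries and computational operations. -/
def work (a : Cost) : ℕ := a.query + a.ops

end Cost

/-- A randomized computation of a value of type `α`: the joint law of the value and the cost. -/
def Comp (α : Type) : Type := PMF (α × Cost)

namespace Comp

/-- The computation that returns `a` at no cost. -/
def ret {α : Type} (a : α) : Comp α := PMF.pure (a, Cost.zero)

/-- Sequential composition, with fresh randomness in each part; costs add up. -/
def seq {α β : Type} (x : Comp α) (f : α → Comp β) : Comp β :=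
  PMF.bind x fun p => PMF.map (fun q => (q.1, p.2.add q.2)) (f p.1)

instance : Monad Comp where
  pure := ret
  bind := seq

/-- Draw from a distribution. -/
def sample {α : Type} (p : PMF α) : Comp α := PMF.map (fun a => (a, Cost.zero)) p

/-- Pay. -/
def charge (c : Cost) : Comp Unit := PMF.pure ((), c)

/-- Pay for `k` elementary operations. -/
def chargeOps (k : ℕ) : Comp Unit := charge ⟨0, 0, k⟩

/-- Count one agreement or heaviness computation. -/
def countCalc : Comp Unit := charge ⟨1, 0, 0⟩

end Comp

/-! ### The database model -/

/-- Each query costs `⌊log₂ |V|⌋ + 1`. -/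
def chargeQuery (G : NodeGraph) : Comp Unit := Comp.charge ⟨0, Nat.log 2 G.verts.card + 1, 0⟩

/-- Degree query. -/
def degreeQuery (G : NodeGraph) (u : ℕ) : Comp ℕ := do
  chargeQuery G
  pure (G.deg u)

open Classical in
/-- Edge query. -/
def edgeQuery (G : NodeGraph) (u v : ℕ) : Comp Bool := do
  chargeQuery G
  pure (decide (G.graph.Adj u v))

open Classical in
/-- Neighborhood sample query: a uniformly random neighbor (`none` if there is no neighbor). -/
def sampleQuery (G : NodeGraph) (u : ℕ) : Comp (Option ℕ) := do
  chargeQuery G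
  if h : (G.nbhd u).Nonempty then
    Comp.sample (PMF.map some (PMF.uniformOfFinset (G.nbhd u) h))
  else pure none

/-- The set of the nodes obtained by `k` independent neighborhood sample queries. -/
def sampleSet (G : NodeGraph) (u : ℕ) : ℕ → Comp (Finset ℕ)
  | 0 => pure ∅
  | k + 1 => do
    let x ← sampleQuery G u
    let S ← sampleSet G u k
    pure (x.toFinset ∪ S)

/-! ### Parameters -/

/-- The parameters of the algorithm: the number `n` of nodes of the stream, the constant `ε`, and
the order in which loops run through sets of nodes. -/
structure Params where
  n : ℕ
  ε : ℝ
  order : Finset ℕ → List ℕ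

namespace Params

/-- `order` lists every set without repetitions. -/
def OrderOK (P : Params) : Prop := ∀ S : Finset ℕ, (P.order S).Nodup ∧ (P.order S).toFinset = S

/-- `⌈c log n / ε⌉`. -/
def size (P : Params) (c : ℝ) : ℕ := ⌈c * Real.logb 2 P.n / P.ε⌉₊

/-- The number of the sets `I^0_u, …, I^{log n}_u`. -/
def levels (P : Params) : ℕ := Nat.log 2 P.n + 1

end Params

/-! ### Agreement and heaviness tests -/

/-- `k` rounds of the agreement test: in each round draw a random neighbor `r` of `u` and a
random neighbor `s` of `v`; count how often `r ∉ N(v)` and how often `s ∉ N(u)`.  (A failed draw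
counts as a disagreement.) -/
def agreementRounds (G : NodeGraph) (u v : ℕ) : ℕ → Comp (ℕ × ℕ)
  | 0 => pure (0, 0)
  | k + 1 => do
    let r ← sampleQuery G u
    let s ← sampleQuery G v
    let a ← match r with
      | some r => edgeQuery G v r
      | none => pure false
    let b ← match s with
      | some s => edgeQuery G u s
      | none => pure false
    let c ← agreementRounds G u v k
    pure (c.1 + (if a then 0 else 1), c.2 + (if b then 0 else 1))

open Classical in
/-- ProbabilisticAgreement(`u`, `v`, `ε`). -/
def probAgreement (P : Params) (G : NodeGraph) (u v : ℕ) : Comp Bool := do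
  Comp.countCalc
  let k := P.size 300
  let c ← agreementRounds G u v k
  pure (decide ((c.1 : ℝ) < 0.4 * P.ε * k ∧ (c.2 : ℝ) < 0.4 * P.ε * k))

/-- `k` rounds of the heaviness test: in each round draw a random neighbor of `u` and test
agreement with it; count the negative answers. -/
def heavyRounds (P : Params) (G : NodeGraph) (u : ℕ) : ℕ → Comp ℕ
  | 0 => pure 0
  | k + 1 => do
    let v ← sampleQuery G u
    let a ← match v with
      | some v => probAgreement P G u v
      | none => pure false
    let c ← heavyRounds P G u k
    pure (c + (if a then 0 else 1))

open Classical in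
/-- Heavy(`u`, `ε`). -/
def heavy (P : Params) (G : NodeGraph) (u : ℕ) : Comp Bool := do
  Comp.countCalc
  let k := P.size 1200
  let c ← heavyRounds P G u k
  pure (decide ((c : ℝ) < 1.2 * P.ε * k))

/-! ### The dynamic algorithm -/

/-- The data that the algorithm maintains. -/
structure State where
  /-- `I u i` is the last neighborhood sample that `u` stored when its degree was in
  `[2^i, 2^(i+1))`. -/
  I : ℕ → ℕ → Finset ℕ
  /-- the anchor set `Φ` -/
  anchors : Finset ℕ
  /-- the sparse solution `G̃` -/
  sparse : SimpleGraph ℕ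
  /-- `ref u` is the neighborhood of `u` in the sparse solution when `u` last entered `Φ`. -/
  ref : ℕ → Finset ℕ

/-- The state before the first update. -/
def State.initial : State := ⟨fun _ _ => ∅, ∅, ⊥, fun _ => ∅⟩

open Classical in
/-- The neighborhood of `u` in the sparse solution. -/
def State.sparseNbhd (s : State) (G : NodeGraph) (u : ℕ) : Finset ℕ :=
  G.verts.filter (fun v => s.sparse.Adj u v)

/-- `Φ_u`: the anchor nodes that are connected to `u` in the sparse solution. -/
def State.anchorNbhd (s : State) (G : NodeGraph) (u : ℕ) : Finset ℕ :=
  s.sparseNbhd G u ∩ s.anchors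

/-- `B^i_u`: the present nodes `v` with `u ∈ I^i_v`. -/
def backSet (G : NodeGraph) (I : ℕ → ℕ → Finset ℕ) (u i : ℕ) : Finset ℕ :=
  G.verts.filter (fun v => u ∈ I v i)

/-- Replace the sparse solution, at one operation per edge that is added or deleted. -/
def setSparse (s : State) (H : SimpleGraph ℕ) : Comp State := do
  Comp.chargeOps (symmDiff s.sparse.edgeSet H.edgeSet).ncard
  pure { s with sparse := H }

/-- The node `w` draws a new neighborhood sample and stores it in `I^{l_w}_w`.  The operations
are the updates of the sets `I` and `B` and the notifications sent to the sample. -/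
def refresh (P : Params) (G : NodeGraph) (I : ℕ → ℕ → Finset ℕ) (w : ℕ) :
    Comp ((ℕ → ℕ → Finset ℕ) × Finset ℕ) := do
  let d ← degreeQuery G w
  let l := Nat.log 2 d
  let S ← sampleSet G w (P.size (10 ^ 10))
  Comp.chargeOps ((I w l).card + 2 * S.card + 1)
  pure (Function.update I w (Function.update (I w) l S), S)

/-- All nodes of `R` draw a new sample; the second component is the set of all sampled nodes. -/
def notifyRound (P : Params) (G : NodeGraph) (I : ℕ → ℕ → Finset ℕ) (R : Finset ℕ) :
    Comp ((ℕ → ℕ → Finset ℕ) × Finset ℕ) :=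
  (P.order R).foldlM (fun acc w => do
    let x ← refresh P G acc.1 w
    pure (x.1, acc.2 ∪ x.2)) (I, ∅)

/-- The loop of Notify, started from the set `R₀` of the receivers of `Type₀` notifications; it
returns the stored samples and the nodes that received a `Type₀` or `Type₁` notification. -/
def notifyLoop (P : Params) (G : NodeGraph) (I : ℕ → ℕ → Finset ℕ) (R₀ : Finset ℕ) :
    Comp ((ℕ → ℕ → Finset ℕ) × Finset ℕ) := do
  let x₀ ← notifyRound P G I R₀
  let x₁ ← notifyRound P G x₀.1 x₀.2
  let x₂ ← notifyRound P G x₁.1 x₁.2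
  pure (x₂.1, R₀ ∪ x₀.2)

open Classical in
/-- Clean(`u`, `ε`, `t`). -/
def clean (P : Params) (G : NodeGraph) (s : State) (u : ℕ) : Comp State :=
  (P.order (s.anchorNbhd G u)).foldlM (fun s w => do
    let a ← probAgreement P G w u
    let b ← heavy P G w
    let s ← if a && b then pure s else setSparse s (s.sparse.deleteEdges {s(w, u)})
    Comp.chargeOps 1
    if P.ε * (s.ref w).card < ((s.ref w \ s.sparseNbhd G w).card : ℝ) then do
      let s ← setSparse s (s.sparse.deleteIncidenceSet w)
      Comp.chargeOps 1
      pure { s with anchors := s.anchors.erase w }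
    else pure s) s

/-- A coin that shows `true` with probability `min p 1`. -/
def coin (p : NNReal) : PMF Bool :=
  PMF.ofFintype (fun b => cond b (min p 1 : ℝ≥0∞) (1 - min p 1)) (by simp)

/-- `10^7 log n / (ε d)`, which is infinite and hence truncated to `1` if `d = 0`. -/
def anchorProb (P : Params) (d : ℕ) : NNReal :=
  if d = 0 then 1 else Real.toNNReal (10 ^ 7 * Real.logb 2 P.n / (P.ε * d))

/-- Anchor(`u`, `ε`, `t`).  It returns the Bernoulli variable `X_u`; the resulting change of `Φ`
takes place at the end of the iteration.  Listing the neighborhood of `u` costs one query per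
neighbor. -/
def anchor (P : Params) (G : NodeGraph) (s : State) (u : ℕ) : Comp (State × Bool) := do
  let d ← degreeQuery G u
  Comp.chargeOps 1
  let X ← Comp.sample (coin (anchorProb P d))
  let s ← if u ∈ s.anchors then
      setSparse s (s.sparse.deleteEdges {e | ∃ v, v ∉ s.anchors ∧ e = s(u, v)})
    else pure s
  let b ← heavy P G u
  let s ← if b && X then
      (P.order (G.nbhd u)).foldlM (fun s v => do
        chargeQuery G
        let a ← probAgreement P G u v
        if a then setSparse s (s.sparse ⊔ SimpleGraph.edge u v) else pure s) s
    else pure s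
  pure (s, X)

/-- Connect(`u`, `ε`, `t`).  The edge query keeps the sparse solution a subgraph of `G_t`. -/
def connect (P : Params) (G : NodeGraph) (s : State) (u : ℕ) : Comp State := do
  let J ← sampleSet G u (P.size (10 ^ 5))
  (P.order J).foldlM (fun s w =>
    (P.order (s.anchorNbhd G w)).foldlM (fun s r => do
      let e ← edgeQuery G r u
      let b ← heavy P G r
      let a ← probAgreement P G r u
      if e && b && a then setSparse s (s.sparse ⊔ SimpleGraph.edge r u) else pure s) s) s

/-- The end of an iteration: the nodes of `on` (those with `X_u = 1`) enter `Φ`, the nodes of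
`off` (those with `X_u = 0`) leave it, and edges of the sparse solution without an endpoint in
`Φ` are dropped. -/
def finish (P : Params) (G : NodeGraph) (s : State) (on off : Finset ℕ) : Comp State := do
  Comp.chargeOps (on.card + off.card)
  let Φ := (s.anchors \ off) ∪ on
  let s ← setSparse s (s.sparse.deleteEdges {e | ∀ v ∈ e, v ∉ Φ})
  let s := { s with anchors := Φ }
  (P.order on).foldlM (fun s u => do
    Comp.chargeOps ((s.sparseNbhd G u).card + 1)
    pure { s with ref := Function.update s.ref u (s.sparseNbhd G u) }) s

/-- Clean, Anchor and Connect for all nodes of `𝓘`, and the end of the iteration. -/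
def processAll (P : Params) (G : NodeGraph) (s : State) (𝓘 : Finset ℕ) : Comp State := do
  let x ← (P.order 𝓘).foldlM (fun (acc : State × Finset ℕ × Finset ℕ) u => do
    let s ← clean P G acc.1 u
    let y ← anchor P G s u
    let s ← connect P G y.1 u
    pure (s, if y.2 then (insert u acc.2.1, acc.2.2) else (acc.2.1, insert u acc.2.2)))
    (s, ∅, ∅)
  finish P G x.1 x.2.1 x.2.2

/-- The iteration of the algorithm after the arrival of `u`; `G` is the graph with `u`. -/
def onArrival (P : Params) (G : NodeGraph) (s : State) (u : ℕ) : Comp State := do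
  let x ← refresh P G s.I u
  let y ← notifyLoop P G x.1 x.2
  processAll P G { s with I := y.1 } (insert u y.2)

/-- The iteration of the algorithm after the deletion of `u`; `G` is the graph without `u`.  The
node leaves all data structures, and the present nodes of `⋃ᵢ B^i_u` are notified. -/
def onDeletion (P : Params) (G : NodeGraph) (s : State) (u : ℕ) : Comp State := do
  Comp.chargeOps
    (1 + ∑ i ∈ Finset.range P.levels, ((s.I u i).card + (backSet G s.I u i).card))
  let R₀ := (Finset.range P.levels).biUnion (backSet G s.I u)
  let s ← setSparse s (s.sparse.deleteIncidenceSet u)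
  let y ← notifyLoop P G (Function.update s.I u (fun _ => ∅)) R₀
  processAll P G { s with I := y.1, anchors := s.anchors.erase u } y.2

/-! ### The whole execution -/

/-- An execution so far: the realized stream, the state of the algorithm, and the cost of each
update (`cost t` belongs to update number `t + 1`). -/
structure Run where
  history : History
  state : State
  cost : ℕ → Cost

/-- Before the first update. -/
def Run.initial : Run := ⟨[], State.initial, fun _ => Cost.zero⟩

/-- Record an update. -/
def Run.record (ω : Run) (e : Event) (c : Comp State) : PMF Run :=
  PMF.map (fun p => ⟨e :: ω.history, p.1, Function.update ω.cost ω.history.length p.2⟩) c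

/-- One update of the stream, chosen by the adversary, and the reaction of the algorithm.  A
deleted node is uniformly random among the present nodes. -/
def Run.next (P : Params) (adv : Adversary) (ω : Run) : PMF Run :=
  match adv ω.history with
  | .insert S =>
    ω.record (.arrival S)
      (onArrival P (graphOf (.arrival S :: ω.history)) ω.state (arrivals ω.history))
  | .delete =>
    if h : (graphOf ω.history).verts.Nonempty then
      (PMF.uniformOfFinset (graphOf ω.history).verts h).bind fun v =>
        ω.record (.deletion v)
          (onDeletion P (graphOf (.deletion v :: ω.history)) ω.state v)
    else PMF.pure ω

/-- The law of the execution during the first `T` updates. -/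
def execution (P : Params) (adv : Adversary) : ℕ → PMF Run
  | 0 => PMF.pure Run.initial
  | T + 1 => (execution P adv T).bind (Run.next P adv)

/-- The expectation of a natural number that depends on the execution. -/
def expect (p : PMF Run) (f : Run → ℕ) : ℝ≥0∞ := ∑' ω, p ω * (f ω : ℝ≥0∞)

end DynCC

end

/-! The cost of an update is the number of notified nodes times the cost of processing one of them.
A stored sample has at most `K = O(log n / ε)` nodes and a node stores at most `log n + 1` samples.
By double counting, a uniformly random deleted node therefore occurs in the samples of at most `K ^
2` nodes on average (`ex_load_le`), and each of these causes only `O(K ^ 2)` further refreshes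
(`sure_notifyPhase`). Processing `u` runs tests against the anchors in `Φ_u` and in `Φ_w` for
sampled neighbors `w`, plus an expected `O(K)` tests in case the coin makes `u` an anchor. So
everything rests on a polylogarithmic bound for `|Φ_u|` that holds with high probability.

Let `dl w` be the degree of `w` when it was last processed, that is, when its coin was last tossed.
The invariant `EdgeInv` says that for every sparse edge `wu` at an anchor `w` there was a time when
`w` was a neighbor of `u` and `u` had degree at most `16 * dl w + 16`. The nodes still present that
were neighbors of `u` while its degree was in `[2^j, 2^(j+1))` all belong to its neighborhood at the
last such time, so there are at most `2^(j+1)` of them (`exists_levelSet`). Those among them that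
the invariant allows have `dl w ≥ 2^(j-5)`, so their coins succeed with probability `O(log n / (ε
2^j))`. The notifications depend on the stored samples and never on the coins; hence an exponential
moment (`ex_bigAnchors_le`) leaves fewer than `K` anchors per level and at most `K ^ 2` in all
(`ex_not_sparsely_le`).

The invariant is threatened only when an anchor `w` gets a new edge after its degree has outgrown
`dl w`. Positive tests force `w` into a dense spot: most of its neighbors have degree at most about
`D = deg w`. By `Fresh`, such a node was processed with degree at least `D / 8`. To see this, fix
the whole stream and suppose that `w` was last processed with a smaller degree. Then at least `D /
4` of its final neighbors of low degree arrived later. While such a neighbor `x` has degree above `4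
* D`, more than half of its neighbors are still to be deleted, so its sample almost surely contains
one of them, and that deletion will notify `x` again. Samples of different levels are stored apart,
so this promise is not overwritten by refreshes at low degree. At some time `x` thus refreshes with
degree `O(D)`, and each of its `K` draws hits `w`, which causes `w` to be processed, with
probability `Ω(1 / D)`. That all these nodes miss `w` is very unlikely; formally, `missProb` to the
power of the number of waiting nodes is almost a supermartingale (`waiting_step`, `ex_waiting_le`).

The adversary does not see the coins, so given the stream the state has the law `stateLaw`
(`ex_execution`); the analysis is done stream by stream, and only the load is averaged over the
random deletion. All failure probabilities are polynomial multiples of `δ = n ^ (-100)`, which beats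
the polynomial worst-case costs. The remaining operations are amortized: the potential is the number
of sparse edges, an added edge is paid by the test that precedes it, and a deleted edge by the
potential (`amortized_stepC`). -/

noncomputable section
namespace DynCC

/-! ### Expectations with respect to a discrete law -/

/-- The expectation of `f` under `p`. -/
def ex {α : Type*} (p : PMF α) (f : α → ℝ≥0∞) : ℝ≥0∞ := ∑' a, p a * f a

open Classical in
/-- The indicator of a proposition. -/
def ind (Q : Prop) : ℝ≥0∞ := if Q then 1 else 0

lemma ind_of {Q : Prop} (h : Q) : ind Q = 1 := if_pos h
lemma ind_of_not {Q : Prop} (h : ¬ Q) : ind Q = 0 := if_neg h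
lemma ind_le_one (Q : Prop) : ind Q ≤ 1 := by unfold ind; split_ifs <;> simp
lemma ind_mono {Q R : Prop} (h : Q → R) : ind Q ≤ ind R := by
  by_cases hQ : Q
  · rw [ind_of (h hQ)]; exact ind_le_one Q
  · rw [ind_of_not hQ]; exact zero_le
lemma ind_or_le (Q R : Prop) : ind (Q ∨ R) ≤ ind Q + ind R := by
  by_cases hQ : Q <;> by_cases hR : R <;> simp [ind, hQ, hR]

section ex
variable {α β : Type*}

lemma ex_pure (a : α) (f : α → ℝ≥0∞) : ex (PMF.pure a) f = f a := by
  unfold ex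
  rw [tsum_eq_single a]
  · simp
  · intro b hb
    simp [PMF.pure_apply, hb]

lemma ex_bind (p : PMF α) (k : α → PMF β) (f : β → ℝ≥0∞) :
    ex (p.bind k) f = ex p fun a => ex (k a) f := by
  unfold ex
  simp only [PMF.bind_apply, ← ENNReal.tsum_mul_right, ← ENNReal.tsum_mul_left]
  rw [ENNReal.tsum_comm]
  simp only [mul_assoc]

lemma ex_map (p : PMF α) (g : α → β) (f : β → ℝ≥0∞) : ex (p.map g) f = ex p fun a => f (g a) := by
  rw [← PMF.bind_pure_comp, ex_bind]
  simp [ex_pure, Function.comp]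

lemma ex_mono_support {p : PMF α} {f g : α → ℝ≥0∞} (h : ∀ a ∈ p.support, f a ≤ g a) :
    ex p f ≤ ex p g := by
  refine ENNReal.tsum_le_tsum fun a => ?_
  by_cases ha : a ∈ p.support
  · gcongr
    exact h a ha
  · simp [(PMF.apply_eq_zero_iff p a).2 ha]

lemma ex_mono {p : PMF α} {f g : α → ℝ≥0∞} (h : ∀ a, f a ≤ g a) : ex p f ≤ ex p g :=
  ex_mono_support fun a _ => h a

lemma ex_congr_support {p : PMF α} {f g : α → ℝ≥0∞} (h : ∀ a ∈ p.support, f a = g a) :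
    ex p f = ex p g :=
  le_antisymm (ex_mono_support fun a ha => (h a ha).le) (ex_mono_support fun a ha => (h a ha).ge)

lemma ex_const (p : PMF α) (c : ℝ≥0∞) : ex p (fun _ => c) = c := by
  simp [ex, ENNReal.tsum_mul_right, p.tsum_coe]

lemma ex_add (p : PMF α) (f g : α → ℝ≥0∞) : ex p (fun a => f a + g a) = ex p f + ex p g := by
  simp [ex, mul_add, ENNReal.tsum_add]

lemma ex_const_mul (p : PMF α) (c : ℝ≥0∞) (f : α → ℝ≥0∞) :
    ex p (fun a => c * f a) = c * ex p f := by
  simp only [ex, ← ENNReal.tsum_mul_left]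
  congr 1; ext a; ring

lemma ex_mul_const (p : PMF α) (c : ℝ≥0∞) (f : α → ℝ≥0∞) :
    ex p (fun a => f a * c) = ex p f * c := by
  simp only [ex, ← ENNReal.tsum_mul_right]
  congr 1; ext a; ring

lemma ex_sum {ι : Type*} (p : PMF α) (s : Finset ι) (f : ι → α → ℝ≥0∞) :
    ex p (fun a => ∑ i ∈ s, f i a) = ∑ i ∈ s, ex p (f i) := by
  classical
  induction s using Finset.induction_on with
  | empty => simp [ex_const]
  | insert i s hi ih => simp only [Finset.sum_insert hi, ex_add, ih]

lemma ex_comm (p : PMF α) (q : PMF β) (f : α → β → ℝ≥0∞) :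
    ex p (fun a => ex q (f a)) = ex q fun b => ex p fun a => f a b := by
  simp only [ex, ← ENNReal.tsum_mul_left]
  rw [ENNReal.tsum_comm]
  congr 1; ext b; congr 1; ext a; ring

lemma ex_le_of_le {p : PMF α} {f : α → ℝ≥0∞} {c : ℝ≥0∞} (h : ∀ a ∈ p.support, f a ≤ c) :
    ex p f ≤ c :=
  (ex_mono_support h).trans_eq (ex_const p c)

lemma ex_uniformOfFinset (s : Finset α) (hs : s.Nonempty) (f : α → ℝ≥0∞) :
    ex (PMF.uniformOfFinset s hs) f = (∑ a ∈ s, f a) / s.card := by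
  unfold ex
  rw [tsum_eq_sum (s := s), div_eq_mul_inv, Finset.sum_mul]
  · refine Finset.sum_congr rfl fun a ha => ?_
    rw [PMF.uniformOfFinset_apply_of_mem hs ha, mul_comm]
  · intro a ha
    rw [PMF.uniformOfFinset_apply_of_notMem hs ha, zero_mul]

end ex

/-! ### Expectations of randomized computations -/

namespace Cost

/-- Calculations and queries together. -/
def cq (c : Cost) : ℕ := c.calcs + c.query

@[simp] lemma cq_zero : zero.cq = 0 := rfl
@[simp] lemma cq_add (a b : Cost) : (a.add b).cq = a.cq + b.cq := by
  simp [cq, add]; omega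
@[simp] lemma ops_zero : zero.ops = 0 := rfl
@[simp] lemma ops_add (a b : Cost) : (a.add b).ops = a.ops + b.ops := rfl
@[simp] lemma cq_mk (a b c : ℕ) : (Cost.mk a b c).cq = a + b := rfl

end Cost

namespace Comp
variable {α β σ : Type}

/-- The expectation of a function of the value and the cost. -/
def wp (c : Comp α) (f : α → Cost → ℝ≥0∞) : ℝ≥0∞ :=
  ex (show PMF (α × Cost) from c) fun p => f p.1 p.2

/-- The expectation of a function of the value. -/
def ev (c : Comp α) (f : α → ℝ≥0∞) : ℝ≥0∞ := c.wp fun a _ => f a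

/-- The expected number of calculations plus the expected cost of the queries. -/
def ec (c : Comp α) : ℝ≥0∞ := c.wp fun _ k => (k.cq : ℝ≥0∞)

/-- `Q` holds with certainty. -/
def Sure (c : Comp α) (Q : α → Cost → Prop) : Prop :=
  ∀ p ∈ PMF.support (show PMF (α × Cost) from c), Q p.1 p.2

/-- The probability that the value satisfies `Q`. -/
def pr (c : Comp α) (Q : α → Prop) : ℝ≥0∞ := c.ev fun a => ind (Q a)

lemma wp_pure (a : α) (f : α → Cost → ℝ≥0∞) : wp (pure a : Comp α) f = f a Cost.zero :=
  ex_pure (a, Cost.zero) _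

lemma wp_bind (c : Comp α) (k : α → Comp β) (f : β → Cost → ℝ≥0∞) :
    wp (c >>= k) f = wp c fun a c₁ => wp (k a) fun b c₂ => f b (c₁.add c₂) := by
  unfold wp
  refine (ex_bind _ _ _).trans ?_
  congr 1
  ext p
  exact ex_map _ _ _

lemma wp_charge (k : Cost) (f : Unit → Cost → ℝ≥0∞) : wp (charge k) f = f () k :=
  ex_pure ((), k) _

lemma wp_sample (p : PMF α) (f : α → Cost → ℝ≥0∞) :
    wp (sample p) f = ex p fun a => f a Cost.zero :=
  ex_map _ _ _

lemma wp_mono {c : Comp α} {f g : α → Cost → ℝ≥0∞} (h : ∀ a k, f a k ≤ g a k) :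
    wp c f ≤ wp c g := ex_mono fun p => h p.1 p.2

lemma wp_mono_sure {c : Comp α} {f g : α → Cost → ℝ≥0∞} {Q : α → Cost → Prop} (hQ : c.Sure Q)
    (h : ∀ a k, Q a k → f a k ≤ g a k) : wp c f ≤ wp c g :=
  ex_mono_support fun p hp => h p.1 p.2 (hQ p hp)

lemma wp_const (c : Comp α) (r : ℝ≥0∞) : wp c (fun _ _ => r) = r := ex_const _ _

lemma wp_add (c : Comp α) (f g : α → Cost → ℝ≥0∞) :
    wp c (fun a k => f a k + g a k) = wp c f + wp c g := ex_add _ _ _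

lemma wp_const_mul (c : Comp α) (r : ℝ≥0∞) (f : α → Cost → ℝ≥0∞) :
    wp c (fun a k => r * f a k) = r * wp c f := ex_const_mul _ _ _

lemma ev_pure (a : α) (f : α → ℝ≥0∞) : ev (pure a : Comp α) f = f a := wp_pure a _

lemma ev_bind (c : Comp α) (k : α → Comp β) (f : β → ℝ≥0∞) :
    ev (c >>= k) f = ev c fun a => ev (k a) f := wp_bind c k _

lemma ev_charge (k : Cost) (f : Unit → ℝ≥0∞) : ev (charge k) f = f () := wp_charge k _

lemma ev_sample (p : PMF α) (f : α → ℝ≥0∞) : ev (sample p) f = ex p f := wp_sample p _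

lemma ev_mono {c : Comp α} {f g : α → ℝ≥0∞} (h : ∀ a, f a ≤ g a) : ev c f ≤ ev c g :=
  wp_mono fun a _ => h a

lemma ev_mono_sure {c : Comp α} {f g : α → ℝ≥0∞} {Q : α → Cost → Prop} (hQ : c.Sure Q)
    (h : ∀ a k, Q a k → f a ≤ g a) : ev c f ≤ ev c g :=
  wp_mono_sure hQ fun a k => h a k

lemma ev_const (c : Comp α) (r : ℝ≥0∞) : ev c (fun _ => r) = r := wp_const _ _

lemma ev_add (c : Comp α) (f g : α → ℝ≥0∞) :
    ev c (fun a => f a + g a) = ev c f + ev c g := wp_add _ _ _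

lemma ev_const_mul (c : Comp α) (r : ℝ≥0∞) (f : α → ℝ≥0∞) :
    ev c (fun a => r * f a) = r * ev c f := wp_const_mul _ _ _

lemma ev_mul_const (c : Comp α) (r : ℝ≥0∞) (f : α → ℝ≥0∞) :
    ev c (fun a => f a * r) = ev c f * r := ex_mul_const _ _ _

lemma ev_le_of_sure {c : Comp α} {f : α → ℝ≥0∞} {Q : α → Cost → Prop} {r : ℝ≥0∞} (hQ : c.Sure Q)
    (h : ∀ a k, Q a k → f a ≤ r) : ev c f ≤ r :=
  (ev_mono_sure hQ h).trans_eq (ev_const c r)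

lemma ev_le {c : Comp α} {f : α → ℝ≥0∞} {r : ℝ≥0∞} (h : ∀ a, f a ≤ r) : ev c f ≤ r :=
  (ev_mono h).trans_eq (ev_const c r)

lemma ec_pure (a : α) : ec (pure a : Comp α) = 0 := by
  simp [ec, wp_pure]

lemma ec_bind (c : Comp α) (k : α → Comp β) : ec (c >>= k) = ec c + ev c fun a => ec (k a) := by
  simp only [ec, ev, wp_bind, Cost.cq_add, Nat.cast_add, wp_add, wp_const]

lemma ec_charge (k : Cost) : ec (charge k) = k.cq := wp_charge k _

lemma ec_sample (p : PMF α) : ec (sample p) = 0 := by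
  simp [ec, wp_sample, ex_const]

lemma ec_le_of_sure {c : Comp α} {b : ℕ} (h : c.Sure fun _ k => k.cq ≤ b) : ec c ≤ b := by
  refine (wp_mono_sure h (g := fun _ _ => (b : ℝ≥0∞)) ?_).trans_eq (wp_const _ _)
  intro a k hk
  exact_mod_cast hk

/-! ### Assertions that hold with certainty. -/

section Sure

lemma Sure.mono {c : Comp α} {Q R : α → Cost → Prop} (h : c.Sure Q) (hQR : ∀ a k, Q a k → R a k) :
    c.Sure R := fun p hp => hQR _ _ (h p hp)

lemma sure_true (c : Comp α) : c.Sure fun _ _ => True := fun _ _ => trivial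

lemma sure_pure {a : α} {Q : α → Cost → Prop} (h : Q a Cost.zero) : Sure (pure a : Comp α) Q := by
  intro p hp
  have : p = (a, Cost.zero) := (PMF.mem_support_pure_iff _ _).1 hp
  subst this
  exact h

lemma sure_charge {k : Cost} {Q : Unit → Cost → Prop} (h : Q () k) : Sure (charge k) Q := by
  intro p hp
  have : p = ((), k) := (PMF.mem_support_pure_iff _ _).1 hp
  subst this
  exact h

lemma sure_sample {p : PMF α} {Q : α → Cost → Prop} (h : ∀ a ∈ p.support, Q a Cost.zero) :
    Sure (sample p) Q := by
  intro x hx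
  obtain ⟨a, ha, rfl⟩ := (PMF.mem_support_map_iff _ _ _).1 hx
  exact h a ha

lemma sure_bind {c : Comp α} {k : α → Comp β} {Q : β → Cost → Prop}
    (h : c.Sure fun a c₁ => (k a).Sure fun b c₂ => Q b (c₁.add c₂)) : Sure (c >>= k) Q := by
  intro p hp
  obtain ⟨q, hq, hp⟩ := (PMF.mem_support_bind_iff _ _ _).1 hp
  obtain ⟨r, hr, rfl⟩ := (PMF.mem_support_map_iff _ _ _).1 hp
  exact h q hq r hr

/-- Sequencing with an intermediate assertion that does not mention the cost. -/
lemma sure_bind_val {c : Comp α} {k : α → Comp β} {R : α → Prop} {Q : β → Prop}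
    (h : c.Sure fun a _ => R a) (h' : ∀ a, R a → (k a).Sure fun b _ => Q b) :
    Sure (c >>= k) fun b _ => Q b :=
  sure_bind (h.mono fun a _ ha => h' a ha)

/-- The assertion is indexed by the elements that are still to be treated, so that it can record
which ones are done. -/
lemma sure_foldlM {f : σ → α → Comp σ} {R : List α → σ → Prop}
    (h : ∀ a l s, R (a :: l) s → (f s a).Sure fun s' _ => R l s') (l : List α) (s : σ)
    (hs : R l s) : (l.foldlM f s).Sure fun s' _ => R [] s' := by
  induction l generalizing s with
  | nil => exact sure_pure hs
  | cons a l ih =>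
    rw [List.foldlM_cons]
    exact sure_bind_val (h a l s hs) fun s' hs' => ih s' hs'

/-- An assertion on the value that every step preserves. -/
lemma sure_foldlM_inv {f : σ → α → Comp σ} {R : σ → Prop} {l : List α}
    (h : ∀ a ∈ l, ∀ s, R s → (f s a).Sure fun s' _ => R s') {s : σ}
    (hs : R s) : (l.foldlM f s).Sure fun s' _ => R s' := by
  have := sure_foldlM (f := f) (R := fun l' s => (∀ a ∈ l', a ∈ l) ∧ R s)
    (fun a l' s hR => (h a (hR.1 a (by simp)) s hR.2).mono fun s' _ hs' =>
      ⟨fun b hb => hR.1 b (by simp [hb]), hs'⟩) l s ⟨fun _ h => h, hs⟩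
  exact this.mono fun _ _ h => h.2

end Sure

/-! ### Failure probabilities and expected costs of loops. -/

section pr

lemma pr_le_one (c : Comp α) (Q : α → Prop) : c.pr Q ≤ 1 := ev_le fun _ => ind_le_one _

lemma pr_mono {c : Comp α} {Q R : α → Prop} (h : ∀ a, Q a → R a) : c.pr Q ≤ c.pr R :=
  ev_mono fun a => ind_mono (h a)

lemma pr_eq_zero_of_sure {c : Comp α} {Q : α → Prop} (h : c.Sure fun a _ => ¬ Q a) :
    c.pr Q = 0 :=
  le_antisymm (ev_le_of_sure h fun _ _ ha => (ind_of_not ha).le) zero_le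

lemma pr_mono_sure {c : Comp α} {Q R : α → Prop} {S : α → Cost → Prop} (hS : c.Sure S)
    (h : ∀ a k, S a k → Q a → R a) : c.pr Q ≤ c.pr R :=
  ev_mono_sure hS fun a k hk => ind_mono (h a k hk)

/-- The union bound for sequential composition. -/
lemma pr_bind_le {c : Comp α} {k : α → Comp β} {R : α → Prop} {Q : β → Prop} {δ₁ δ₂ : ℝ≥0∞}
    (h : c.pr (fun a => ¬ R a) ≤ δ₁) (h' : ∀ a, R a → (k a).pr Q ≤ δ₂) :
    (c >>= k).pr Q ≤ δ₁ + δ₂ := by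
  unfold pr at h ⊢
  rw [ev_bind]
  calc _ ≤ ev c (fun a => ind (¬ R a) + δ₂) := by
        refine ev_mono fun a => ?_
        by_cases hR : R a
        · exact (h' a hR).trans le_add_self
        · rw [ind_of hR]; exact (pr_le_one (k a) _).trans le_self_add
    _ ≤ _ := by
        rw [ev_add, ev_const]
        gcongr

/-- The same for an intermediate assertion that holds with certainty. -/
lemma pr_bind_sure {c : Comp α} {k : α → Comp β} {R : α → Cost → Prop} {Q : β → Prop} {δ : ℝ≥0∞}
    (h : c.Sure R) (h' : ∀ a m, R a m → (k a).pr Q ≤ δ) :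
    (c >>= k).pr Q ≤ δ := by
  unfold pr
  rw [ev_bind]
  exact ev_le_of_sure h h'

lemma pr_pure_le {a : α} {Q : α → Prop} (h : ¬ Q a) (δ : ℝ≥0∞) : (pure a : Comp α).pr Q ≤ δ := by
  simp [pr, ev_pure, ind_of_not h]

/-- The union bound over the steps of a loop. -/
lemma pr_foldlM_le {f : σ → α → Comp σ} {J : List α → σ → Prop} {δ : ℝ≥0∞}
    (h : ∀ a l s, J (a :: l) s → (f s a).pr (fun s' => ¬ J l s') ≤ δ) (l : List α) (s : σ)
    (hs : J l s) : (l.foldlM f s).pr (fun s' => ¬ J [] s') ≤ l.length * δ := by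
  induction l generalizing s with
  | nil => exact pr_pure_le (Q := fun s' => ¬ J [] s') (not_not.2 hs) _
  | cons a l ih =>
    rw [List.foldlM_cons]
    refine (pr_bind_le (h a l s hs) fun s' hs' => ih s' hs').trans_eq ?_
    rw [List.length_cons]; push_cast; ring

lemma ec_foldlM_le {f : σ → α → Comp σ} {B : ℝ≥0∞} (hB : ∀ s a, (f s a).ec ≤ B) (l : List α)
    (s : σ) : (l.foldlM f s).ec ≤ l.length * B := by
  induction l generalizing s with
  | nil => exact (ec_pure s).trans_le (zero_le)
  | cons a l ih =>
    rw [List.foldlM_cons, ec_bind]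
    refine (add_le_add (hB s a) (ev_le fun s' => ih s')).trans_eq ?_
    rw [List.length_cons]; push_cast; ring

/-- The expected cost of a loop whose steps are cheap under an invariant that fails rarely. -/
lemma ec_foldlM_le_of_inv {f : σ → α → Comp σ} {J : List α → σ → Prop} {δ b B : ℝ≥0∞}
    (hB : ∀ s a, (f s a).ec ≤ B)
    (hb : ∀ a l s, J (a :: l) s → (f s a).ec ≤ b)
    (h : ∀ a l s, J (a :: l) s → (f s a).pr (fun s' => ¬ J l s') ≤ δ) (l : List α) (s : σ)
    (hs : J l s) {N : ℕ} (hN : l.length ≤ N) :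
    (l.foldlM f s).ec ≤ l.length * (b + N * δ * B) := by
  induction l generalizing s with
  | nil => exact (ec_pure s).trans_le (zero_le)
  | cons a l ih =>
    rw [List.foldlM_cons, ec_bind]
    have hN' : l.length ≤ N := by simp at hN; omega
    -- Once the invariant is broken nothing is known, and all remaining steps, at most `N`, are
    -- charged their worst cost `B`.
    have : (f s a).ev (fun s' => (l.foldlM f s').ec) ≤
        (f s a).ev (fun s' => l.length * (b + N * δ * B) + N * B * ind (¬ J l s')) := by
      refine ev_mono fun s' => ?_
      by_cases hJ : J l s'
      · exact (ih s' hJ hN').trans le_self_add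
      · rw [ind_of hJ, mul_one]
        refine (ec_foldlM_le hB l s').trans ?_
        refine le_trans ?_ le_add_self
        gcongr
    rw [ev_add, ev_const, ev_const_mul] at this
    refine (add_le_add (hb a l s hs) (this.trans (add_le_add le_rfl
      (mul_le_mul_right (h a l s hs) _)))).trans_eq ?_
    rw [List.length_cons]; push_cast; ring

end pr

/-- The amortized expected number of operations, for a potential that is `V₀` before and `V`
after the computation, is at most `γ` times the expected cost of calculations and queries. -/
def Amortized (c : Comp α) (V₀ : ℝ≥0∞) (V : α → ℝ≥0∞) (γ : ℝ≥0∞) : Prop :=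
  (c.wp fun a k => (k.ops : ℝ≥0∞) + V a) ≤ V₀ + γ * c.ec

lemma Amortized.bind_sure {c : Comp α} {k : α → Comp β} {V₀ γ : ℝ≥0∞} {V₁ : α → ℝ≥0∞}
    {V₂ : β → ℝ≥0∞} {R : α → Cost → Prop}
    (h : c.Amortized V₀ V₁ γ) (hR : c.Sure R) (h' : ∀ a m, R a m → (k a).Amortized (V₁ a) V₂ γ) :
    (c >>= k).Amortized V₀ V₂ γ := by
  unfold Amortized at *
  rw [wp_bind, ec_bind]
  calc _ = c.wp (fun a k₁ => (k₁.ops : ℝ≥0∞) + (k a).wp fun b k₂ => (k₂.ops : ℝ≥0∞) + V₂ b) := by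
        simp only [Cost.ops_add, Nat.cast_add, add_assoc, wp_add, wp_const]
    _ ≤ c.wp (fun a k₁ => ((k₁.ops : ℝ≥0∞) + V₁ a) + γ * (k a).ec) :=
        wp_mono_sure hR fun a k₁ hk => by
          rw [add_assoc]
          gcongr
          exact h' a k₁ hk
    _ = (c.wp fun a k => (k.ops : ℝ≥0∞) + V₁ a) + γ * c.ev fun a => (k a).ec := by
        rw [wp_add, wp_const_mul]; rfl
    _ ≤ V₀ + γ * c.ec + γ * c.ev fun a => (k a).ec := by gcongr
    _ = _ := by ring

lemma Amortized.bind {c : Comp α} {k : α → Comp β} {V₀ γ : ℝ≥0∞} {V₁ : α → ℝ≥0∞} {V₂ : β → ℝ≥0∞}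
    (h : c.Amortized V₀ V₁ γ) (h' : ∀ a, (k a).Amortized (V₁ a) V₂ γ) :
    (c >>= k).Amortized V₀ V₂ γ :=
  h.bind_sure (sure_true c) fun a _ _ => h' a

lemma Amortized.mono {c : Comp α} {V₀ V₀' γ γ' : ℝ≥0∞} {V V' : α → ℝ≥0∞}
    (h : c.Amortized V₀ V γ) (h₀ : V₀ ≤ V₀') (hV : ∀ a, V' a ≤ V a) (hγ : γ ≤ γ') :
    c.Amortized V₀' V' γ' := by
  unfold Amortized at *
  refine (wp_mono fun a k => ?_).trans (h.trans ?_)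
  · gcongr; exact hV a
  · gcongr

lemma amortized_pure {a : α} {V₀ γ : ℝ≥0∞} {V : α → ℝ≥0∞} (h : V a ≤ V₀) :
    (pure a : Comp α).Amortized V₀ V γ := by
  unfold Amortized
  rw [wp_pure, ec_pure]
  simpa using h

lemma amortized_foldlM {f : σ → α → Comp σ} {γ : ℝ≥0∞} {V : σ → ℝ≥0∞} {l : List α}
    (h : ∀ s, ∀ a ∈ l, (f s a).Amortized (V s) V γ) (s : σ) :
    (l.foldlM f s).Amortized (V s) V γ := by
  induction l generalizing s with
  | nil => exact amortized_pure le_rfl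
  | cons a l ih =>
    rw [List.foldlM_cons]
    exact (h s a (by simp)).bind fun s' => ih (fun s b hb => h s b (by simp [hb])) s'

/-- A computation that pays no operations and does not touch the potential. -/
lemma amortized_of_ops_eq_zero {c : Comp α} {V₀ γ : ℝ≥0∞} (h : c.Sure fun _ k => k.ops = 0) :
    c.Amortized V₀ (fun _ => V₀) γ := by
  unfold Amortized
  refine (wp_mono_sure h (g := fun _ _ => V₀) fun a k hk => by simp [hk]).trans ?_
  rw [wp_const]
  exact le_self_add

end Comp
end DynCC
end

noncomputable section
namespace DynCC

/-! ### The graphs of a stream -/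

lemma NodeGraph.mem_nbhd {G : NodeGraph} {u v : ℕ} : v ∈ G.nbhd u ↔ v ∈ G.verts ∧ G.graph.Adj u v := by
  simp [NodeGraph.nbhd]

lemma NodeGraph.nbhd_subset (G : NodeGraph) (u : ℕ) : G.nbhd u ⊆ G.verts := fun _ h =>
  (NodeGraph.mem_nbhd.1 h).1

lemma NodeGraph.deg_le_card (G : NodeGraph) (u : ℕ) : G.deg u ≤ G.verts.card :=
  Finset.card_le_card (G.nbhd_subset u)

/-- Edges join present nodes. -/
def NodeGraph.Wf (G : NodeGraph) : Prop := ∀ a b, G.graph.Adj a b → a ∈ G.verts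

lemma NodeGraph.Wf.mem_nbhd {G : NodeGraph} (hG : G.Wf) {u v : ℕ} :
    v ∈ G.nbhd u ↔ G.graph.Adj u v := by
  rw [NodeGraph.mem_nbhd]
  exact ⟨fun h => h.2, fun h => ⟨hG v u h.symm, h⟩⟩

/-- The streams in which at most `n` nodes arrive and only present nodes are deleted. -/
def Valid (n : ℕ) : History → Prop
  | [] => True
  | .arrival _ :: h => Valid n h ∧ arrivals h < n
  | .deletion v :: h => Valid n h ∧ v ∈ (graphOf h).verts

section
variable {n : ℕ} {e : Event} {h h' : History} {x y : ℕ}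

lemma Valid.tail (hv : Valid n (e :: h)) : Valid n h := by
  cases e <;> exact hv.1

lemma Valid.suffix (hv : Valid n h) (hs : h' <:+ h) : Valid n h' := by
  induction h with
  | nil => rw [List.suffix_nil.1 hs]; trivial
  | cons e h ih =>
    rcases List.suffix_cons_iff.1 hs with rfl | hs
    · exact hv
    · exact ih hv.tail hs

lemma graphOf_adj_arrival {S : Finset ℕ} : (graphOf (.arrival S :: h)).graph.Adj x y ↔
    (graphOf h).graph.Adj x y ∨
      (x ≠ y ∧ ∃ w ∈ S ∩ (graphOf h).verts, s(x, y) = s(arrivals h, w)) := by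
  simp only [graphOf, NodeGraph.insertNode, SimpleGraph.sup_adj, SimpleGraph.fromEdgeSet_adj,
    Set.mem_ofPred_eq]
  tauto

lemma graphOf_verts_arrival {S : Finset ℕ} :
    (graphOf (.arrival S :: h)).verts = insert (arrivals h) (graphOf h).verts := rfl

lemma graphOf_adj_deletion {v : ℕ} : (graphOf (.deletion v :: h)).graph.Adj x y ↔
    (graphOf h).graph.Adj x y ∧ x ≠ v ∧ y ≠ v := by
  simp only [graphOf, NodeGraph.deleteNode, SimpleGraph.deleteIncidenceSet_adj]

lemma graphOf_verts_deletion {v : ℕ} :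
    (graphOf (.deletion v :: h)).verts = (graphOf h).verts.erase v := rfl

lemma Valid.lt_arrivals (hv : Valid n h) (hx : x ∈ (graphOf h).verts) : x < arrivals h := by
  induction h with
  | nil => simp [graphOf, NodeGraph.empty] at hx
  | cons e h ih =>
    cases e with
    | arrival S =>
      rw [graphOf_verts_arrival, Finset.mem_insert] at hx
      rcases hx with rfl | hx
      · exact Nat.lt_succ_self _
      · exact (ih hv.tail hx).trans (Nat.lt_succ_self _)
    | deletion v => exact ih hv.tail (Finset.mem_of_mem_erase hx)

lemma Valid.wf (hv : Valid n h) : (graphOf h).Wf := by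
  induction h with
  | nil => intro a b hab; simp [graphOf, NodeGraph.empty] at hab
  | cons e h ih =>
    intro a b hab
    cases e with
    | arrival S =>
      rw [graphOf_verts_arrival, Finset.mem_insert]
      rcases graphOf_adj_arrival.1 hab with hab | ⟨_, w, hw, hs⟩
      · exact Or.inr (ih hv.tail a b hab)
      · rcases Sym2.eq_iff.1 hs with ⟨rfl, _⟩ | ⟨rfl, _⟩
        · exact Or.inl rfl
        · exact Or.inr (Finset.mem_inter.1 hw).2
    | deletion v =>
      obtain ⟨hab, ha, _⟩ := graphOf_adj_deletion.1 hab
      exact Finset.mem_erase.2 ⟨ha, ih hv.tail a b hab⟩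

lemma Valid.arrivals_le (hv : Valid n h) : arrivals h ≤ n := by
  induction h with
  | nil => exact Nat.zero_le _
  | cons e h ih =>
    cases e with
    | arrival S => exact hv.2
    | deletion v => exact ih hv.tail

lemma Valid.lt (hv : Valid n h) (hx : x ∈ (graphOf h).verts) : x < n :=
  (hv.lt_arrivals hx).trans_le hv.arrivals_le

lemma Valid.verts_subset (hv : Valid n h) : (graphOf h).verts ⊆ Finset.range n := fun _ hx =>
  Finset.mem_range.2 (hv.lt hx)

lemma Valid.card_le (hv : Valid n h) : (graphOf h).verts.card ≤ n := by
  simpa using Finset.card_le_card hv.verts_subset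

lemma Valid.deg_le (hv : Valid n h) (u : ℕ) : (graphOf h).deg u ≤ n :=
  ((graphOf h).deg_le_card u).trans hv.card_le

lemma Valid.notMem_verts (hv : Valid n h) : arrivals h ∉ (graphOf h).verts := fun hx =>
  (hv.lt_arrivals hx).false

/-- Each arrival adds one to the length and to the number of present nodes; each deletion moves one
from the latter to the former. It follows that a stream has at most `2 * n` updates, so a union
bound over time is affordable. -/
lemma Valid.length_add (hv : Valid n h) :
    h.length + (graphOf h).verts.card = 2 * arrivals h := by
  induction h with
  | nil => rfl
  | cons e h ih =>
    have := ih hv.tail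
    cases e with
    | arrival S =>
      rw [graphOf_verts_arrival, Finset.card_insert_of_notMem hv.tail.notMem_verts]
      simp only [List.length_cons, arrivals]
      omega
    | deletion v =>
      have hc := Finset.card_erase_add_one hv.2
      rw [graphOf_verts_deletion]
      simp only [List.length_cons, arrivals]
      omega

lemma Valid.length_le (hv : Valid n h) : h.length ≤ 2 * n := by
  have := hv.length_add
  have := hv.arrivals_le
  omega

lemma arrivals_mono (hs : h' <:+ h) : arrivals h' ≤ arrivals h := by
  induction h with
  | nil => rw [List.suffix_nil.1 hs]
  | cons e h ih =>
    rcases List.suffix_cons_iff.1 hs with rfl | hs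
    · exact le_rfl
    · refine (ih hs).trans ?_
      cases e
      · exact Nat.le_succ _
      · exact le_rfl

lemma mem_verts_cons (hx : x ∈ (graphOf (e :: h)).verts) :
    x ∈ (graphOf h).verts ∨ ((∃ S, e = .arrival S) ∧ x = arrivals h) := by
  cases e with
  | arrival S =>
    rw [graphOf_verts_arrival, Finset.mem_insert] at hx
    rcases hx with rfl | hx
    · exact Or.inr ⟨⟨S, rfl⟩, rfl⟩
    · exact Or.inl hx
  | deletion v => exact Or.inl (Finset.mem_of_mem_erase hx)

/-- A present node that had arrived at an earlier time was present then. -/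
lemma mem_verts_of_suffix (hs : h' <:+ h) (hx : x ∈ (graphOf h).verts)
    (hx' : x < arrivals h') : x ∈ (graphOf h').verts := by
  induction h with
  | nil => rwa [List.suffix_nil.1 hs]
  | cons e h ih =>
    rcases List.suffix_cons_iff.1 hs with rfl | hs
    · exact hx
    · rcases mem_verts_cons hx with hx | ⟨_, rfl⟩
      · exact ih hs hx
      · exact absurd (arrivals_mono hs) (not_le.2 hx')

lemma adj_cons_iff (hv : Valid n (e :: h)) (hx : x ∈ (graphOf h).verts)
    (hy : y ∈ (graphOf h).verts) (hx' : x ∈ (graphOf (e :: h)).verts)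
    (hy' : y ∈ (graphOf (e :: h)).verts) :
    (graphOf (e :: h)).graph.Adj x y ↔ (graphOf h).graph.Adj x y := by
  cases e with
  | arrival S =>
    rw [graphOf_adj_arrival]
    refine ⟨fun hxy => hxy.resolve_right ?_, Or.inl⟩
    rintro ⟨_, w, _, hs⟩
    rcases Sym2.eq_iff.1 hs with ⟨rfl, _⟩ | ⟨_, rfl⟩
    · exact hv.tail.notMem_verts hx
    · exact hv.tail.notMem_verts hy
  | deletion v =>
    rw [graphOf_adj_deletion]
    exact ⟨fun hxy => hxy.1, fun hxy => ⟨hxy, Finset.ne_of_mem_erase hx', Finset.ne_of_mem_erase hy'⟩⟩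

/-- The adjacency of two nodes does not change while both are present. -/
lemma adj_suffix_iff (hv : Valid n h) (hs : h' <:+ h) (hx : x ∈ (graphOf h).verts)
    (hy : y ∈ (graphOf h).verts) (hx' : x ∈ (graphOf h').verts) (hy' : y ∈ (graphOf h').verts) :
    (graphOf h).graph.Adj x y ↔ (graphOf h').graph.Adj x y := by
  have hv' := hv.suffix hs
  induction h with
  | nil => rw [List.suffix_nil.1 hs]
  | cons e h ih =>
    rcases List.suffix_cons_iff.1 hs with rfl | hs₁
    · rfl
    · have hs₂ : h <:+ e :: h := List.suffix_cons e h
      have hx₁ := mem_verts_of_suffix hs₂ hx ((hv'.lt_arrivals hx').trans_le (arrivals_mono hs₁))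
      have hy₁ := mem_verts_of_suffix hs₂ hy ((hv'.lt_arrivals hy').trans_le (arrivals_mono hs₁))
      rw [adj_cons_iff hv hx₁ hy₁ hx hy]
      exact ih hv.tail hs₁ hx₁ hy₁

/-- One update changes the degree of a node that stays by at most one. -/
lemma deg_le_deg_cons_add_one (hv : Valid n (e :: h)) (hx : x ∈ (graphOf h).verts)
    (hx' : x ∈ (graphOf (e :: h)).verts) :
    (graphOf h).deg x ≤ (graphOf (e :: h)).deg x + 1 := by
  have key : ∀ v, (∀ y ∈ (graphOf h).verts, y ≠ v → y ∈ (graphOf (e :: h)).verts) →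
      (graphOf h).deg x ≤ (graphOf (e :: h)).deg x + 1 := by
    intro v hvv
    have : (graphOf h).nbhd x ⊆ insert v ((graphOf (e :: h)).nbhd x) := by
      intro y hy
      by_cases hyv : y = v
      · simp [hyv]
      · refine Finset.mem_insert_of_mem ?_
        have hy₁ := NodeGraph.mem_nbhd.1 hy
        have hy₂ := hvv y hy₁.1 hyv
        exact NodeGraph.mem_nbhd.2 ⟨hy₂, (adj_cons_iff hv hx hy₁.1 hx' hy₂).2 hy₁.2⟩
    exact (Finset.card_le_card this).trans (Finset.card_insert_le _ _)
  cases e with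
  -- An arrival removes no node, so the exceptional node is a dummy.
  | arrival S => exact key 0 fun y hy _ => Finset.mem_insert_of_mem hy
  | deletion v => exact key v fun y hy hyv => Finset.mem_erase.2 ⟨hyv, hy⟩

/-- A neighbor after an update is the arriving node or was a neighbor before. -/
lemma nbhd_cons_subset (hv : Valid n (e :: h)) (hx : x ∈ (graphOf h).verts)
    (hx' : x ∈ (graphOf (e :: h)).verts) :
    (graphOf (e :: h)).nbhd x ⊆ insert (arrivals h) ((graphOf h).nbhd x) := by
  intro y hy
  have hy₁ := NodeGraph.mem_nbhd.1 hy
  rcases mem_verts_cons hy₁.1 with hy₂ | ⟨_, rfl⟩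
  · exact Finset.mem_insert_of_mem (NodeGraph.mem_nbhd.2 ⟨hy₂, (adj_cons_iff hv hx hy₂ hx' hy₁.1).1 hy₁.2⟩)
  · simp

/-- The neighbors at an earlier time that are still present are neighbors of a node that is still
present. -/
lemma mem_nbhd_of_suffix (hv : Valid n h) (hs : h' <:+ h) (hx : x ∈ (graphOf h).verts)
    (hy : y ∈ (graphOf h).verts) (hxy : y ∈ (graphOf h').nbhd x) : y ∈ (graphOf h).nbhd x := by
  have hwf := (hv.suffix hs).wf
  have hxy' := hwf.mem_nbhd.1 hxy
  exact hv.wf.mem_nbhd.2 ((adj_suffix_iff hv hs hx hy (hwf _ _ hxy') (hwf _ _ hxy'.symm)).2 hxy')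

end

/-- The sample sizes and the logarithms are all at most the size of the stored samples. -/
structure Sizes (P : Params) : Prop where
  two_le : 2 ≤ P.n
  eps_pos : 0 < P.ε
  eps_lt : P.ε < 1 / 1000
  order : P.OrderOK

namespace Params

/-- The size of the stored samples. -/
def K (P : Params) : ℕ := P.size (10 ^ 10)

end Params

/-! ### Comparison of the sample sizes with the logarithm of `n`. -/

namespace Sizes
variable {P : Params}

lemma one_le_logb (hP : Sizes P) : 1 ≤ Real.logb 2 P.n := by
  rw [Real.le_logb_iff_rpow_le (by norm_num) (by have := hP.two_le; positivity)]
  simpa using (by exact_mod_cast hP.two_le : (2 : ℝ) ≤ P.n)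

lemma logb_le (hP : Sizes P) {c : ℝ} (hc : 0 ≤ c) :
    1000 * c * Real.logb 2 P.n ≤ c * Real.logb 2 P.n / P.ε := by
  rw [le_div_iff₀ hP.eps_pos]
  have := hP.one_le_logb
  have := hP.eps_lt
  have h : 0 ≤ c * Real.logb 2 P.n := by positivity
  nlinarith

lemma le_size (P : Params) (c : ℝ) : c * Real.logb 2 P.n / P.ε ≤ P.size c := Nat.le_ceil _

lemma logb_le_size (hP : Sizes P) {c : ℝ} (hc : 0 ≤ c) :
    1000 * c * Real.logb 2 P.n ≤ P.size c := (hP.logb_le hc).trans (le_size P c)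

lemma logb_le_K (hP : Sizes P) : 10 ^ 13 * Real.logb 2 P.n ≤ P.K := by
  have := hP.logb_le_size (c := 10 ^ 10) (by positivity)
  unfold Params.K
  linarith

lemma natLog_add_one_le (hP : Sizes P) {m : ℕ} (hm : m ≤ P.n) : Nat.log 2 m + 1 ≤ P.K := by
  have h₁ : Nat.log 2 m ≤ Nat.log 2 P.n := Nat.log_mono_right hm
  have h₂ : (Nat.log 2 P.n : ℝ) ≤ Real.logb 2 P.n := Real.natLog_le_logb _ _
  have h₃ := hP.logb_le_K
  have h₄ := hP.one_le_logb
  have : ((Nat.log 2 P.n + 1 : ℕ) : ℝ) ≤ P.K := by push_cast; nlinarith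
  have : Nat.log 2 P.n + 1 ≤ P.K := by exact_mod_cast this
  omega

lemma levels_le (hP : Sizes P) : P.levels ≤ P.K := hP.natLog_add_one_le le_rfl

lemma size_le_K (hP : Sizes P) {c : ℝ} (hc : c ≤ 10 ^ 10) : P.size c ≤ P.K := by
  unfold Params.K Params.size
  refine Nat.ceil_le_ceil ?_
  have := hP.one_le_logb
  have := hP.eps_pos
  gcongr

lemma hundred_le_K (hP : Sizes P) : 100 ≤ P.K := by
  have h₃ := hP.logb_le_K
  have h₄ := hP.one_le_logb
  have : (100 : ℝ) ≤ P.K := by nlinarith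
  exact_mod_cast this

lemma length_order (hP : Sizes P) (S : Finset ℕ) : (P.order S).length = S.card := by
  obtain ⟨h₁, h₂⟩ := hP.order S
  rw [← List.toFinset_card_of_nodup h₁, h₂]

lemma mem_order (hP : Sizes P) {S : Finset ℕ} {x : ℕ} : x ∈ P.order S ↔ x ∈ S := by
  conv_rhs => rw [← (hP.order S).2]
  exact List.mem_toFinset.symm

lemma nodup_order (hP : Sizes P) (S : Finset ℕ) : (P.order S).Nodup := (hP.order S).1

/-- An exponentially small probability is at most `n ^ (-100)`. -/
lemma exp_le (hP : Sizes P) {x : ℝ} (hx : 100 * Real.logb 2 P.n ≤ x) :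
    ENNReal.ofReal (Real.exp (-x)) ≤ ((P.n : ℝ≥0∞) ^ 100)⁻¹ := by
  have hn : (0 : ℝ) < P.n := by have := hP.two_le; positivity
  have h1 : Real.exp (-x) ≤ ((P.n : ℝ) ^ 100)⁻¹ := by
    rw [Real.exp_neg]
    gcongr
    rw [← Real.exp_log hn, ← Real.exp_nat_mul]
    gcongr
    refine le_trans ?_ hx
    push_cast
    gcongr
    rw [Real.logb, le_div_iff₀ (Real.log_pos (by norm_num))]
    have h0 : 0 ≤ Real.log P.n := Real.log_natCast_nonneg _
    have h2 : Real.log 2 ≤ 1 := by have := Real.log_two_lt_d9; linarith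
    nlinarith
  refine (ENNReal.ofReal_le_ofReal h1).trans_eq ?_
  rw [ENNReal.ofReal_inv_of_pos (by positivity), ENNReal.ofReal_pow hn.le, ENNReal.ofReal_natCast]

end Sizes

/-- The probability that is allowed for the failure of a single test. -/
def Params.δ (P : Params) : ℝ≥0∞ := ((P.n : ℝ≥0∞) ^ 100)⁻¹

end DynCC
end

noncomputable section
namespace DynCC
open DynCC.Comp

/-! ### The agreement and heaviness tests -/

/-! ### Laws and costs of single queries. -/

section queries
variable {G : NodeGraph}

lemma ev_chargeQuery (f : Unit → ℝ≥0∞) : ev (chargeQuery G) f = f () := ev_charge _ _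

lemma ev_edgeQuery (u v : ℕ) (f : Bool → ℝ≥0∞) :
    ev (edgeQuery G u v) f = f (@decide (G.graph.Adj u v) (Classical.dec _)) := by
  unfold edgeQuery
  rw [ev_bind, ev_chargeQuery, ev_pure]

lemma ev_sampleQuery_of_pos {u : ℕ} (hu : 0 < G.deg u) (f : Option ℕ → ℝ≥0∞) :
    ev (sampleQuery G u) f = (∑ v ∈ G.nbhd u, f (some v)) / G.deg u := by
  unfold sampleQuery
  have h : (G.nbhd u).Nonempty := Finset.card_pos.1 hu
  rw [ev_bind, ev_chargeQuery, dif_pos h, ev_sample, ex_map, ex_uniformOfFinset]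
  rfl

lemma sure_sampleQuery (u : ℕ) : (sampleQuery G u).Sure fun x k =>
    (∀ y ∈ x, y ∈ G.nbhd u) ∧ k.cq = Nat.log 2 G.verts.card + 1 ∧ k.ops = 0 := by
  unfold sampleQuery
  refine sure_bind (sure_charge ?_)
  split_ifs with h
  · refine sure_sample fun a ha => ?_
    obtain ⟨b, hb, rfl⟩ := (PMF.mem_support_map_iff _ _ _).1 ha
    rw [PMF.mem_support_uniformOfFinset_iff] at hb
    simpa using hb
  · exact sure_pure (by simp)

lemma sure_edgeQuery (u v : ℕ) : (edgeQuery G u v).Sure fun a k =>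
    (a = true → G.graph.Adj u v) ∧ k.cq ≤ Nat.log 2 G.verts.card + 1 ∧ k.ops = 0 := by
  unfold edgeQuery
  exact sure_bind (sure_charge (sure_pure (by simp)))

lemma sure_degreeQuery (u : ℕ) : (degreeQuery G u).Sure fun a k =>
    a = G.deg u ∧ k.cq = Nat.log 2 G.verts.card + 1 ∧ k.ops = 0 := by
  unfold degreeQuery
  exact sure_bind (sure_charge (sure_pure (by simp)))

end queries

/-- One factor of an exponential moment: at least a tenth of the possible draws are disagreements,
and these contribute at most `b` instead of 1. -/
lemma sum_le_of_filter_card_le {s : Finset ℕ} {Q : ℕ → Prop} [DecidablePred Q] {f : ℕ → ℝ≥0∞}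
    {b : ℝ} (hb₀ : 0 ≤ b) (hb : b ≤ 1) (hQ : 10 * (s.filter Q).card ≤ 9 * s.card)
    (hf : ∀ x ∈ s, f x ≤ 1) (hfb : ∀ x ∈ s, ¬ Q x → f x ≤ ENNReal.ofReal b) :
    (∑ x ∈ s, f x) / s.card ≤ ENNReal.ofReal (9 / 10 + b / 10) := by
  refine ENNReal.div_le_of_le_mul ?_
  rw [← Finset.sum_filter_add_sum_filter_not s Q]
  have h₁ : ∑ x ∈ s with Q x, f x ≤ ENNReal.ofReal (s.filter Q).card := by
    rw [ENNReal.ofReal_natCast]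
    refine (Finset.sum_le_card_nsmul _ _ 1 fun x hx => hf x (Finset.mem_filter.1 hx).1).trans_eq ?_
    simp
  have h₂ : ∑ x ∈ s with ¬ Q x, f x ≤ ENNReal.ofReal ((s.filter fun x => ¬ Q x).card * b) := by
    rw [ENNReal.ofReal_mul (by positivity), ENNReal.ofReal_natCast]
    refine (Finset.sum_le_card_nsmul _ _ _ fun x hx => hfb x (Finset.mem_filter.1 hx).1
      (Finset.mem_filter.1 hx).2).trans_eq ?_
    simp
  refine (add_le_add h₁ h₂).trans ?_
  rw [← ENNReal.ofReal_natCast, ← ENNReal.ofReal_mul (by positivity),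
    ← ENNReal.ofReal_add (by positivity) (by positivity)]
  refine ENNReal.ofReal_le_ofReal ?_
  have h₃ := Finset.card_filter_add_card_filter_not (s := s) Q
  have h₄ : ((s.filter Q).card : ℝ) + (s.filter fun x => ¬ Q x).card = s.card := by exact_mod_cast h₃
  have h₅ : 10 * ((s.filter Q).card : ℝ) ≤ 9 * s.card := by exact_mod_cast hQ
  nlinarith

/-- A lower tail bound from an exponential moment. -/
lemma pr_lt_le_of_moment {α : Type} {c : Comp α} {X : α → ℕ} {ρ y a : ℝ} {k : ℕ}
    (h : c.ev (fun i => (2⁻¹ : ℝ≥0∞) ^ X i) ≤ ENNReal.ofReal ρ ^ k) (hρ₀ : 0 ≤ ρ)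
    (hρ : ρ ≤ Real.exp (-a)) :
    c.pr (fun i => (X i : ℝ) < y) ≤ ENNReal.ofReal (Real.exp (-(a * k - y))) := by
  calc c.pr (fun i => (X i : ℝ) < y)
      ≤ c.ev (fun i => ENNReal.ofReal (Real.exp y) * (2⁻¹ : ℝ≥0∞) ^ X i) := by
        refine ev_mono fun i => ?_
        by_cases hi : (X i : ℝ) < y
        · rw [ind_of hi]
          have : (2⁻¹ : ℝ≥0∞) = ENNReal.ofReal 2⁻¹ := by
            rw [ENNReal.ofReal_inv_of_pos (by norm_num)]; simp
          rw [this, ← ENNReal.ofReal_pow (by norm_num), ← ENNReal.ofReal_mul (by positivity),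
            ENNReal.one_le_ofReal]
          have h₁ : Real.exp (-1) ≤ 2⁻¹ := by
            rw [Real.exp_neg]
            gcongr
            have := Real.add_one_le_exp (1 : ℝ)
            linarith
          calc (1 : ℝ) = Real.exp y * Real.exp (-y) := by rw [← Real.exp_add]; simp
            _ ≤ Real.exp y * Real.exp (X i * (-1)) := by gcongr; linarith
            _ = Real.exp y * Real.exp (-1) ^ X i := by rw [Real.exp_nat_mul]
            _ ≤ _ := by gcongr
        · rw [ind_of_not hi]; exact zero_le
    _ ≤ ENNReal.ofReal (Real.exp y) * ENNReal.ofReal ρ ^ k := by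
        rw [ev_const_mul]; gcongr
    _ ≤ _ := by
        rw [← ENNReal.ofReal_pow hρ₀, ← ENNReal.ofReal_mul (by positivity)]
        refine ENNReal.ofReal_le_ofReal ?_
        calc Real.exp y * ρ ^ k ≤ Real.exp y * Real.exp (-a) ^ k := by gcongr
          _ = _ := by rw [← Real.exp_nat_mul, ← Real.exp_add]; congr 1; ring

/-- `u` and `v` have most of their neighbors in common. -/
def Agr (G : NodeGraph) (u v : ℕ) : Prop :=
  9 * G.deg u ≤ 10 * (G.nbhd u ∩ G.nbhd v).card ∧ 9 * G.deg v ≤ 10 * (G.nbhd u ∩ G.nbhd v).card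

open Classical in
/-- `u` agrees with most of its neighbors. -/
def Hvy (G : NodeGraph) (u : ℕ) : Prop :=
  9 * G.deg u ≤ 10 * ((G.nbhd u).filter fun v => Agr G u v).card

/-- Test the drawn node, if there is one. -/
def onDraw (f : ℕ → Comp Bool) : Option ℕ → Comp Bool
  | some r => f r
  | none => pure false

section
variable {G : NodeGraph} {P : Params}

lemma agreementRounds_succ (u v k : ℕ) : agreementRounds G u v (k + 1) =
    (sampleQuery G u >>= fun r => sampleQuery G v >>= fun s =>
      onDraw (edgeQuery G v) r >>= fun a => onDraw (edgeQuery G u) s >>= fun b =>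
        agreementRounds G u v k >>= fun c =>
          pure (c.1 + (if a then 0 else 1), c.2 + (if b then 0 else 1))) := by
  rw [agreementRounds]
  congr 1; funext r
  congr 1; funext s
  cases r <;> cases s <;> rfl

lemma heavyRounds_succ (u k : ℕ) : heavyRounds P G u (k + 1) =
    (sampleQuery G u >>= fun v => onDraw (probAgreement P G u) v >>= fun a =>
      heavyRounds P G u k >>= fun c => pure (c + (if a then 0 else 1))) := by
  rw [heavyRounds]
  congr 1; funext r
  cases r <;> rfl

/-- If fewer than nine tenths of `N(u)` are in `N(v)`, then each round is counted with probability
at least 1/10 and halves the weight when it is. The rounds are independent, so the factors multiply.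
-/
lemma moment_agreementRounds_fst {u v : ℕ}
    (h : 10 * (G.nbhd u ∩ G.nbhd v).card < 9 * G.deg u) (k : ℕ) :
    ev (agreementRounds G u v k) (fun c => (2⁻¹ : ℝ≥0∞) ^ c.1) ≤
      ENNReal.ofReal (9 / 10 + (1 / 2) / 10) ^ k := by
  classical
  induction k with
  | zero => simp [agreementRounds, ev_pure]
  | succ k ih =>
    have hd : 0 < G.deg u := by omega
    simp only [agreementRounds_succ, ev_bind, ev_pure]
    rw [ev_sampleQuery_of_pos hd, pow_succ', ENNReal.div_eq_inv_mul]
    set E := ev (agreementRounds G u v k) (fun c => (2⁻¹ : ℝ≥0∞) ^ c.1) with hE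
    have key : ∀ r ∈ G.nbhd u, (sampleQuery G v).ev (fun a =>
        ev (edgeQuery G v r) fun b => ev (onDraw (edgeQuery G u) a) fun b' => ev (agreementRounds G u v k) fun c =>
            (2⁻¹ : ℝ≥0∞) ^ (c.1 + if b = true then 0 else 1)) ≤
        (if r ∈ G.nbhd v then 1 else 2⁻¹) * E := by
      intro r hr
      refine ev_le fun a => ?_
      rw [ev_edgeQuery, ev_const]
      have : r ∈ G.nbhd v ↔ G.graph.Adj v r := by
        rw [NodeGraph.mem_nbhd]
        exact ⟨fun h => h.2, fun h => ⟨G.nbhd_subset u hr, h⟩⟩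
      by_cases hrv : G.graph.Adj v r
      · simp [hrv, this, hE]
      · simp only [hrv, this, decide_false, if_false, pow_succ, Bool.false_eq_true]
        rw [hE, ← ev_const_mul]
        exact ev_mono fun c => by rw [mul_comm]
    refine (mul_le_mul_right (Finset.sum_le_sum key) _).trans ?_
    rw [← Finset.sum_mul, ← mul_assoc, ← ENNReal.div_eq_inv_mul]
    refine mul_le_mul' ?_ ih
    refine sum_le_of_filter_card_le (Q := fun r => r ∈ G.nbhd v) (by norm_num) (by norm_num)
      ?_ ?_ ?_
    · rw [Finset.filter_mem_eq_inter]
      exact h.le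
    · intro x _
      split_ifs <;> simp
    · intro x _ hx
      rw [if_neg hx, one_div, ENNReal.ofReal_inv_of_pos (by norm_num)]
      simp

lemma moment_agreementRounds_snd {u v : ℕ}
    (h : 10 * (G.nbhd u ∩ G.nbhd v).card < 9 * G.deg v) (k : ℕ) :
    ev (agreementRounds G u v k) (fun c => (2⁻¹ : ℝ≥0∞) ^ c.2) ≤
      ENNReal.ofReal (9 / 10 + (1 / 2) / 10) ^ k := by
  classical
  induction k with
  | zero => simp [agreementRounds, ev_pure]
  | succ k ih =>
    have hd : 0 < G.deg v := by omega
    simp only [agreementRounds_succ, ev_bind, ev_pure]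
    refine ev_le fun r => ?_
    rw [ev_sampleQuery_of_pos hd, pow_succ', ENNReal.div_eq_inv_mul]
    set E := ev (agreementRounds G u v k) (fun c => (2⁻¹ : ℝ≥0∞) ^ c.2) with hE
    have key : ∀ s ∈ G.nbhd v, ev (onDraw (edgeQuery G v) r) (fun b => ev (edgeQuery G u s) fun b' =>
            ev (agreementRounds G u v k) fun c =>
            (2⁻¹ : ℝ≥0∞) ^ (c.2 + if b' = true then 0 else 1)) ≤
        (if s ∈ G.nbhd u then 1 else 2⁻¹) * E := by
      intro s hs
      refine ev_le fun a => ?_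
      rw [ev_edgeQuery]
      have : s ∈ G.nbhd u ↔ G.graph.Adj u s := by
        rw [NodeGraph.mem_nbhd]
        exact ⟨fun h => h.2, fun h => ⟨G.nbhd_subset v hs, h⟩⟩
      by_cases hrv : G.graph.Adj u s
      · simp [hrv, this, hE]
      · simp only [hrv, this, decide_false, if_false, pow_succ, Bool.false_eq_true]
        rw [hE, ← ev_const_mul]
        exact ev_mono fun c => by rw [mul_comm]
    refine (mul_le_mul_right (Finset.sum_le_sum key) _).trans ?_
    rw [← Finset.sum_mul, ← mul_assoc, ← ENNReal.div_eq_inv_mul]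
    refine mul_le_mul' ?_ ih
    refine sum_le_of_filter_card_le (Q := fun r => r ∈ G.nbhd u) (by norm_num) (by norm_num)
      ?_ ?_ ?_
    · rw [Finset.filter_mem_eq_inter, Finset.inter_comm]
      exact h.le
    · intro x _
      split_ifs <;> simp
    · intro x _ hx
      rw [if_neg hx, one_div, ENNReal.ofReal_inv_of_pos (by norm_num)]
      simp

/-- A positive answer of the agreement test is reliable. -/
lemma pr_probAgreement (hP : Sizes P) (u v : ℕ) :
    (probAgreement P G u v).pr (fun a => ¬ (a = true → Agr G u v)) ≤ P.δ := by
  by_cases h : Agr G u v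
  · refine (pr_eq_zero_of_sure ?_).trans_le zero_le
    exact (sure_true _).mono fun a _ _ => by simp [h]
  have hk := hP.logb_le_size (c := 300) (by norm_num)
  have hL := hP.one_le_logb
  have hε := hP.eps_lt
  set k := P.size 300 with hk'
  -- The moment decays by `exp (-1/20)` per round. Since `ε < 1/1000`, the threshold `0.4 ε k` is
  -- negligible against `k / 20`.
  have tail : 100 * Real.logb 2 P.n ≤ 1 / 20 * k - 0.4 * P.ε * k := by nlinarith
  have hρ : (9 / 10 + (1 / 2) / 10 : ℝ) ≤ Real.exp (-(1 / 20)) := by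
    have := Real.add_one_le_exp (-(1 / 20) : ℝ)
    linarith
  rcases not_and_or.1 h with h | h
  · have key := pr_lt_le_of_moment (y := 0.4 * P.ε * k)
      (moment_agreementRounds_fst (not_le.1 h) k) (by norm_num) hρ
    refine le_trans ?_ (key.trans (hP.exp_le tail))
    unfold probAgreement pr
    simp only [ev_bind, ev_pure, ← hk']
    refine ev_le fun _ => ev_mono fun c => ind_mono ?_
    simp only [decide_eq_true_eq, Classical.not_imp]
    tauto
  · have key := pr_lt_le_of_moment (y := 0.4 * P.ε * k)
      (moment_agreementRounds_snd (not_le.1 h) k) (by norm_num) hρ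
    refine le_trans ?_ (key.trans (hP.exp_le tail))
    unfold probAgreement pr
    simp only [ev_bind, ev_pure, ← hk']
    refine ev_le fun _ => ev_mono fun c => ind_mono ?_
    simp only [decide_eq_true_eq, Classical.not_imp]
    tauto

lemma Sizes.delta_le (hP : Sizes P) : P.δ ≤ ENNReal.ofReal (1 / 4) := by
  unfold Params.δ
  rw [one_div, ENNReal.ofReal_inv_of_pos (by norm_num)]
  gcongr
  have h2 : (2 : ℝ≥0∞) ≤ P.n := by exact_mod_cast hP.two_le
  calc ENNReal.ofReal 4 = 2 ^ 2 := by norm_num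
    _ ≤ 2 ^ 100 := pow_le_pow_right₀ (by norm_num) (by norm_num)
    _ ≤ _ := by gcongr

/-- As for agreement, but the inner test may err: a draw that does not agree with `u` has weight at
most `1/2 + δ ≤ 3/4`. -/
lemma moment_heavyRounds (hP : Sizes P) {u : ℕ} (h : ¬ Hvy G u) (k : ℕ) :
    ev (heavyRounds P G u k) (fun c => (2⁻¹ : ℝ≥0∞) ^ c) ≤
      ENNReal.ofReal (9 / 10 + (3 / 4) / 10) ^ k := by
  classical
  have half : (2⁻¹ : ℝ≥0∞) = ENNReal.ofReal (1 / 2) := by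
    rw [one_div, ENNReal.ofReal_inv_of_pos (by norm_num)]; simp
  unfold Hvy at h
  rw [not_le] at h
  induction k with
  | zero => simp [heavyRounds, ev_pure]
  | succ k ih =>
    have hd : 0 < G.deg u := by omega
    simp only [heavyRounds_succ, ev_bind, ev_pure]
    rw [ev_sampleQuery_of_pos hd, pow_succ', ENNReal.div_eq_inv_mul]
    set E := ev (heavyRounds P G u k) (fun c => (2⁻¹ : ℝ≥0∞) ^ c) with hE
    have key : ∀ v ∈ G.nbhd u, ev (probAgreement P G u v) (fun a =>
        ev (heavyRounds P G u k) fun c => (2⁻¹ : ℝ≥0∞) ^ (c + if a = true then 0 else 1)) =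
        ev (probAgreement P G u v) (fun a => if a = true then 1 else 2⁻¹) * E := by
      intro v _
      rw [mul_comm, ← ev_const_mul]
      congr 1
      ext a
      cases a
      · simp only [Bool.false_eq_true, if_false, pow_succ]
        rw [hE, mul_comm, ← ev_const_mul]
        congr 1; ext c; rw [mul_comm]
      · simp [hE]
    simp only [onDraw]
    rw [Finset.sum_congr rfl key, ← Finset.sum_mul, ← mul_assoc, ← ENNReal.div_eq_inv_mul]
    refine mul_le_mul' ?_ ih
    refine sum_le_of_filter_card_le (Q := fun v => Agr G u v) (by norm_num) (by norm_num)
      h.le ?_ ?_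
    · intro v _
      refine ev_le fun a => ?_
      split_ifs <;> simp
    · intro v _ hv
      have := pr_probAgreement (G := G) hP u v
      calc _ ≤ ev (probAgreement P G u v) (fun a => 2⁻¹ + ind (¬ (a = true → Agr G u v))) := by
            refine ev_mono fun a => ?_
            cases a
            · simp
            · simp [ind_of, hv]
        _ ≤ ENNReal.ofReal (1 / 2) + ENNReal.ofReal (1 / 4) := by
            rw [ev_add, ev_const, half]
            exact add_le_add le_rfl (this.trans hP.delta_le)
        _ = _ := by rw [← ENNReal.ofReal_add (by norm_num) (by norm_num)]; norm_num

/-- A positive answer of the heaviness test is reliable. -/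
lemma pr_heavy (hP : Sizes P) (u : ℕ) :
    (heavy P G u).pr (fun a => ¬ (a = true → Hvy G u)) ≤ P.δ := by
  by_cases h : Hvy G u
  · refine (pr_eq_zero_of_sure ?_).trans_le zero_le
    exact (sure_true _).mono fun a _ _ => by simp [h]
  have hk := hP.logb_le_size (c := 1200) (by norm_num)
  have hL := hP.one_le_logb
  have hε := hP.eps_lt
  set k := P.size 1200 with hk'
  have tail : 100 * Real.logb 2 P.n ≤ 1 / 40 * k - 1.2 * P.ε * k := by nlinarith
  have hρ : (9 / 10 + (3 / 4) / 10 : ℝ) ≤ Real.exp (-(1 / 40)) := by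
    have := Real.add_one_le_exp (-(1 / 40) : ℝ)
    linarith
  have key := pr_lt_le_of_moment (X := fun c => c) (y := 1.2 * P.ε * k)
    (moment_heavyRounds hP h k) (by norm_num) hρ
  refine le_trans ?_ (key.trans (hP.exp_le tail))
  unfold heavy pr
  simp only [ev_bind, ev_pure, ← hk']
  refine ev_le fun _ => ev_mono fun c => ind_mono ?_
  simp only [decide_eq_true_eq, Classical.not_imp]
  tauto

/-! ### The cost of the tests -/

lemma sure_agreementRounds (u v k : ℕ) : (agreementRounds G u v k).Sure fun _ m =>
    m.cq ≤ k * (4 * (Nat.log 2 G.verts.card + 1)) ∧ m.ops = 0 := by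
  induction k with
  | zero => exact sure_pure (by simp)
  | succ k ih =>
    rw [agreementRounds_succ]
    refine sure_bind ((sure_sampleQuery u).mono fun r k₁ h₁ => ?_)
    refine sure_bind ((sure_sampleQuery v).mono fun s k₂ h₂ => ?_)
    have h : ∀ (o : Option ℕ) (x : ℕ), (onDraw (edgeQuery G x) o).Sure fun _ m => m.cq ≤ Nat.log 2 G.verts.card + 1 ∧ m.ops = 0 := by
      intro o x
      cases o with
      | none => exact sure_pure (by simp)
      | some r => exact (sure_edgeQuery x r).mono fun _ _ h => h.2
    refine sure_bind ((h r v).mono fun a k₃ h₃ => ?_)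
    refine sure_bind ((h s u).mono fun b k₄ h₄ => ?_)
    refine sure_bind (ih.mono fun c k₅ h₅ => ?_)
    refine sure_pure ?_
    simp only [Cost.cq_add, Cost.ops_add, Cost.cq_zero, Cost.ops_zero]
    refine ⟨?_, by omega⟩
    have : (k + 1) * (4 * (Nat.log 2 G.verts.card + 1)) =
      k * (4 * (Nat.log 2 G.verts.card + 1)) + 4 * (Nat.log 2 G.verts.card + 1) := by ring
    omega

/-- A bound for the cost of a test. -/
def Params.testCost (P : Params) : ℕ := 8 * P.K ^ 3

/-- The quadratic bound is what the heaviness test multiplies by its number of rounds. The lower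
bound 1 comes from counting the call and lets a test pay for later operations. -/
lemma sure_probAgreement_sq (hP : Sizes P) (hG : G.verts.card ≤ P.n) (u v : ℕ) :
    (probAgreement P G u v).Sure fun _ m => m.cq ≤ 5 * P.K ^ 2 ∧ m.ops = 0 ∧ 1 ≤ m.cq := by
  unfold probAgreement
  refine sure_bind (sure_charge ?_)
  refine sure_bind ((sure_agreementRounds u v _).mono fun c k h => ?_)
  refine sure_pure ?_
  simp only [Cost.cq_add, Cost.ops_add, Cost.cq_zero, Cost.ops_zero, Cost.cq_mk]
  refine ⟨?_, by omega, by omega⟩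
  have h₁ := hP.natLog_add_one_le hG
  have h₂ := hP.size_le_K (c := 300) (by norm_num)
  have h₃ := hP.hundred_le_K
  have : P.size 300 * (4 * (Nat.log 2 G.verts.card + 1)) ≤ P.K * (4 * P.K) := by gcongr
  nlinarith [h.1]

lemma sure_probAgreement (hP : Sizes P) (hG : G.verts.card ≤ P.n) (u v : ℕ) :
    (probAgreement P G u v).Sure fun _ m => m.cq ≤ P.testCost ∧ m.ops = 0 ∧ 1 ≤ m.cq := by
  refine (sure_probAgreement_sq hP hG u v).mono fun _ m h => ⟨h.1.trans ?_, h.2⟩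
  have h₃ := hP.hundred_le_K
  unfold Params.testCost
  nlinarith [sq_nonneg P.K]

lemma sure_heavyRounds (hP : Sizes P) (hG : G.verts.card ≤ P.n) (u k : ℕ) :
    (heavyRounds P G u k).Sure fun _ m => m.cq ≤ k * (6 * P.K ^ 2) ∧ m.ops = 0 := by
  induction k with
  | zero => exact sure_pure (by simp)
  | succ k ih =>
    rw [heavyRounds_succ]
    refine sure_bind ((sure_sampleQuery u).mono fun r k₁ h₁ => ?_)
    have h : (onDraw (probAgreement P G u) r).Sure fun _ m => m.cq ≤ 5 * P.K ^ 2 ∧ m.ops = 0 := by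
      cases r with
      | none => exact sure_pure (by simp)
      | some r => exact (sure_probAgreement_sq hP hG u r).mono fun _ _ h => ⟨h.1, h.2.1⟩
    refine sure_bind (h.mono fun a k₃ h₃ => ?_)
    refine sure_bind (ih.mono fun c k₅ h₅ => ?_)
    refine sure_pure ?_
    simp only [Cost.cq_add, Cost.ops_add, Cost.cq_zero, Cost.ops_zero]
    refine ⟨?_, by omega⟩
    have h₁ := hP.natLog_add_one_le hG
    have h₂ := hP.hundred_le_K
    have : P.K ≤ P.K ^ 2 := by nlinarith
    have : (k + 1) * (6 * P.K ^ 2) = k * (6 * P.K ^ 2) + 6 * P.K ^ 2 := by ring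
    omega

lemma sure_heavy (hP : Sizes P) (hG : G.verts.card ≤ P.n) (u : ℕ) :
    (heavy P G u).Sure fun _ m => m.cq ≤ P.testCost ∧ m.ops = 0 ∧ 1 ≤ m.cq := by
  unfold heavy
  refine sure_bind (sure_charge ?_)
  refine sure_bind ((sure_heavyRounds hP hG u _).mono fun c k h => ?_)
  refine sure_pure ?_
  simp only [Cost.cq_add, Cost.ops_add, Cost.cq_zero, Cost.ops_zero, Cost.cq_mk]
  refine ⟨?_, by omega, by omega⟩
  have h₂ := hP.size_le_K (c := 1200) (by norm_num)
  have h₃ := hP.hundred_le_K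
  have h₄ : P.size 1200 * (6 * P.K ^ 2) ≤ P.K * (6 * P.K ^ 2) := by gcongr
  unfold Params.testCost
  have h₅ : P.K * (6 * P.K ^ 2) = 6 * P.K ^ 3 := by ring
  have h₆ : 1 ≤ P.K ^ 3 := Nat.one_le_pow _ _ (by omega)
  omega

end
end DynCC
end

noncomputable section
namespace DynCC
open DynCC.Comp

/-! ### Neighborhood samples -/

section
variable {G : NodeGraph} {P : Params}

lemma sure_sampleSet (u k : ℕ) : (sampleSet G u k).Sure fun S m =>
    S ⊆ G.nbhd u ∧ S.card ≤ k ∧ m.cq = k * (Nat.log 2 G.verts.card + 1) ∧ m.ops = 0 := by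
  induction k with
  | zero => exact sure_pure (by simp)
  | succ k ih =>
    unfold sampleSet
    refine sure_bind ((sure_sampleQuery u).mono fun x k₁ h₁ => ?_)
    refine sure_bind (ih.mono fun S k₂ h₂ => ?_)
    refine sure_pure ⟨?_, ?_, ?_, ?_⟩
    · refine Finset.union_subset (fun y hy => h₁.1 y ?_) h₂.1
      simpa using hy
    · refine (Finset.card_union_le _ _).trans ?_
      have : x.toFinset.card ≤ 1 := by cases x <;> simp
      omega
    · simp only [Cost.cq_add, Cost.cq_zero, h₁.2.1, h₂.2.2.1]
      ring
    · simp [h₁.2.2, h₂.2.2.2]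

/-- The probability that all sampled nodes have a property. -/
lemma pr_sampleSet_forall {u : ℕ} {Q : ℕ → Prop} [DecidablePred Q] {r : ℝ≥0∞} (hu : 0 < G.deg u)
    (hr : (((G.nbhd u).filter Q).card : ℝ≥0∞) / G.deg u ≤ r) (k : ℕ) :
    (sampleSet G u k).pr (fun S => ∀ y ∈ S, Q y) ≤ r ^ k := by
  induction k with
  | zero => simpa using pr_le_one _ _
  | succ k ih =>
    unfold pr at ih ⊢
    unfold sampleSet
    simp only [ev_bind, ev_pure]
    rw [ev_sampleQuery_of_pos hu, pow_succ']
    set E := ev (sampleSet G u k) (fun S => ind (∀ y ∈ S, Q y)) with hE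
    have key : ∀ v ∈ G.nbhd u, (sampleSet G u k).ev (fun S =>
        ind (∀ y ∈ (some v).toFinset ∪ S, Q y)) ≤ (if Q v then 1 else 0) * E := by
      intro v _
      by_cases hv : Q v
      · rw [if_pos hv, one_mul]
        refine ev_mono fun S => ind_mono fun h y hy => h y (Finset.mem_union_right _ hy)
      · rw [if_neg hv, zero_mul]
        refine ev_le fun S => (ind_of_not ?_).le
        intro h
        exact hv (h v (by simp))
    rw [ENNReal.div_eq_inv_mul]
    refine (mul_le_mul_right (Finset.sum_le_sum key) _).trans ?_
    rw [← Finset.sum_mul, ← mul_assoc, ← ENNReal.div_eq_inv_mul]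
    refine mul_le_mul' ?_ ih
    rwa [Finset.sum_boole]

/-- The probability that a neighbor of a node of small degree is missed. -/
lemma pr_notMem_sampleSet {u w D : ℕ} (hw : w ∈ G.nbhd u) (hD : G.deg u ≤ D) (k : ℕ) :
    (sampleSet G u k).pr (fun S => w ∉ S) ≤ ENNReal.ofReal (1 - 1 / D) ^ k := by
  have hpos : 0 < G.deg u := Finset.card_pos.2 ⟨w, hw⟩
  refine le_trans (pr_mono ?_) (pr_sampleSet_forall (Q := fun y => y ≠ w) hpos ?_ k)
  · intro S hS y hy h
    exact hS (h ▸ hy)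
  · rw [Finset.filter_ne', Finset.card_erase_of_mem hw]
    change (((G.deg u - 1 : ℕ) : ℝ≥0∞)) / _ ≤ _
    rw [← ENNReal.ofReal_natCast, ← ENNReal.ofReal_natCast,
      ← ENNReal.ofReal_div_of_pos (by exact_mod_cast hpos)]
    refine ENNReal.ofReal_le_ofReal ?_
    have h₁ : (0 : ℝ) < G.deg u := by exact_mod_cast hpos
    have h₂ : (G.deg u : ℝ) ≤ D := by exact_mod_cast hD
    rw [Nat.cast_sub hpos, sub_div, div_self h₁.ne', Nat.cast_one]
    gcongr

/-- The probability that all sampled nodes are among at most half of the neighbors. -/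
lemma pr_sampleSet_half {u : ℕ} {Q : ℕ → Prop} [DecidablePred Q] (hu : 0 < G.deg u)
    (hQ : 2 * ((G.nbhd u).filter Q).card ≤ G.deg u) (k : ℕ) :
    (sampleSet G u k).pr (fun S => ∀ y ∈ S, Q y) ≤ 2⁻¹ ^ k := by
  refine pr_sampleSet_forall hu ?_ k
  refine ENNReal.div_le_of_le_mul ?_
  rw [← ENNReal.div_eq_inv_mul, ENNReal.le_div_iff_mul_le (by simp) (by simp)]
  rw [mul_comm]
  exact_mod_cast hQ

lemma Sizes.half_pow_K_le (hP : Sizes P) : (2⁻¹ : ℝ≥0∞) ^ P.K ≤ P.δ := by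
  have h := hP.logb_le_K
  have h1 := hP.one_le_logb
  refine le_trans ?_ (hP.exp_le (x := P.K / 2) (by linarith))
  have : (2⁻¹ : ℝ≥0∞) = ENNReal.ofReal 2⁻¹ := by
    rw [ENNReal.ofReal_inv_of_pos (by norm_num)]; simp
  rw [this, ← ENNReal.ofReal_pow (by norm_num)]
  refine ENNReal.ofReal_le_ofReal ?_
  have h2 : (2⁻¹ : ℝ) ≤ Real.exp (-(1 / 2)) := by
    have := Real.add_one_le_exp (-(1 / 2) : ℝ)
    linarith
  calc (2⁻¹ : ℝ) ^ P.K ≤ Real.exp (-(1 / 2)) ^ P.K := by gcongr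
    _ = _ := by rw [← Real.exp_nat_mul]; congr 1; ring

/-! ### The notification phase -/

/-- The stored samples of all nodes. -/
abbrev Store := ℕ → ℕ → Finset ℕ

/-- The stored samples have at most the prescribed size. -/
def StoreOK (P : Params) (I : Store) : Prop := ∀ w l, (I w l).card ≤ P.K

/-- Store the sample `S` at the current level of `w`. -/
def storeSample (G : NodeGraph) (I : Store) (w : ℕ) (S : Finset ℕ) : Store :=
  Function.update I w (Function.update (I w) (Nat.log 2 (G.deg w)) S)

lemma ev_refresh (I : Store) (w : ℕ) (f : Store × Finset ℕ → ℝ≥0∞) :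
    ev (refresh P G I w) f = ev (sampleSet G w P.K) fun S => f (storeSample G I w S, S) := by
  unfold refresh degreeQuery
  simp only [ev_bind, ev_pure, chargeOps, ev_charge, ev_chargeQuery]
  rfl

lemma StoreOK.update {I : Store} (hI : StoreOK P I) {S : Finset ℕ} (hS : S.card ≤ P.K) (w : ℕ) :
    StoreOK P (storeSample G I w S) := by
  intro x l
  unfold storeSample
  by_cases hx : x = w
  · subst hx
    rw [Function.update_self]
    by_cases hl : l = Nat.log 2 (G.deg x)
    · subst hl; rwa [Function.update_self]
    · rw [Function.update_of_ne hl]; exact hI x l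
  · rw [Function.update_of_ne hx]; exact hI x l

lemma sure_refresh (I : Store) (hI : StoreOK P I) (w : ℕ) :
    (refresh P G I w).Sure fun x m => StoreOK P x.1 ∧ x.2 ⊆ G.nbhd w ∧ x.2.card ≤ P.K ∧
      m.cq = (P.K + 1) * (Nat.log 2 G.verts.card + 1) ∧ m.ops ≤ 3 * P.K + 1 := by
  unfold refresh
  refine sure_bind ((sure_degreeQuery w).mono fun d k₁ h₁ => ?_)
  refine sure_bind ((sure_sampleSet w _).mono fun S k₂ h₂ => ?_)
  refine sure_bind (sure_charge (sure_pure ⟨?_, h₂.1, h₂.2.1, ?_, ?_⟩))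
  · obtain ⟨rfl, _⟩ := h₁
    exact hI.update h₂.2.1 w
  · simp only [Cost.cq_add, Cost.cq_zero, Cost.cq_mk, h₁.2.1, h₂.2.2.1]
    unfold Params.K
    ring
  · have := hI w (Nat.log 2 d)
    have h₄ := h₂.2.1
    simp only [Cost.ops_add, Cost.ops_zero, h₁.2.2, h₂.2.2.2]
    unfold Params.K at *
    omega

lemma sure_notifyRound (hP : Sizes P) (I : Store) (hI : StoreOK P I) (R : Finset ℕ) :
    (notifyRound P G I R).Sure fun x m => StoreOK P x.1 ∧ x.2 ⊆ G.verts ∧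
      x.2.card ≤ R.card * P.K ∧ m.cq = R.card * ((P.K + 1) * (Nat.log 2 G.verts.card + 1)) ∧
      m.ops ≤ R.card * (3 * P.K + 1) := by
  unfold notifyRound
  rw [← hP.length_order R]
  have key : ∀ (l : List ℕ) (acc : Store × Finset ℕ), StoreOK P acc.1 → acc.2 ⊆ G.verts →
      (l.foldlM (fun (acc : Store × Finset ℕ) w => do
        let x ← refresh P G acc.1 w
        pure (x.1, acc.2 ∪ x.2)) acc : Comp (Store × Finset ℕ)).Sure fun x m => StoreOK P x.1 ∧ x.2 ⊆ G.verts ∧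
      x.2.card ≤ acc.2.card + l.length * P.K ∧
      m.cq = l.length * ((P.K + 1) * (Nat.log 2 G.verts.card + 1)) ∧
      m.ops ≤ l.length * (3 * P.K + 1) := by
    intro l
    induction l with
    | nil => intro acc h₁ h₂; exact sure_pure ⟨h₁, h₂, by simp⟩
    | cons w l ih =>
      intro acc h₁ h₂
      rw [List.foldlM_cons]
      refine sure_bind (sure_bind ((sure_refresh acc.1 h₁ w).mono fun x k₁ hx => sure_pure ?_))
      refine (ih (x.1, acc.2 ∪ x.2) hx.1 (Finset.union_subset h₂ (hx.2.1.trans (G.nbhd_subset w)))).mono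
        fun y k₂ hy => ⟨hy.1, hy.2.1, ?_, ?_, ?_⟩
      · have h₃ := Finset.card_union_le acc.2 x.2
        have h₄ := hx.2.2.1
        have h₅ := hy.2.2.1
        simp only [List.length_cons, add_mul, one_mul]
        dsimp only at h₅
        omega
      · simp only [List.length_cons, Cost.cq_add, Cost.cq_zero, hx.2.2.2.1, hy.2.2.2.1]
        ring
      · have h₄ := hx.2.2.2.2
        have h₅ := hy.2.2.2.2
        simp only [List.length_cons, Cost.ops_add, Cost.ops_zero, add_mul, one_mul] at *
        omega
  refine (key (P.order R) (I, ∅) hI (by simp)).mono fun x m hx => ?_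
  simpa using hx

/-- The three rounds refresh at most `|R|`, `|R| K` and `|R| K ^ 2` nodes, at `O(K ^ 2)` each; only
the first two sets are processed. -/
lemma sure_notifyLoop (hP : Sizes P) (hG : G.verts.card ≤ P.n) (I : Store) (hI : StoreOK P I)
    (R : Finset ℕ) (hR : R ⊆ G.verts) :
    (notifyLoop P G I R).Sure fun x m => StoreOK P x.1 ∧ x.2 ⊆ G.verts ∧
      x.2.card ≤ R.card * (2 * P.K) ∧ m.cq ≤ R.card * (6 * P.K ^ 4) ∧ m.ops ≤ 3 * m.cq := by
  unfold notifyLoop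
  refine sure_bind ((sure_notifyRound hP I hI R).mono fun x₀ k₀ h₀ => ?_)
  refine sure_bind ((sure_notifyRound hP x₀.1 h₀.1 x₀.2).mono fun x₁ k₁ h₁ => ?_)
  refine sure_bind ((sure_notifyRound hP x₁.1 h₁.1 x₁.2).mono fun x₂ k₂ h₂ => ?_)
  obtain ⟨-, a₂, a₃, a₄, a₅⟩ := h₀
  obtain ⟨-, b₂, b₃, b₄, b₅⟩ := h₁
  obtain ⟨c₁, c₂, c₃, c₄, c₅⟩ := h₂
  have hK := hP.hundred_le_K
  have hlog := hP.natLog_add_one_le hG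
  set K := P.K with hKdef
  set L := Nat.log 2 G.verts.card + 1 with hL
  have hL1 : 1 ≤ L := by omega
  refine sure_pure ⟨c₁, Finset.union_subset hR a₂, ?_, ?_, ?_⟩
  · refine (Finset.card_union_le _ _).trans ?_
    nlinarith
  · simp only [Cost.cq_add, Cost.cq_zero]
    have hb : x₁.2.card ≤ R.card * K * K := b₃.trans (Nat.mul_le_mul_right _ a₃)
    have hq : (K + 1) * L ≤ 2 * K ^ 2 := by nlinarith
    have e₀ : k₀.cq ≤ R.card * (2 * K ^ 2) := a₄ ▸ Nat.mul_le_mul_left _ hq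
    have e₁ : k₁.cq ≤ R.card * K * (2 * K ^ 2) := b₄ ▸ Nat.mul_le_mul a₃ hq
    have e₂ : k₂.cq ≤ R.card * K * K * (2 * K ^ 2) := c₄ ▸ Nat.mul_le_mul hb hq
    have f₀ : R.card * (2 * K ^ 2) ≤ R.card * (2 * K ^ 4) := by
      gcongr
      · omega
      · norm_num
    have f₁ : R.card * K * (2 * K ^ 2) ≤ R.card * (2 * K ^ 4) := by
      rw [show R.card * K * (2 * K ^ 2) = R.card * (2 * K ^ 3) by ring]
      gcongr
      · omega
      · norm_num
    have f₂ : R.card * K * K * (2 * K ^ 2) = R.card * (2 * K ^ 4) := by ring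
    have f₃ : R.card * (6 * K ^ 4) = 3 * (R.card * (2 * K ^ 4)) := by ring
    omega
  · simp only [Cost.cq_add, Cost.cq_zero, Cost.ops_add, Cost.ops_zero]
    have g : ∀ r : ℕ, r * (3 * K + 1) ≤ 3 * (r * ((K + 1) * L)) := by
      intro r
      calc r * (3 * K + 1) ≤ r * (3 * ((K + 1) * 1)) := by gcongr; omega
        _ ≤ r * (3 * ((K + 1) * L)) := by gcongr
        _ = _ := by ring
    have := g R.card
    have := g x₀.2.card
    have := g x₁.2.card
    omega

/-- The receivers of notifications after the deletion of `v`. -/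
def receivers (P : Params) (G : NodeGraph) (I : Store) (v : ℕ) : Finset ℕ :=
  (Finset.range P.levels).biUnion (backSet G I v)

lemma mem_receivers {I : Store} {v x : ℕ} :
    x ∈ receivers P G I v ↔ x ∈ G.verts ∧ ∃ i < P.levels, v ∈ I x i := by
  simp only [receivers, backSet, Finset.mem_biUnion, Finset.mem_range, Finset.mem_filter]
  tauto

lemma receivers_subset (I : Store) (v : ℕ) : receivers P G I v ⊆ G.verts := fun _ hx =>
  (mem_receivers.1 hx).1

/-- The part of an iteration that draws the samples and determines the nodes to be processed. -/
def notifyPhase (P : Params) (e : Event) (h : History) (I : Store) : Comp (Store × Finset ℕ) :=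
  match e with
  | .arrival S => do
    let x ← refresh P (graphOf (.arrival S :: h)) I (arrivals h)
    let y ← notifyLoop P (graphOf (.arrival S :: h)) x.1 x.2
    pure (y.1, insert (arrivals h) y.2)
  | .deletion v =>
    notifyLoop P (graphOf (.deletion v :: h)) (Function.update I v fun _ => ∅)
      (receivers P (graphOf (.deletion v :: h)) I v)

/-- A bound for the number of nodes in the first round of notifications. -/
def load (P : Params) (e : Event) (h : History) (I : Store) : ℕ :=
  match e with
  | .arrival _ => P.K
  | .deletion v => (receivers P (graphOf (.deletion v :: h)) I v).card

lemma sure_notifyPhase (hP : Sizes P) {e : Event} {h : History} (hv : Valid P.n (e :: h))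
    {I : Store} (hI : StoreOK P I) :
    (notifyPhase P e h I).Sure fun x m => StoreOK P x.1 ∧ x.2 ⊆ (graphOf (e :: h)).verts ∧
      x.2.card ≤ 2 * P.K * (load P e h I + 1) ∧ m.cq ≤ 10 * P.K ^ 4 * (load P e h I + 1) ∧
      m.ops ≤ 3 * m.cq := by
  have hK := hP.hundred_le_K
  cases e with
  | arrival S =>
    unfold notifyPhase
    refine sure_bind ((sure_refresh I hI _).mono fun x k₁ h₁ => ?_)
    obtain ⟨a₁, a₂, a₃, a₄, a₅⟩ := h₁
    refine sure_bind ((sure_notifyLoop hP hv.card_le x.1 a₁ x.2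
      (a₂.trans (NodeGraph.nbhd_subset _ _))).mono fun y k₂ h₂ => ?_)
    obtain ⟨b₁, b₂, b₃, b₄, b₅⟩ := h₂
    have hlog := hP.natLog_add_one_le hv.card_le
    set K := P.K with hKdef
    set L := Nat.log 2 (graphOf (.arrival S :: h)).verts.card + 1 with hL
    have hL1 : 1 ≤ L := by omega
    refine sure_pure ⟨b₁, ?_, ?_, ?_, ?_⟩
    · refine Finset.insert_subset ?_ b₂
      rw [graphOf_verts_arrival]
      exact Finset.mem_insert_self _ _
    · refine (Finset.card_insert_le _ _).trans ?_
      have : x.2.card * (2 * K) ≤ K * (2 * K) := Nat.mul_le_mul_right _ a₃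
      change _ ≤ 2 * K * (K + 1)
      nlinarith
    · simp only [Cost.cq_add, Cost.cq_zero]
      change _ ≤ 10 * K ^ 4 * (K + 1)
      have e₁ : k₁.cq ≤ 4 * K ^ 4 := by
        rw [a₄]
        calc (K + 1) * L ≤ 2 * K ^ 2 := by nlinarith
          _ ≤ 2 * K ^ 4 := by
            gcongr
            · omega
            · norm_num
          _ ≤ _ := by omega
      have e₂ : x.2.card * (6 * K ^ 4) ≤ K * (6 * K ^ 4) := Nat.mul_le_mul_right _ a₃
      have e₃ : 10 * K ^ 4 * (K + 1) = 10 * (K * K ^ 4) + 10 * K ^ 4 := by ring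
      have e₄ : K * (6 * K ^ 4) = 6 * (K * K ^ 4) := by ring
      omega
    · simp only [Cost.cq_add, Cost.cq_zero, Cost.ops_add, Cost.ops_zero]
      have : 3 * K + 1 ≤ 3 * ((K + 1) * L) := by nlinarith
      omega
  | deletion v =>
    unfold notifyPhase
    have hI' : StoreOK P (Function.update I v fun _ => ∅) := by
      intro w l
      by_cases hw : w = v
      · subst hw; simp
      · rw [Function.update_of_ne hw]; exact hI w l
    refine (sure_notifyLoop hP hv.card_le _ hI' _ (receivers_subset _ _)).mono
      fun x m hx => ⟨hx.1, hx.2.1, ?_, ?_, hx.2.2.2.2⟩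
    · change _ ≤ 2 * P.K * (Finset.card _ + 1)
      exact hx.2.2.1.trans (by nlinarith)
    · change _ ≤ 10 * P.K ^ 4 * (Finset.card _ + 1)
      refine hx.2.2.2.1.trans ?_
      rw [mul_comm]
      gcongr
      · norm_num
      · omega

lemma sure_notifyPhase_arrival (S : Finset ℕ) (h : History) (I : Store) :
    (notifyPhase P (.arrival S) h I).Sure fun x _ => arrivals h ∈ x.2 := by
  unfold notifyPhase
  exact sure_bind ((sure_true _).mono fun x _ _ => sure_bind ((sure_true _).mono fun y _ _ =>
    sure_pure (by simp)))

/-! ### What the notifications achieve -/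

/-- `x` has stored a sample of level at least `l₀` that contains a node with the property `Dm`. -/
def Pending (P : Params) (l₀ : ℕ) (Dm : ℕ → Prop) (I : Store) (x : ℕ) : Prop :=
  ∃ l, l₀ ≤ l ∧ l < P.levels ∧ ∃ y ∈ I x l, Dm y

variable {l₀ : ℕ} {Dm : ℕ → Prop} {Q₀ : Finset ℕ}

/-- All nodes of `Q₀` are pending, or are about to draw a sample of level at least `l₀`. -/
def PendingOr (P : Params) (G : NodeGraph) (l₀ : ℕ) (Dm : ℕ → Prop) (Q₀ : Finset ℕ) (l : List ℕ)
    (I : Store) : Prop :=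
  ∀ x ∈ Q₀, Pending P l₀ Dm I x ∨ (x ∈ l ∧ l₀ ≤ Nat.log 2 (G.deg x))

open Classical in
/-- Half of the neighbors of the nodes of `Q₀` that have large degree have the property `Dm`. -/
def HalfDoomed (G : NodeGraph) (l₀ : ℕ) (Dm : ℕ → Prop) (Q₀ : Finset ℕ) : Prop :=
  ∀ x ∈ Q₀, l₀ ≤ Nat.log 2 (G.deg x) →
    2 * ((G.nbhd x).filter fun y => ¬ Dm y).card ≤ G.deg x

/-- A refresh cannot cancel a pending state. At level at least `l₀` half of the neighbors have the
property `Dm`, so the new sample misses all of them with probability at most `2 ^ (-K)`; at a lower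
level the sample goes to a different slot. -/
lemma pr_refresh_pending (hP : Sizes P) (hG : G.verts.card ≤ P.n) (hl₀ : 0 < l₀)
    (hD : HalfDoomed G l₀ Dm Q₀) (z : ℕ) (l : List ℕ) (I : Store)
    (hI : PendingOr P G l₀ Dm Q₀ (z :: l) I) :
    (refresh P G I z).pr (fun x => ¬ PendingOr P G l₀ Dm Q₀ l x.1) ≤ P.δ := by
  classical
  have other : ∀ S : Finset ℕ, ∀ x ∈ Q₀, x ≠ z →
      Pending P l₀ Dm (storeSample G I z S) x ∨ (x ∈ l ∧ l₀ ≤ Nat.log 2 (G.deg x)) := by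
    intro S x hx hxz
    rcases hI x hx with h | ⟨h, h'⟩
    · left
      unfold Pending storeSample
      rwa [Function.update_of_ne hxz]
    · exact Or.inr ⟨(List.mem_cons.1 h).resolve_left hxz, h'⟩
  unfold pr
  rw [ev_refresh]
  by_cases hz : z ∈ Q₀ ∧ l₀ ≤ Nat.log 2 (G.deg z)
  · have hpos : 0 < G.deg z := by
      by_contra h0
      have : G.deg z = 0 := by omega
      rw [this] at hz
      simp at hz
      omega
    refine le_trans (ev_mono fun S => ind_mono ?_)
      ((pr_sampleSet_half hpos (hD z hz.1 hz.2) P.K).trans hP.half_pow_K_le)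
    intro hS y hy hDm
    apply hS
    intro x hx
    by_cases hxz : x = z
    · subst hxz
      left
      refine ⟨Nat.log 2 (G.deg x), hz.2, ?_, y, ?_, hDm⟩
      · exact Nat.lt_succ_of_le (Nat.log_mono_right ((G.deg_le_card x).trans hG))
      · simpa [storeSample] using hy
    · exact other S x hx hxz
  · refine le_trans (ev_le (r := 0) fun S => (ind_of_not ?_).le) zero_le
    rw [not_not]
    intro x hx
    by_cases hxz : x = z
    · subst hxz
      have hlt : ¬ l₀ ≤ Nat.log 2 (G.deg x) := fun hl => hz ⟨hx, hl⟩
      obtain ⟨m, hm, hm', y, hy, hDm⟩ := (hI x hx).resolve_right fun h => hlt h.2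
      refine Or.inl ⟨m, hm, hm', y, ?_, hDm⟩
      change y ∈ storeSample G I x S x m
      unfold storeSample
      -- The new sample has a level below `l₀ ≤ m`, so the slot `m` keeps its content.
      rw [Function.update_self, Function.update_of_ne (by omega)]
      exact hy
    · exact other S x hx hxz

lemma pr_notifyRound_pending (hP : Sizes P) (hG : G.verts.card ≤ P.n) (hl₀ : 0 < l₀)
    (hD : HalfDoomed G l₀ Dm Q₀) (I : Store) (R : Finset ℕ) (hR : R ⊆ G.verts)
    (hI : PendingOr P G l₀ Dm Q₀ (P.order R) I) :
    (notifyRound P G I R).pr (fun x => ¬ PendingOr P G l₀ Dm Q₀ [] x.1) ≤ P.n * P.δ := by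
  unfold notifyRound
  refine (pr_foldlM_le (J := fun l (acc : Store × Finset ℕ) => PendingOr P G l₀ Dm Q₀ l acc.1)
    (δ := P.δ) ?_ (P.order R) (I, ∅) hI).trans ?_
  · intro z l acc hacc
    refine le_trans (le_of_eq ?_) (pr_refresh_pending hP hG hl₀ hD z l acc.1 hacc)
    simp only [pr, ev_bind, ev_pure]
  · rw [hP.length_order]
    gcongr
    exact (Finset.card_le_card hR).trans hG

lemma PendingOr.weaken {I : Store} (h : PendingOr P G l₀ Dm Q₀ [] I) (l : List ℕ) :
    PendingOr P G l₀ Dm Q₀ l I := fun x hx => Or.inl ((h x hx).resolve_right (by simp))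

/-- Nodes that are not yet pending must be repaired in the first round; the later rounds only have
to preserve what it achieves. -/
lemma pr_notifyLoop_pending (hP : Sizes P) (hG : G.verts.card ≤ P.n) (hl₀ : 0 < l₀)
    (hD : HalfDoomed G l₀ Dm Q₀) (I : Store) (hIK : StoreOK P I) (R : Finset ℕ) (hR : R ⊆ G.verts)
    (hI : PendingOr P G l₀ Dm Q₀ (P.order R) I) :
    (notifyLoop P G I R).pr (fun x => ¬ PendingOr P G l₀ Dm Q₀ [] x.1) ≤ 3 * (P.n * P.δ) := by
  have step : ∀ (I : Store) (R : Finset ℕ), StoreOK P I → R ⊆ G.verts →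
      PendingOr P G l₀ Dm Q₀ (P.order R) I →
      (notifyRound P G I R).pr (fun x => ¬ (StoreOK P x.1 ∧ x.2 ⊆ G.verts ∧
        PendingOr P G l₀ Dm Q₀ [] x.1)) ≤ P.n * P.δ := by
    intro I R hIK hR hI
    refine (pr_mono_sure (sure_notifyRound hP I hIK R) ?_).trans
      (pr_notifyRound_pending hP hG hl₀ hD I R hR hI)
    intro x k hx hn h
    exact hn ⟨hx.1, hx.2.1, h⟩
  unfold notifyLoop
  rw [show 3 * ((P.n : ℝ≥0∞) * P.δ) = P.n * P.δ + (P.n * P.δ + (P.n * P.δ + 0)) by ring]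
  refine pr_bind_le (step I R hIK hR hI) fun x₀ h₀ => ?_
  refine pr_bind_le (step x₀.1 x₀.2 h₀.1 h₀.2.1 (h₀.2.2.weaken _)) fun x₁ h₁ => ?_
  refine pr_bind_le (step x₁.1 x₁.2 h₁.1 h₁.2.1 (h₁.2.2.weaken _)) fun x₂ h₂ => ?_
  exact pr_pure_le (a := (x₂.1, R ∪ x₀.2))
    (Q := fun x : Store × Finset ℕ => ¬ PendingOr P G l₀ Dm Q₀ [] x.1) (not_not.2 h₂.2.2) 0

/-- The nodes of a round sample independently, and each of them is listed once, so the probabilities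
of missing `w` multiply over `H`. -/
lemma pr_notifyRound_notMem {w : ℕ} {q : ℝ≥0∞} {H : Finset ℕ} (hP : Sizes P)
    (hq : ∀ x ∈ H, (sampleSet G x P.K).pr (fun S => w ∉ S) ≤ q) (I : Store) (R : Finset ℕ)
    (hH : H ⊆ R) : (notifyRound P G I R).pr (fun x => w ∉ x.2) ≤ q ^ H.card := by
  classical
  have key : ∀ (l : List ℕ) (acc : Store × Finset ℕ),
      (l.foldlM (fun (acc : Store × Finset ℕ) w => do
        let x ← refresh P G acc.1 w
        pure (x.1, acc.2 ∪ x.2)) acc : Comp (Store × Finset ℕ)).pr (fun x => w ∉ x.2) ≤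
        ind (w ∉ acc.2) * (l.map fun x => if x ∈ H then q else 1).prod := by
    intro l
    induction l with
    | nil => intro acc; simp [pr, ev_pure]
    | cons z l ih =>
      intro acc
      unfold pr at ih ⊢
      rw [List.foldlM_cons, ev_bind, ev_bind]
      simp only [ev_pure]
      rw [ev_refresh, List.map_cons, List.prod_cons]
      refine (ev_mono fun S => ih _).trans ?_
      have h1 : ∀ S : Finset ℕ, ind (w ∉ acc.2 ∪ S) ≤ ind (w ∉ acc.2) * ind (w ∉ S) := by
        intro S
        by_cases h1 : w ∈ acc.2 <;> by_cases h2 : w ∈ S <;> simp [ind, h1, h2]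
      refine (ev_mono fun S => mul_le_mul_left (h1 S) _).trans ?_
      simp only [mul_assoc]
      rw [ev_const_mul]
      gcongr
      simp only [mul_comm (ind _)]
      rw [ev_const_mul, mul_comm]
      gcongr
      split_ifs with hz
      · exact hq z hz
      · exact pr_le_one _ _
  unfold notifyRound
  refine (key (P.order R) (I, ∅)).trans ?_
  rw [ind_of (by simp), one_mul, ← List.prod_toFinset _ (hP.nodup_order R), (hP.order R).2,
    Finset.prod_ite, Finset.prod_const_one, mul_one, Finset.prod_const, Finset.filter_mem_eq_inter,
    Finset.inter_eq_right.2 hH]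

lemma pr_notifyLoop_notMem {w : ℕ} {q : ℝ≥0∞} {H : Finset ℕ} (hP : Sizes P)
    (hq : ∀ x ∈ H, (sampleSet G x P.K).pr (fun S => w ∉ S) ≤ q) (I : Store) (R : Finset ℕ)
    (hH : H ⊆ R) : (notifyLoop P G I R).pr (fun x => w ∉ x.2) ≤ q ^ H.card := by
  refine le_trans ?_ (pr_notifyRound_notMem hP hq I R hH)
  unfold notifyLoop pr
  simp only [ev_bind, ev_pure]
  refine ev_mono fun x₀ => ev_le fun x₁ => ev_le fun x₂ => ind_mono ?_
  simp only [Finset.mem_union, not_or]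
  exact fun h => h.2

end
end DynCC
end

noncomputable section
namespace DynCC
open DynCC.Comp

/-! ### Normal forms of the procedures -/

open Classical in
/-- The step of Clean(`u`) that treats the anchor `w`. -/
def cleanStep (P : Params) (G : NodeGraph) (u : ℕ) (s : State) (w : ℕ) : Comp State :=
  probAgreement P G w u >>= fun a => heavy P G w >>= fun b =>
    (if a && b then pure s else setSparse s (s.sparse.deleteEdges {s(w, u)})) >>= fun s =>
      chargeOps 1 >>= fun _ =>
        if P.ε * (s.ref w).card < ((s.ref w \ s.sparseNbhd G w).card : ℝ) then
          setSparse s (s.sparse.deleteIncidenceSet w) >>= fun s =>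
            chargeOps 1 >>= fun _ => pure { s with anchors := s.anchors.erase w }
        else pure s

lemma clean_eq (P : Params) (G : NodeGraph) (s : State) (u : ℕ) :
    clean P G s u = (P.order (s.anchorNbhd G u)).foldlM (cleanStep P G u) s := by
  unfold clean
  congr 1
  funext s w
  unfold cleanStep
  congr 1; funext a
  congr 1; funext b
  split_ifs <;> rfl

/-- The step of Anchor(`u`) that treats the neighbor `v`. -/
def anchorStep (P : Params) (G : NodeGraph) (u : ℕ) (s : State) (v : ℕ) : Comp State :=
  chargeQuery G >>= fun _ => probAgreement P G u v >>= fun a =>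
    if a then setSparse s (s.sparse ⊔ SimpleGraph.edge u v) else pure s

/-- The edges that Anchor(`u`) deletes first. -/
def anchorReset (s : State) (u : ℕ) : Comp State :=
  if u ∈ s.anchors then
    setSparse s (s.sparse.deleteEdges {e | ∃ v, v ∉ s.anchors ∧ e = s(u, v)})
  else pure s

/-- The `do` block carries the continuation of a conditional into both branches; here it is a
separate bind, to which the rules for sequencing apply. -/
lemma anchor_eq (P : Params) (G : NodeGraph) (s : State) (u : ℕ) :
    anchor P G s u = (degreeQuery G u >>= fun d => chargeOps 1 >>= fun _ =>
      Comp.sample (coin (anchorProb P d)) >>= fun X => anchorReset s u >>= fun s =>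
        heavy P G u >>= fun b =>
          (if b && X then (P.order (G.nbhd u)).foldlM (anchorStep P G u) s else pure s) >>= fun s =>
            pure (s, X)) := by
  unfold anchor anchorReset
  congr 1; funext d
  congr 1; funext _
  congr 1; funext X
  have key : ∀ (s : State) (b : Bool), (
      (if b && X then (P.order (G.nbhd u)).foldlM (anchorStep P G u) s else pure s) >>= fun s =>
            (pure (s, X) : Comp (State × Bool))) = if b && X then
      (P.order (G.nbhd u)).foldlM (anchorStep P G u) s >>= fun s => pure (s, X) else
      pure s >>= fun s => pure (s, X) := by
    intro s b
    split_ifs <;> rfl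
  simp only [key]
  split_ifs <;> rfl

/-- The step of Connect(`u`) that treats the anchor `r`. -/
def connectStep (P : Params) (G : NodeGraph) (u : ℕ) (s : State) (r : ℕ) : Comp State :=
  edgeQuery G r u >>= fun e => heavy P G r >>= fun b => probAgreement P G r u >>= fun a =>
    if e && b && a then setSparse s (s.sparse ⊔ SimpleGraph.edge r u) else pure s

lemma connect_eq (P : Params) (G : NodeGraph) (s : State) (u : ℕ) :
    connect P G s u = (sampleSet G u (P.size (10 ^ 5)) >>= fun J =>
      (P.order J).foldlM (fun s w =>
        (P.order (s.anchorNbhd G w)).foldlM (connectStep P G u) s) s) := rfl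

/-- The step of an iteration that processes the node `u`. -/
def processStep (P : Params) (G : NodeGraph) (acc : State × Finset ℕ × Finset ℕ) (u : ℕ) :
    Comp (State × Finset ℕ × Finset ℕ) :=
  clean P G acc.1 u >>= fun s => anchor P G s u >>= fun y => connect P G y.1 u >>= fun s =>
    pure (s, if y.2 then (insert u acc.2.1, acc.2.2) else (acc.2.1, insert u acc.2.2))

lemma processAll_eq (P : Params) (G : NodeGraph) (s : State) (𝓘 : Finset ℕ) :
    processAll P G s 𝓘 = ((P.order 𝓘).foldlM (processStep P G) (s, ∅, ∅) >>= fun x =>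
      finish P G x.1 x.2.1 x.2.2) := rfl

/-- The step of the end of an iteration that records the sparse neighborhood of `u`. -/
def recordStep (G : NodeGraph) (s : State) (u : ℕ) : Comp State :=
  chargeOps ((s.sparseNbhd G u).card + 1) >>= fun _ =>
    pure { s with ref := Function.update s.ref u (s.sparseNbhd G u) }

/-- The anchor set after an iteration. -/
def newAnchors (s : State) (on off : Finset ℕ) : Finset ℕ := (s.anchors \ off) ∪ on

lemma finish_eq (P : Params) (G : NodeGraph) (s : State) (on off : Finset ℕ) :
    finish P G s on off = (chargeOps (on.card + off.card) >>= fun _ =>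
      setSparse s (s.sparse.deleteEdges {e | ∀ v ∈ e, v ∉ newAnchors s on off}) >>= fun s' =>
        (P.order on).foldlM (recordStep G) { s' with anchors := newAnchors s on off }) := rfl

/-! ### Elementary properties of the procedures -/

section
variable {P : Params} {G : NodeGraph}

lemma ev_setSparse (s : State) (H : SimpleGraph ℕ) (f : State → ℝ≥0∞) :
    ev (setSparse s H) f = f { s with sparse := H } := by
  unfold setSparse chargeOps
  rw [ev_bind, ev_charge, ev_pure]

lemma sure_setSparse (s : State) (H : SimpleGraph ℕ) :
    (setSparse s H).Sure fun s' m => s' = { s with sparse := H } ∧ m.cq = 0 := by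
  unfold setSparse chargeOps
  exact sure_bind (sure_charge (sure_pure (by simp)))

/-- The changes of the state that are possible while the nodes of an iteration are processed. -/
def Pres (G : NodeGraph) (s s' : State) : Prop :=
  s'.I = s.I ∧ s'.anchors ⊆ s.anchors ∧ (s.sparse ≤ G.graph → s'.sparse ≤ G.graph)

lemma Pres.refl (s : State) : Pres G s s := ⟨rfl, subset_rfl, id⟩

lemma Pres.trans {s s' s'' : State} (h : Pres G s s') (h' : Pres G s' s'') : Pres G s s'' :=
  ⟨h'.1.trans h.1, h'.2.1.trans h.2.1, fun hs => h'.2.2 (h.2.2 hs)⟩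

lemma pres_sparse {s : State} {H : SimpleGraph ℕ} (h : s.sparse ≤ G.graph → H ≤ G.graph) :
    Pres G s { s with sparse := H } := ⟨rfl, subset_rfl, h⟩

lemma sure_pres_foldlM {α : Type} {f : State → α → Comp State} {l : List α}
    (h : ∀ a ∈ l, ∀ s, (f s a).Sure fun s' _ => Pres G s s') (s : State) :
    (l.foldlM f s).Sure fun s' _ => Pres G s s' :=
  sure_foldlM_inv (R := fun s' => Pres G s s')
    (fun a ha s' hs' => (h a ha s').mono fun _ _ h => hs'.trans h) (Pres.refl s)

lemma sure_cleanStep (u : ℕ) (s : State) (w : ℕ) :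
    (cleanStep P G u s w).Sure fun s' _ => Pres G s s' ∧ s'.sparse ≤ s.sparse := by
  unfold cleanStep
  refine sure_bind_val (sure_true _) fun a _ => sure_bind_val (sure_true _) fun b _ => ?_
  refine sure_bind_val (R := fun s' => Pres G s s' ∧ s'.sparse ≤ s.sparse) ?_ ?_
  · split_ifs
    · exact sure_pure ⟨Pres.refl s, le_rfl⟩
    · refine (sure_setSparse _ _).mono fun s' _ h => ?_
      obtain ⟨rfl, _⟩ := h
      exact ⟨pres_sparse fun h => (SimpleGraph.deleteEdges_le _).trans h, SimpleGraph.deleteEdges_le _⟩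
  · intro s₁ h₁
    refine sure_bind_val (sure_true _) fun _ _ => ?_
    split_ifs
    · refine sure_bind_val (sure_setSparse _ _ |>.mono fun _ _ h => h.1) fun s₂ h₂ => ?_
      subst h₂
      refine sure_bind_val (sure_true _) fun _ _ => sure_pure ⟨h₁.1.trans ⟨rfl, ?_, ?_⟩, ?_⟩
      · exact Finset.erase_subset _ _
      · exact fun h => (SimpleGraph.deleteIncidenceSet_le _ _).trans h
      · exact (SimpleGraph.deleteIncidenceSet_le _ _).trans h₁.2
    · exact sure_pure h₁

lemma sure_clean (s : State) (u : ℕ) : (clean P G s u).Sure fun s' _ => Pres G s s' := by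
  rw [clean_eq]
  exact sure_pres_foldlM (fun w _ s => (sure_cleanStep u s w).mono fun _ _ h => h.1) s

lemma edge_le_graph {u v : ℕ} (h : G.graph.Adj u v) : SimpleGraph.edge u v ≤ G.graph := by
  rw [SimpleGraph.edge_le_iff]
  exact Or.inr h

lemma sure_anchorStep {u v : ℕ} (hv : v ∈ G.nbhd u) (s : State) :
    (anchorStep P G u s v).Sure fun s' _ => Pres G s s' ∧ s'.anchors = s.anchors := by
  unfold anchorStep
  refine sure_bind_val (sure_true _) fun _ _ => sure_bind_val (sure_true _) fun a _ => ?_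
  split_ifs
  · refine (sure_setSparse _ _).mono fun s' _ h => ?_
    obtain ⟨rfl, _⟩ := h
    exact ⟨pres_sparse fun h => sup_le h (edge_le_graph (NodeGraph.mem_nbhd.1 hv).2), rfl⟩
  · exact sure_pure ⟨Pres.refl s, rfl⟩

lemma sure_anchorReset (s : State) (u : ℕ) :
    (anchorReset s u).Sure fun s' m => (Pres G s s' ∧ s'.anchors = s.anchors ∧
      s'.sparse ≤ s.sparse) ∧ m.cq = 0 := by
  unfold anchorReset
  split_ifs
  · refine (sure_setSparse _ _).mono fun s' _ h => ?_
    obtain ⟨rfl, hm⟩ := h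
    exact ⟨⟨pres_sparse fun h => (SimpleGraph.deleteEdges_le _).trans h, rfl,
      SimpleGraph.deleteEdges_le _⟩, hm⟩
  · exact sure_pure ⟨⟨Pres.refl s, rfl, le_rfl⟩, rfl⟩

lemma sure_anchor (hP : Sizes P) (s : State) (u : ℕ) :
    (anchor P G s u).Sure fun y _ => Pres G s y.1 := by
  rw [anchor_eq]
  refine sure_bind_val (sure_true _) fun d _ => sure_bind_val (sure_true _) fun _ _ =>
    sure_bind_val (sure_true _) fun X _ => ?_
  refine sure_bind_val ((sure_anchorReset (G := G) s u).mono fun _ _ h => h.1.1) fun s₁ h₁ => ?_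
  refine sure_bind_val (sure_true _) fun b _ => ?_
  refine sure_bind_val (R := fun s' => Pres G s s') ?_ fun s₂ h₂ => sure_pure h₂
  split_ifs
  · refine (sure_pres_foldlM (fun v hv s => (sure_anchorStep (hP.mem_order.1 hv) s).mono
      fun _ _ h => h.1) s₁).mono fun _ _ h => h₁.trans h
  · exact sure_pure h₁

lemma sure_connectStep (u : ℕ) (s : State) (r : ℕ) :
    (connectStep P G u s r).Sure fun s' _ => Pres G s s' := by
  unfold connectStep
  refine sure_bind_val ((sure_edgeQuery r u).mono fun _ _ h => h.1) fun e he => ?_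
  refine sure_bind_val (sure_true _) fun b _ => sure_bind_val (sure_true _) fun a _ => ?_
  split_ifs with h
  · refine (sure_setSparse _ _).mono fun s' _ h' => ?_
    obtain ⟨rfl, _⟩ := h'
    have : e = true := by cases e <;> simp_all
    exact pres_sparse fun h => sup_le h (edge_le_graph (he this))
  · exact sure_pure (Pres.refl s)

lemma sure_connect (s : State) (u : ℕ) : (connect P G s u).Sure fun s' _ => Pres G s s' := by
  rw [connect_eq]
  refine sure_bind_val (sure_true _) fun J _ => ?_
  exact sure_pres_foldlM (fun w _ s => sure_pres_foldlM (fun r _ s => sure_connectStep u s r) s) s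

/-- The processed nodes are sorted into the two lists. -/
lemma sure_processStep (hP : Sizes P) (acc : State × Finset ℕ × Finset ℕ) (u : ℕ) :
    (processStep P G acc u).Sure fun acc' _ => Pres G acc.1 acc'.1 ∧
      (acc'.2 = (insert u acc.2.1, acc.2.2) ∨ acc'.2 = (acc.2.1, insert u acc.2.2)) := by
  unfold processStep
  refine sure_bind_val (sure_clean acc.1 u) fun s₁ h₁ =>
    sure_bind_val (sure_anchor hP s₁ u) fun y h₂ => sure_bind_val (sure_connect y.1 u) fun s₃ h₃ =>
      sure_pure ⟨(h₁.trans h₂).trans h₃, ?_⟩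
  dsimp only
  split_ifs <;> simp

lemma sure_processLoop (hP : Sizes P) (s : State) (𝓘 : Finset ℕ) :
    ((P.order 𝓘).foldlM (processStep P G) (s, ∅, ∅)).Sure fun acc _ => Pres G s acc.1 ∧
      acc.2.1 ∪ acc.2.2 = 𝓘 := by
  classical
  have := sure_foldlM (f := processStep P G)
    (R := fun l acc => Pres G s acc.1 ∧ acc.2.1 ∪ acc.2.2 ∪ l.toFinset = 𝓘) ?_ (P.order 𝓘)
    (s, ∅, ∅) ⟨Pres.refl s, by simp [(hP.order 𝓘).2]⟩
  · refine this.mono fun acc _ h => ⟨h.1, by simpa using h.2⟩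
  · intro u l acc h
    refine (sure_processStep hP acc u).mono fun acc' _ h' => ⟨h.1.trans h'.1, ?_⟩
    rw [← h.2]
    rcases h'.2 with h' | h' <;> rw [h', List.toFinset_cons] <;> ext x <;>
      simp only [Finset.mem_union, Finset.mem_insert] <;> tauto

lemma sure_recordLoop (l : List ℕ) (s : State) :
    (l.foldlM (recordStep G) s).Sure fun s' _ =>
      s'.I = s.I ∧ s'.anchors = s.anchors ∧ s'.sparse = s.sparse := by
  refine sure_foldlM_inv
    (R := fun s' : State => s'.I = s.I ∧ s'.anchors = s.anchors ∧ s'.sparse = s.sparse)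
    (fun u _ s' h => ?_) ⟨rfl, rfl, rfl⟩
  unfold recordStep
  exact sure_bind_val (sure_true _) fun _ _ => sure_pure h

lemma sure_finish (s : State) (on off : Finset ℕ) :
    (finish P G s on off).Sure fun s' _ => s'.I = s.I ∧ s'.anchors = newAnchors s on off ∧
      s'.sparse = s.sparse.deleteEdges {e | ∀ v ∈ e, v ∉ newAnchors s on off} := by
  rw [finish_eq]
  refine sure_bind_val (sure_true _) fun _ _ => ?_
  refine sure_bind_val ((sure_setSparse _ _).mono fun _ _ h => h.1) fun s' h => ?_
  subst h
  exact sure_recordLoop _ _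

/-! ### One iteration -/

/-- The state at the beginning of an iteration, after a deleted node has left. -/
def baseState (e : Event) (s : State) : State :=
  match e with
  | .arrival _ => s
  | .deletion v =>
    { s with sparse := s.sparse.deleteIncidenceSet v, anchors := s.anchors.erase v }

/-- The part of an iteration after the notifications. -/
def processPhase (P : Params) (e : Event) (h : History) (s : State) (z : Store × Finset ℕ) :
    Comp State :=
  processAll P (graphOf (e :: h)) { baseState e s with I := z.1 } z.2

/-- The reaction of the algorithm to the event `e` after the history `h`. -/
def stepC (P : Params) (e : Event) (h : History) (s : State) : Comp State :=
  match e with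
  | .arrival S => onArrival P (graphOf (.arrival S :: h)) s (arrivals h)
  | .deletion v => onDeletion P (graphOf (.deletion v :: h)) s v

/-- The first phase reads nothing of the state but the stored samples. Hence the choice of the nodes
to be processed is independent of all anchor coins. -/
lemma ev_stepC (e : Event) (h : History) (s : State) (f : State → ℝ≥0∞) :
    ev (stepC P e h s) f =
      ev (notifyPhase P e h s.I) fun z => ev (processPhase P e h s z) f := by
  cases e with
  | arrival S =>
    simp only [stepC, onArrival, notifyPhase, processPhase, ev_bind, ev_pure]
    rfl
  | deletion v =>
    simp only [stepC, onDeletion, notifyPhase, processPhase, ev_bind, chargeOps, ev_charge,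
      ev_setSparse]
    rfl

lemma ec_setSparse (s : State) (H : SimpleGraph ℕ) : ec (setSparse s H) = 0 := by
  unfold setSparse chargeOps
  rw [ec_bind, ec_charge, ev_charge, ec_pure]
  simp

lemma ec_stepC (e : Event) (h : History) (s : State) :
    ec (stepC P e h s) =
      ec (notifyPhase P e h s.I) + ev (notifyPhase P e h s.I) fun z => ec (processPhase P e h s z) := by
  cases e with
  | arrival S =>
    simp only [stepC, onArrival, notifyPhase, processPhase, ec_bind, ev_bind, ev_pure, ec_pure,
      ev_const, ev_add, add_assoc, add_zero]
    rfl
  | deletion v =>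
    simp only [stepC, onDeletion, notifyPhase, processPhase, ec_bind, chargeOps, ev_charge,
      ec_charge, ev_setSparse, ec_setSparse, Cost.cq_mk, Nat.cast_zero, zero_add, add_zero]
    rfl

/-- The degrees that the nodes had when they were last processed. -/
def newDegs (G : NodeGraph) (dl : ℕ → ℕ) (𝓘 : Finset ℕ) : ℕ → ℕ :=
  fun w => if w ∈ 𝓘 then G.deg w else dl w

/-- The law of the state after a given stream, together with the degrees that the nodes had when
they were last processed. -/
def stateLaw (P : Params) : History → PMF (State × (ℕ → ℕ))
  | [] => PMF.pure (State.initial, fun _ => 0)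
  | e :: h => (stateLaw P h).bind fun x =>
      PMF.bind (show PMF _ from notifyPhase P e h x.1.I) fun z =>
        PMF.map (fun y => (y.1, newDegs (graphOf (e :: h)) x.2 z.1.2))
          (show PMF _ from processPhase P e h x.1 z.1)

lemma ex_stateLaw_cons (e : Event) (h : History) (f : State × (ℕ → ℕ) → ℝ≥0∞) :
    ex (stateLaw P (e :: h)) f = ex (stateLaw P h) fun x => ev (notifyPhase P e h x.1.I) fun z =>
      ev (processPhase P e h x.1 z) fun s' => f (s', newDegs (graphOf (e :: h)) x.2 z.2) := by
  rw [stateLaw, ex_bind]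
  congr 1
  funext x
  rw [ex_bind]
  refine congrArg (ex _) ?_
  funext z
  exact ex_map _ _ _

/-- The properties of the state that hold with certainty. -/
structure StateOK (P : Params) (h : History) (s : State) : Prop where
  store : StoreOK P s.I
  anchors : s.anchors ⊆ (graphOf h).verts
  sparse : s.sparse ≤ (graphOf h).graph
  endpoint : ∀ a b, s.sparse.Adj a b → a ∈ s.anchors ∨ b ∈ s.anchors

variable {e : Event} {h : History}

lemma baseState_anchors_subset (s : State) : (baseState e s).anchors ⊆ s.anchors := by
  cases e
  · exact subset_rfl
  · exact Finset.erase_subset _ _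

lemma baseState_sparse_le (s : State) : (baseState e s).sparse ≤ s.sparse := by
  cases e
  · exact le_rfl
  · exact SimpleGraph.deleteIncidenceSet_le _ _

lemma StateOK.base_anchors {s : State} (hs : StateOK P h s) :
    (baseState e s).anchors ⊆ (graphOf (e :: h)).verts := by
  cases e with
  | arrival S => exact hs.anchors.trans (Finset.subset_insert _ _)
  | deletion v => exact Finset.erase_subset_erase v hs.anchors

lemma StateOK.base_sparse {s : State} (hs : StateOK P h s) :
    (baseState e s).sparse ≤ (graphOf (e :: h)).graph := by
  intro a b hab
  cases e with
  | arrival S => exact graphOf_adj_arrival.2 (Or.inl (hs.sparse hab))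
  | deletion v =>
    obtain ⟨hab, ha, hb⟩ := SimpleGraph.deleteIncidenceSet_adj.1 hab
    exact graphOf_adj_deletion.2 ⟨hs.sparse hab, ha, hb⟩

lemma StateOK.base_endpoint {s : State} (hs : StateOK P h s) {a b : ℕ}
    (hab : (baseState e s).sparse.Adj a b) :
    a ∈ (baseState e s).anchors ∨ b ∈ (baseState e s).anchors := by
  cases e with
  | arrival S => exact hs.endpoint a b hab
  | deletion v =>
    obtain ⟨hab, ha, hb⟩ := SimpleGraph.deleteIncidenceSet_adj.1 hab
    exact (hs.endpoint a b hab).imp (fun h => Finset.mem_erase.2 ⟨ha, h⟩)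
      (fun h => Finset.mem_erase.2 ⟨hb, h⟩)

lemma sure_processPhase (hP : Sizes P) {s : State} (hs : StateOK P h s)
    {z : Store × Finset ℕ} (hz₁ : StoreOK P z.1) (hz₂ : z.2 ⊆ (graphOf (e :: h)).verts) :
    (processPhase P e h s z).Sure fun s' _ => StateOK P (e :: h) s' := by
  unfold processPhase
  rw [processAll_eq]
  refine sure_bind_val (sure_processLoop hP _ _) fun acc hacc => ?_
  refine (sure_finish _ _ _).mono fun s' _ hs' => ?_
  obtain ⟨⟨h₁, h₂, h₃⟩, h₄⟩ := hacc
  refine ⟨?_, ?_, ?_, ?_⟩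
  · rw [hs'.1, h₁]; exact hz₁
  · rw [hs'.2.1]
    refine Finset.union_subset ?_ ?_
    · exact Finset.sdiff_subset.trans (h₂.trans hs.base_anchors)
    · exact (h₄ ▸ Finset.subset_union_left).trans hz₂
  · rw [hs'.2.2]
    exact (SimpleGraph.deleteEdges_le _).trans (h₃ hs.base_sparse)
  · intro a b hab
    rw [hs'.2.2, SimpleGraph.deleteEdges_adj] at hab
    rw [hs'.2.1]
    by_contra hn
    rw [not_or] at hn
    refine hab.2 fun v hv => ?_
    rcases Sym2.mem_iff.1 hv with rfl | rfl
    · exact hn.1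
    · exact hn.2

lemma sure_processPhase_store (hP : Sizes P) (s : State) (z : Store × Finset ℕ) :
    (processPhase P e h s z).Sure fun s' _ => s'.I = z.1 := by
  unfold processPhase
  rw [processAll_eq]
  refine sure_bind_val (sure_processLoop hP _ _) fun acc hacc => ?_
  exact (sure_finish _ _ _).mono fun s' _ hs' => hs'.1.trans hacc.1.1

lemma stateOK_of_mem_support (hP : Sizes P) (hv : Valid P.n h) {x : State × (ℕ → ℕ)}
    (hx : x ∈ (stateLaw P h).support) : StateOK P h x.1 := by
  induction h generalizing x with
  | nil =>
    rw [stateLaw, PMF.mem_support_pure_iff] at hx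
    subst hx
    exact ⟨fun _ _ => by simp [State.initial], by simp [State.initial], by simp [State.initial],
      by simp [State.initial]⟩
  | cons e h ih =>
    rw [stateLaw, PMF.mem_support_bind_iff] at hx
    obtain ⟨x₀, hx₀, hx⟩ := hx
    obtain ⟨z, hz, hx⟩ := (PMF.mem_support_bind_iff _ _ _).1 hx
    obtain ⟨y, hy, rfl⟩ := (PMF.mem_support_map_iff _ _ _).1 hx
    have h₀ := ih hv.tail hx₀
    have h₁ := sure_notifyPhase hP hv h₀.store z hz
    exact sure_processPhase hP h₀ h₁.1 h₁.2.1 y hy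

end
end DynCC
end

noncomputable section
namespace DynCC
open DynCC.Comp

/-! ### Nodes in dense spots have been processed recently -/

lemma ind_exists_le {ι : Type*} (s : Finset ι) (Q : ι → Prop) :
    ind (∃ i ∈ s, Q i) ≤ ∑ i ∈ s, ind (Q i) := by
  by_cases h : ∃ i ∈ s, Q i
  · obtain ⟨i, hi, hQ⟩ := h
    refine (ind_le_one _).trans ?_
    rw [← ind_of hQ]
    exact Finset.single_le_sum (f := fun i => ind (Q i)) (fun _ _ => zero_le) hi
  · rw [ind_of_not h]; exact zero_le

/-- The neighbors of `w` of degree at most `2 * D`. -/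
def lowNbhd (G : NodeGraph) (w D : ℕ) : Finset ℕ := (G.nbhd w).filter fun x => G.deg x ≤ 2 * D

/-- Nodes with many neighbors of degree `O(D)` were last processed with degree `Ω(D)`. -/
def Fresh (h : History) (dl : ℕ → ℕ) : Prop :=
  ∀ w ∈ (graphOf h).verts, ∀ D, 1 ≤ D → D ≤ 2 * (lowNbhd (graphOf h) w D).card → D ≤ 8 * dl w

section
variable {P : Params} {h h' : History} {e : Event} {w D : ℕ}

/-- The present nodes that will have been deleted at the end of the stream `h`. -/
def Doomed (h h' : History) (y : ℕ) : Prop := y ∈ (graphOf h').verts ∧ y ∉ (graphOf h).verts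

/-- The lowest level of the samples that are considered. -/
def baseLevel (D : ℕ) : ℕ := Nat.log 2 D + 3

/-- The offset 3 puts `2 ^ baseLevel D` between `4 * D` and `8 * D`. From this level on a degree is
more than twice the final bound `2 * D`; below it a draw hits a given neighbor with probability at
least `1 / (8 * D)`. -/
lemma two_pow_baseLevel_le (hD : 1 ≤ D) : 2 ^ baseLevel D ≤ 8 * D := by
  have := Nat.pow_log_le_self 2 (x := D) (by omega)
  rw [baseLevel, pow_add]; omega

lemma lt_two_pow_baseLevel : 4 * D < 2 ^ baseLevel D := by
  have := Nat.lt_pow_succ_log_self (b := 2) (by norm_num) D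
  rw [baseLevel, pow_add]; rw [pow_succ] at this; omega

open Classical in
/-- The low neighbors of `w` at the end of the stream that have not arrived yet or are pending. -/
def waiting (P : Params) (h : History) (w D : ℕ) (h' : History) (I : Store) : Finset ℕ :=
  (lowNbhd (graphOf h) w D).filter fun x =>
    x ∉ (graphOf h').verts ∨ Pending P (baseLevel D) (Doomed h h') I x

/-- The probability that a node misses `w`. -/
def missProb (P : Params) (D : ℕ) : ℝ≥0∞ := ENNReal.ofReal (1 - 1 / (2 ^ baseLevel D : ℕ)) ^ P.K

lemma missProb_le_one : missProb P D ≤ 1 := by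
  refine pow_le_one₀ zero_le ?_
  rw [ENNReal.ofReal_le_one]
  have : (0 : ℝ) ≤ 1 / (2 ^ baseLevel D : ℕ) := by positivity
  linarith

/-- In `K * c ≥ K * D / 4` draws, each successful with probability at least `1 / (8 * D)`, the
expected number of hits is at least `K / 32`. -/
lemma missProb_pow_le (hP : Sizes P) (hD : 1 ≤ D) {c : ℕ} (hc : D ≤ 4 * c) :
    missProb P D ^ c ≤ P.δ := by
  have hK := hP.logb_le_K
  have hL := hP.one_le_logb
  refine le_trans ?_ (hP.exp_le (x := P.K / 32) (by linarith))
  have h2 : (1 : ℝ) ≤ (2 ^ baseLevel D : ℕ) := by exact_mod_cast Nat.one_le_two_pow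
  have h0 : (0 : ℝ) ≤ 1 - 1 / (2 ^ baseLevel D : ℕ) := by
    have : 1 / ((2 ^ baseLevel D : ℕ) : ℝ) ≤ 1 := by
      rw [div_le_one (by linarith)]; exact h2
    linarith
  rw [missProb, ← ENNReal.ofReal_pow h0, ← ENNReal.ofReal_pow (by positivity)]
  refine ENNReal.ofReal_le_ofReal ?_
  rw [← pow_mul]
  calc (1 - 1 / ((2 ^ baseLevel D : ℕ) : ℝ)) ^ (P.K * c)
      ≤ Real.exp (-(1 / ((2 ^ baseLevel D : ℕ) : ℝ))) ^ (P.K * c) := by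
        gcongr
        have := Real.add_one_le_exp (-(1 / ((2 ^ baseLevel D : ℕ) : ℝ)))
        linarith
    _ = Real.exp (-(P.K * c / ((2 ^ baseLevel D : ℕ) : ℝ))) := by
        rw [← Real.exp_nat_mul]; congr 1; push_cast; ring
    _ ≤ _ := by
        refine Real.exp_le_exp.2 (neg_le_neg ?_)
        rw [div_le_div_iff₀ (by norm_num) (by linarith)]
        have h3 : ((2 ^ baseLevel D : ℕ) : ℝ) ≤ 8 * D := by exact_mod_cast two_pow_baseLevel_le hD
        have h4 : (D : ℝ) ≤ 4 * c := by exact_mod_cast hc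
        have : (0 : ℝ) ≤ P.K := by positivity
        nlinarith

/-- A node that is present at an earlier time, and at the end, is present in between. -/
lemma mem_verts_cons_of_mem (hv : Valid P.n h) (hs : e :: h' <:+ h) (hw : w ∈ (graphOf h).verts)
    (hw' : w ∈ (graphOf h').verts) : w ∈ (graphOf (e :: h')).verts :=
  mem_verts_of_suffix hs hw (((hv.suffix hs).tail.lt_arrivals hw').trans_le
    (arrivals_mono (List.suffix_cons e h')))

lemma mem_lowNbhd {G : NodeGraph} {x : ℕ} :
    x ∈ lowNbhd G w D ↔ x ∈ G.nbhd w ∧ G.deg x ≤ 2 * D := by simp [lowNbhd]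

/-- A neighbor that survives to the end is still a neighbor then, so at most `2 * D` neighbors are
not doomed, while the present degree exceeds `4 * D`. -/
lemma halfDoomed (hv : Valid P.n h) (hs : h' <:+ h) {Q₀ : Finset ℕ}
    (hQ : ∀ x ∈ Q₀, x ∈ lowNbhd (graphOf h) w D) :
    HalfDoomed (graphOf h') (baseLevel D) (Doomed h h') Q₀ := by
  classical
  intro x hx hl
  obtain ⟨hx₁, hx₂⟩ := mem_lowNbhd.1 (hQ x hx)
  have h₁ : ((graphOf h').nbhd x).filter (fun y => ¬ Doomed h h' y) ⊆ (graphOf h).nbhd x := by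
    intro y hy
    obtain ⟨hy₁, hy₂⟩ := Finset.mem_filter.1 hy
    have : y ∈ (graphOf h).verts := by
      by_contra hn
      exact hy₂ ⟨NodeGraph.nbhd_subset _ _ hy₁, hn⟩
    exact mem_nbhd_of_suffix hv hs (NodeGraph.nbhd_subset _ _ hx₁) this hy₁
  have h₂ := Finset.card_le_card h₁
  have h₃ : (graphOf h').deg x ≠ 0 := by
    intro h0
    rw [h0, Nat.log_zero_right, baseLevel] at hl
    omega
  have h₄ := (Nat.pow_le_pow_right (by norm_num : 0 < 2) hl).trans (Nat.pow_log_le_self 2 h₃)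
  have h₅ := lt_two_pow_baseLevel (D := D)
  change _ ≤ (graphOf h).deg x at h₂
  omega

/-- `x` and `w` are adjacent at the end, hence at all times when both are present. -/
lemma pr_sample_misses (hv : Valid P.n h) (hs : e :: h' <:+ h) (hw : w ∈ (graphOf h).verts)
    (hw' : w ∈ (graphOf h').verts) {x : ℕ} (hx : x ∈ lowNbhd (graphOf h) w D)
    (hx' : x ∈ (graphOf (e :: h')).verts)
    (hl : Nat.log 2 ((graphOf (e :: h')).deg x) < baseLevel D) :
    (sampleSet (graphOf (e :: h')) x P.K).pr (fun S => w ∉ S) ≤ missProb P D := by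
  have hx₁ := (mem_lowNbhd.1 hx).1
  have hx₂ := NodeGraph.mem_nbhd.1 hx₁
  have hwe := mem_verts_cons_of_mem hv hs hw hw'
  refine pr_notMem_sampleSet ?_ (Nat.lt_pow_of_log_lt (by norm_num) hl).le _
  exact NodeGraph.mem_nbhd.2 ⟨hwe, (adj_suffix_iff hv hs hx₂.1 hw hx' hwe).1 hx₂.2.symm⟩

/-- From the bounds on missing `w` and on losing pending nodes to the potential. -/
lemma potential_step {c : Comp (Store × Finset ℕ)} {q η : ℝ≥0∞} (hq : q ≤ 1) {C H : Finset ℕ}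
    {F : Store → Finset ℕ} {R : Store → Prop} (hH : H ⊆ C) (h₁ : c.pr (fun z => w ∉ z.2) ≤ q ^ H.card)
    (h₂ : c.pr (fun z => ¬ R z.1) ≤ η) (h₃ : ∀ I, R I → C \ H ⊆ F I) :
    c.ev (fun z => ind (w ∉ z.2) * q ^ (F z.1).card) ≤ q ^ C.card + η := by
  -- Losing the nodes of `H` from the waiting set raises the power by `q ^ (-|H|)`, which the
  -- probability `q ^ |H|` that all of them miss `w` makes up for.
  calc _ ≤ c.ev (fun z => q ^ (C.card - H.card) * ind (w ∉ z.2) + ind (¬ R z.1)) := by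
        refine ev_mono fun z => ?_
        by_cases hR : R z.1
        · refine le_trans ?_ le_self_add
          rw [mul_comm]
          refine mul_le_mul_left (pow_le_pow_of_le_one zero_le hq ?_) _
          rw [← Finset.card_sdiff_of_subset hH]
          exact Finset.card_le_card (h₃ _ hR)
        · rw [ind_of hR]
          refine le_trans ?_ le_add_self
          exact mul_le_one' (ind_le_one _) (pow_le_one₀ zero_le hq)
    _ ≤ q ^ (C.card - H.card) * q ^ H.card + η := by
        rw [ev_add, ev_const_mul]
        gcongr
        · exact h₁
        · exact h₂
    _ = _ := by rw [← pow_add, Nat.sub_add_cancel (Finset.card_le_card hH)]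

/-- The supermartingale property, up to the small probability that a pending state is lost. Nodes
leave the waiting set only by refreshing at a level below `baseLevel D` at the start of the
notifications, and then they may sample `w`, which is processed in that case. -/
lemma waiting_step (hP : Sizes P) (hv : Valid P.n h) (hs : e :: h' <:+ h)
    (hw : w ∈ (graphOf h).verts) (hw' : w ∈ (graphOf h').verts) {I : Store} (hI : StoreOK P I) :
    (notifyPhase P e h' I).ev (fun z => ind (w ∉ z.2) *
        missProb P D ^ (waiting P h w D (e :: h') z.1).card) ≤
      missProb P D ^ (waiting P h w D h' I).card + (3 * (P.n * P.δ) + P.δ) := by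
  classical
  have hve := hv.suffix hs
  set G := graphOf (e :: h') with hG
  have mem_low : ∀ x ∈ waiting P h w D h' I, x ∈ lowNbhd (graphOf h) w D := fun x hx =>
    (Finset.mem_filter.1 hx).1
  have hl₀ : 0 < baseLevel D := by unfold baseLevel; omega
  have final : ∀ (H : Finset ℕ) (I' : Store), PendingOr P G (baseLevel D) (Doomed h (e :: h'))
      ((waiting P h w D h' I).filter (fun x => x ∈ G.verts) \ H) [] I' →
      waiting P h w D h' I \ H ⊆ waiting P h w D (e :: h') I' := by
    intro H I' hR x hx
    obtain ⟨hx₁, hx₂⟩ := Finset.mem_sdiff.1 hx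
    refine Finset.mem_filter.2 ⟨mem_low x hx₁, ?_⟩
    by_cases hxv : x ∈ G.verts
    · exact Or.inr ((hR x (Finset.mem_sdiff.2 ⟨Finset.mem_filter.2 ⟨hx₁, hxv⟩, hx₂⟩)).resolve_right
        (by simp))
    · exact Or.inl hxv
  cases e with
  | arrival S =>
    set u := arrivals h' with hu
    -- Only the arriving node can stop waiting, and only if its degree is low.
    set H := ({u} : Finset ℕ).filter fun x =>
      x ∈ waiting P h w D h' I ∧ Nat.log 2 (G.deg x) < baseLevel D with hH
    set Q₀ := (waiting P h w D h' I).filter (fun x => x ∈ G.verts) \ H with hQ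
    have hdoom : HalfDoomed G (baseLevel D) (Doomed h (.arrival S :: h')) Q₀ :=
      halfDoomed hv hs fun x hx => mem_low x (Finset.mem_filter.1 (Finset.mem_sdiff.1 hx).1).1
    refine potential_step missProb_le_one (H := H) ?_ ?_ ?_ (final H)
    · exact fun x hx => (Finset.mem_filter.1 hx).2.1
    · unfold pr notifyPhase
      simp only [ev_bind, ev_pure]
      rw [ev_refresh]
      by_cases hH' : u ∈ H
      · have : H = {u} := Finset.Subset.antisymm (Finset.filter_subset _ _)
          (Finset.singleton_subset_iff.2 hH')
        rw [this, Finset.card_singleton, pow_one]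
        have hu' := (Finset.mem_filter.1 hH').2
        refine le_trans (ev_mono fun T => ?_) (pr_sample_misses (P := P) hv hs hw hw' (mem_low u hu'.1)
          (by rw [graphOf_verts_arrival]; exact Finset.mem_insert_self _ _) hu'.2)
        unfold notifyLoop
        simp only [ev_bind, ev_pure]
        refine ev_le fun _ => ev_le fun _ => ev_le fun _ => ind_mono ?_
        simp only [Finset.mem_insert, Finset.mem_union, not_or]
        exact fun h => h.2.1
      · have : H = ∅ := by
          refine Finset.eq_empty_of_forall_notMem fun x hx => hH' ?_
          have := Finset.mem_singleton.1 (Finset.mem_filter.1 hx).1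
          rwa [← this]
        rw [this, Finset.card_empty, pow_zero]
        exact ev_le fun _ => ev_le fun _ => ind_le_one _
    · unfold notifyPhase
      rw [add_comm]
      refine pr_bind_le (R := fun x => StoreOK P x.1 ∧ x.2 ⊆ G.verts ∧
        PendingOr P G (baseLevel D) (Doomed h (.arrival S :: h')) Q₀ [] x.1) ?_ fun x hx => ?_
      · refine (pr_mono_sure (sure_refresh I hI _) ?_).trans
          (pr_refresh_pending hP hve.card_le hl₀ hdoom u [] I ?_)
        · intro x k hx hn hp
          exact hn ⟨hx.1, hx.2.1.trans (NodeGraph.nbhd_subset _ _), hp⟩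
        · intro x hx
          obtain ⟨hx₁, hx₂⟩ := Finset.mem_sdiff.1 hx
          obtain ⟨hx₁, hx₃⟩ := Finset.mem_filter.1 hx₁
          by_cases hxu : x = u
          · right
            refine ⟨by simp [hxu], ?_⟩
            by_contra hlt
            exact hx₂ (Finset.mem_filter.2 ⟨by simp [hxu], hx₁, not_le.1 hlt⟩)
          · left
            have hx₄ : x ∈ (graphOf h').verts := by
              rw [hG, graphOf_verts_arrival] at hx₃
              exact (Finset.mem_insert.1 hx₃).resolve_left hxu
            obtain ⟨l, hl, hl', y, hy, hD⟩ := (Finset.mem_filter.1 hx₁).2.resolve_left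
              (not_not.2 hx₄)
            exact ⟨l, hl, hl', y, hy, Finset.mem_insert_of_mem hD.1, hD.2⟩
      · rw [← add_zero (3 * _)]
        refine pr_bind_le (pr_notifyLoop_pending hP hve.card_le hl₀ hdoom x.1 hx.1 x.2 hx.2.1
          (hx.2.2.weaken _)) fun y hy => ?_
        exact pr_pure_le (a := (y.1, insert u y.2)) (Q := fun z : Store × Finset ℕ =>
          ¬ PendingOr P G (baseLevel D) (Doomed h (.arrival S :: h')) Q₀ [] z.1) (not_not.2 hy) 0
  | deletion v =>
    set R := receivers P G I v with hR
    -- The waiting nodes that are notified directly and have low degree by now.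
    set H := R.filter fun x =>
      x ∈ waiting P h w D h' I ∧ Nat.log 2 (G.deg x) < baseLevel D with hH
    set Q₀ := (waiting P h w D h' I).filter (fun x => x ∈ G.verts) \ H with hQ
    have hdoom : HalfDoomed G (baseLevel D) (Doomed h (.deletion v :: h')) Q₀ :=
      halfDoomed hv hs fun x hx => mem_low x (Finset.mem_filter.1 (Finset.mem_sdiff.1 hx).1).1
    have hI' : StoreOK P (Function.update I v fun _ => ∅) := by
      intro w l
      by_cases hw : w = v
      · subst hw; simp
      · rw [Function.update_of_ne hw]; exact hI w l
    refine potential_step missProb_le_one (H := H) ?_ ?_ ?_ (final H)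
    · exact fun x hx => (Finset.mem_filter.1 hx).2.1
    · refine pr_notifyLoop_notMem hP ?_ _ _ (Finset.filter_subset _ _)
      intro x hx
      obtain ⟨hx₁, hx₂, hx₃⟩ := Finset.mem_filter.1 hx
      exact pr_sample_misses hv hs hw hw' (mem_low x hx₂) (receivers_subset _ _ hx₁) hx₃
    · refine (pr_notifyLoop_pending hP hve.card_le hl₀ hdoom _ hI' _ (receivers_subset _ _)
        ?_).trans le_self_add
      intro x hx
      obtain ⟨hx₁, hx₂⟩ := Finset.mem_sdiff.1 hx
      obtain ⟨hx₁, hx₃⟩ := Finset.mem_filter.1 hx₁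
      by_cases hxR : x ∈ R
      · right
        refine ⟨hP.mem_order.2 hxR, ?_⟩
        by_contra hlt
        exact hx₂ (Finset.mem_filter.2 ⟨hxR, hx₁, not_le.1 hlt⟩)
      · left
        obtain ⟨hxv, hx₄⟩ := Finset.mem_erase.1 hx₃
        obtain ⟨l, hl, hl', y, hy, hD⟩ := (Finset.mem_filter.1 hx₁).2.resolve_left
          (not_not.2 hx₄)
        refine ⟨l, hl, hl', y, ?_, Finset.mem_erase.2 ⟨?_, hD.1⟩, hD.2⟩
        · rw [Function.update_of_ne hxv]; exact hy
        -- Had the doomed node in the sample been the one deleted now, `x` would be a receiver.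
        · rintro rfl
          exact hxR (mem_receivers.2 ⟨hx₃, l, hl', hy⟩)

/-- A low neighbor at the end that is already present is a neighbor of `w` already. There are fewer
than `D / 8` of these, so of the at least `D / 2` low neighbors the rest has not arrived. -/
lemma card_waiting (hv : Valid P.n h) (hs : h' <:+ h) (hw : w ∈ (graphOf h).verts)
    (hw' : w ∈ (graphOf h').verts) (hlow : D ≤ 2 * (lowNbhd (graphOf h) w D).card)
    (hd : 8 * (graphOf h').deg w < D) (I : Store) : D ≤ 4 * (waiting P h w D h' I).card := by
  classical
  have : lowNbhd (graphOf h) w D ⊆ waiting P h w D h' I ∪ (graphOf h').nbhd w := by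
    intro x hx
    have hx₁ := NodeGraph.mem_nbhd.1 (mem_lowNbhd.1 hx).1
    by_cases hxv : x ∈ (graphOf h').verts
    · refine Finset.mem_union_right _ (NodeGraph.mem_nbhd.2 ⟨hxv, ?_⟩)
      exact (adj_suffix_iff hv hs hw hx₁.1 hw' hxv).1 hx₁.2
    · exact Finset.mem_union_left _ (Finset.mem_filter.2 ⟨hx, Or.inl hxv⟩)
  have h₁ := (Finset.card_le_card this).trans (Finset.card_union_le _ _)
  change _ ≤ _ + (graphOf h').deg w at h₁
  omega

/-- The induction runs over the prefixes `h'` in time of a fixed stream `h`, which determines the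
doomed nodes and the low neighbors. Whenever `w` is processed the potential restarts: it vanishes if
the degree of `w` is large, and is at most `δ` by `card_waiting` otherwise. -/
lemma ex_waiting_le (hP : Sizes P) (hv : Valid P.n h) (hw : w ∈ (graphOf h).verts)
    (hD : 1 ≤ D) (hlow : D ≤ 2 * (lowNbhd (graphOf h) w D).card) (hs : h' <:+ h)
    (hw' : w ∈ (graphOf h').verts) :
    ex (stateLaw P h') (fun x => ind (8 * x.2 w < D) *
        missProb P D ^ (waiting P h w D h' x.1.I).card) ≤
      h'.length * (3 * (P.n * P.δ) + P.δ + P.δ) := by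
  induction h' with
  | nil => simp [graphOf, NodeGraph.empty] at hw'
  | cons e h' ih =>
    have hs' : h' <:+ h := (List.suffix_cons e h').trans hs
    rw [ex_stateLaw_cons]
    set η := 3 * (P.n * P.δ) + P.δ with hη
    -- the nodes that are processed with small degree
    have processed : ∀ (dl : ℕ → ℕ) (I : Store) (T : Finset ℕ), w ∈ T →
        ind (8 * newDegs (graphOf (e :: h')) dl T w < D) *
          missProb P D ^ (waiting P h w D (e :: h') I).card ≤ P.δ := by
      intro dl I T hT
      by_cases hd : 8 * (graphOf (e :: h')).deg w < D
      · rw [newDegs, if_pos hT, ind_of hd, one_mul]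
        exact missProb_pow_le hP hD (card_waiting hv hs hw hw' hlow hd I)
      · rw [newDegs, if_pos hT, ind_of_not hd, zero_mul]
        exact zero_le
    have store : ∀ (x : State × (ℕ → ℕ)) (z : Store × Finset ℕ),
        ev (processPhase P e h' x.1 z) (fun s' =>
          ind (8 * newDegs (graphOf (e :: h')) x.2 z.2 w < D) *
            missProb P D ^ (waiting P h w D (e :: h') s'.I).card) ≤
          ind (8 * newDegs (graphOf (e :: h')) x.2 z.2 w < D) *
            missProb P D ^ (waiting P h w D (e :: h') z.1).card := by
      intro x z
      exact ev_le_of_sure (sure_processPhase_store hP x.1 z) fun s' _ hs' => by rw [hs']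
    rcases mem_verts_cons hw' with hw'' | ⟨⟨S, rfl⟩, hwa⟩
    · have step : ∀ x ∈ (stateLaw P h').support, ev (notifyPhase P e h' x.1.I) (fun z =>
          ev (processPhase P e h' x.1 z) fun s' =>
            ind (8 * newDegs (graphOf (e :: h')) x.2 z.2 w < D) *
            missProb P D ^ (waiting P h w D (e :: h') s'.I).card) ≤
          ind (8 * x.2 w < D) * missProb P D ^ (waiting P h w D h' x.1.I).card + (η + P.δ) := by
        intro x hx
        have hI := (stateOK_of_mem_support hP (hv.suffix hs') hx).store
        calc _ ≤ ev (notifyPhase P e h' x.1.I) (fun z => ind (8 * x.2 w < D) * (ind (w ∉ z.2) *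
              missProb P D ^ (waiting P h w D (e :: h') z.1).card) + P.δ) := by
              refine ev_mono fun z => (store x z).trans ?_
              by_cases hz : w ∈ z.2
              · exact (processed x.2 z.1 z.2 hz).trans le_add_self
              · rw [newDegs, if_neg hz, ind_of hz, one_mul]
                exact le_self_add
          _ ≤ ind (8 * x.2 w < D) * (missProb P D ^ (waiting P h w D h' x.1.I).card + η) + P.δ := by
              rw [ev_add, ev_const, ev_const_mul]
              gcongr
              exact waiting_step hP hv hs hw hw'' hI
          _ ≤ _ := by
              rw [mul_add, add_assoc]
              gcongr
              exact mul_le_of_le_one_left zero_le (ind_le_one _)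
      refine (ex_mono_support step).trans ?_
      rw [ex_add, ex_const]
      refine (add_le_add (ih hs' hw'') le_rfl).trans_eq ?_
      rw [List.length_cons]; push_cast; ring
    · refine le_trans (ex_le_of_le (c := P.δ) fun x _ => ?_) ?_
      -- If `w` has just arrived, it is processed in the same iteration.
      · refine ev_le_of_sure (sure_notifyPhase_arrival S h' x.1.I) fun z _ hz => ?_
        exact (store x z).trans (processed x.2 z.1 z.2 (hwa ▸ hz))
      · rw [List.length_cons]
        push_cast
        rw [add_mul, one_mul]
        exact le_add_self.trans le_add_self

lemma ex_stale_le (hP : Sizes P) (hv : Valid P.n h) (hw : w ∈ (graphOf h).verts)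
    (hD : 1 ≤ D) (hlow : D ≤ 2 * (lowNbhd (graphOf h) w D).card) :
    ex (stateLaw P h) (fun x => ind (8 * x.2 w < D)) ≤ 10 * P.n ^ 2 * P.δ := by
  classical
  have := ex_waiting_le hP hv hw hD hlow (List.suffix_refl h) hw
  refine le_trans (ex_mono fun x => ?_) (this.trans ?_)
  -- At the end of the stream all low neighbors have arrived and nothing is doomed, so the power in
  -- the potential is 1.
  · have : waiting P h w D h x.1.I = ∅ := by
      refine Finset.filter_eq_empty_iff.2 fun y hy => ?_
      rintro (hn | ⟨_, _, _, z, _, hz⟩)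
      · exact hn (NodeGraph.nbhd_subset _ _ (mem_lowNbhd.1 hy).1)
      · exact hz.2 hz.1
    rw [this]
    simp
  · have h1 : (1 : ℝ≥0∞) ≤ P.n := by exact_mod_cast (le_trans (by norm_num) hP.two_le : 1 ≤ P.n)
    have h2 : (h.length : ℝ≥0∞) ≤ 2 * P.n := by exact_mod_cast hv.length_le
    calc (h.length : ℝ≥0∞) * (3 * (P.n * P.δ) + P.δ + P.δ)
        ≤ 2 * P.n * (3 * (P.n * P.δ) + P.n * P.δ + P.n * P.δ) := by
          gcongr
          · exact le_mul_of_one_le_left zero_le h1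
          · exact le_mul_of_one_le_left zero_le h1
      _ = _ := by ring

/-- With high probability, all nodes in dense spots have been processed recently. -/
lemma ex_not_fresh_le (hP : Sizes P) (hv : Valid P.n h) :
    ex (stateLaw P h) (fun x => ind (¬ Fresh h x.2)) ≤ 30 * P.n ^ 4 * P.δ := by
  classical
  have h1 : 1 ≤ P.n := le_trans (by norm_num) hP.two_le
  have step : ∀ x : State × (ℕ → ℕ), ind (¬ Fresh h x.2) ≤
      ∑ w ∈ Finset.range P.n, ∑ D ∈ Finset.range (2 * P.n + 1),
        ind (w ∈ (graphOf h).verts ∧ 1 ≤ D ∧ D ≤ 2 * (lowNbhd (graphOf h) w D).card ∧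
          8 * x.2 w < D) := by
    intro x
    refine le_trans (ind_mono ?_) ((ind_exists_le _ _).trans
      (Finset.sum_le_sum fun w _ => ind_exists_le _ _))
    intro hn
    unfold Fresh at hn
    push Not at hn
    obtain ⟨w, hw, D, hD, hlow, hlt⟩ := hn
    refine ⟨w, Finset.mem_range.2 (hv.lt hw), D, Finset.mem_range.2 ?_, hw, hD, hlow, hlt⟩
    have h2 := hv.deg_le w
    have h3 : (lowNbhd (graphOf h) w D).card ≤ (graphOf h).deg w :=
      Finset.card_le_card (Finset.filter_subset _ _)
    omega
  refine (ex_mono step).trans ?_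
  simp only [ex_sum]
  calc _ ≤ ∑ w ∈ Finset.range P.n, ∑ D ∈ Finset.range (2 * P.n + 1), 10 * (P.n : ℝ≥0∞) ^ 2 * P.δ := by
        refine Finset.sum_le_sum fun w _ => Finset.sum_le_sum fun D _ => ?_
        by_cases hc : w ∈ (graphOf h).verts ∧ 1 ≤ D ∧ D ≤ 2 * (lowNbhd (graphOf h) w D).card
        · refine le_trans (ex_mono fun x => ind_mono fun hx => hx.2.2.2)
            (ex_stale_le hP hv hc.1 hc.2.1 hc.2.2)
        · refine le_trans (ex_le_of_le (c := 0) fun x _ => (ind_of_not ?_).le) zero_le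
          tauto
    _ = ((P.n * (2 * P.n + 1) * 10 : ℕ) : ℝ≥0∞) * P.n ^ 2 * P.δ := by
        simp only [Finset.sum_const, Finset.card_range, nsmul_eq_mul]
        push_cast
        ring
    _ ≤ ((30 * P.n ^ 2 : ℕ) : ℝ≥0∞) * P.n ^ 2 * P.δ := by
        refine mul_le_mul_left (mul_le_mul_left (Nat.cast_le.2 ?_) _) _
        nlinarith
    _ = _ := by push_cast; ring

end
end DynCC
end

noncomputable section
namespace DynCC
open DynCC.Comp

/-! ### The number of anchors in a given set of nodes -/

section
variable {P : Params} {G : NodeGraph}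

lemma ex_coin (p : NNReal) (g : Bool → ℝ≥0∞) :
    ex (coin p) g = min (p : ℝ≥0∞) 1 * g true + (1 - min (p : ℝ≥0∞) 1) * g false := by
  unfold ex
  rw [tsum_fintype, Fintype.sum_bool]
  simp [coin, PMF.ofFintype_apply]

/-- The coin depends on the state and the tests in no way, only on the degree. -/
lemma ev_anchor_snd (s : State) (u : ℕ) (g : Bool → ℝ≥0∞) :
    ev (anchor P G s u) (fun y => g y.2) = ex (coin (anchorProb P (G.deg u))) g := by
  rw [anchor_eq]
  simp only [ev_bind, ev_pure, ev_const, chargeOps, degreeQuery, ev_sample]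

lemma ev_processStep_snd (acc : State × Finset ℕ × Finset ℕ) (u : ℕ)
    (g : Finset ℕ × Finset ℕ → ℝ≥0∞) :
    ev (processStep P G acc u) (fun a => g a.2) = ex (coin (anchorProb P (G.deg u))) fun X =>
      g (if X then (insert u acc.2.1, acc.2.2) else (acc.2.1, insert u acc.2.2)) := by
  unfold processStep
  simp only [ev_bind, ev_pure, ev_const]
  simp only [ev_anchor_snd (g := fun X => g (if X = true then (insert u acc.2.1, acc.2.2)
    else (acc.2.1, insert u acc.2.2))), ev_const]

/-- The tossing probability at degree `m`. -/
def tossProb (P : Params) (m : ℕ) : ℝ≥0∞ :=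
  ENNReal.ofReal (10 ^ 7 * Real.logb 2 P.n / (P.ε * m))

lemma anchorProb_le (hP : Sizes P) {m d : ℕ} (hm : 1 ≤ m) (hd : m ≤ d) :
    (anchorProb P d : ℝ≥0∞) ≤ tossProb P m := by
  unfold anchorProb tossProb
  rw [if_neg (by omega)]
  change ENNReal.ofReal _ ≤ _
  refine ENNReal.ofReal_le_ofReal ?_
  have := hP.one_le_logb
  have := hP.eps_pos
  have : (0 : ℝ) < m := by exact_mod_cast hm
  gcongr

/-- An independent coin of success probability `p` has `E[2 ^ X] = 1 + p`, and the coins of the loop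
are independent. -/
lemma ev_on_le (hP : Sizes P) {m : ℕ} (hm : 1 ≤ m) (B : Finset ℕ) (hB : ∀ u ∈ B, m ≤ G.deg u)
    (l : List ℕ) (acc : State × Finset ℕ × Finset ℕ) :
    ev (l.foldlM (processStep P G) acc) (fun a => 2 ^ (B ∩ a.2.1).card) ≤
      2 ^ (B ∩ acc.2.1).card * (l.map fun u => if u ∈ B then 1 + tossProb P m else 1).prod := by
  induction l generalizing acc with
  | nil => simp [ev_pure]
  | cons u l ih =>
    rw [List.foldlM_cons, ev_bind, List.map_cons, List.prod_cons, ← mul_assoc]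
    refine (ev_mono fun a => ih a).trans ?_
    simp only [mul_comm _ (List.prod _)]
    rw [ev_const_mul]
    gcongr
    rw [ev_processStep_snd (g := fun c => 2 ^ (B ∩ c.1).card), ex_coin]
    set p := min (anchorProb P (G.deg u) : ℝ≥0∞) 1 with hp
    have hp1 : p ≤ 1 := min_le_right _ _
    simp only [if_true, Bool.false_eq_true, if_false]
    by_cases hu : u ∈ B
    · rw [if_pos hu]
      have h1 : (B ∩ insert u acc.2.1).card ≤ (B ∩ acc.2.1).card + 1 := by
        refine (Finset.card_le_card ?_).trans (Finset.card_insert_le u _)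
        intro x hx
        simp only [Finset.mem_inter, Finset.mem_insert] at hx ⊢
        tauto
      have h2 : p ≤ tossProb P m := (min_le_left _ _).trans (anchorProb_le hP hm (hB u hu))
      calc p * 2 ^ (B ∩ insert u acc.2.1).card + (1 - p) * 2 ^ (B ∩ acc.2.1).card
          ≤ p * 2 ^ ((B ∩ acc.2.1).card + 1) + (1 - p) * 2 ^ (B ∩ acc.2.1).card := by
            gcongr
            norm_num
        _ = 2 ^ (B ∩ acc.2.1).card * ((p + (1 - p)) + p) := by ring
        _ = 2 ^ (B ∩ acc.2.1).card * (1 + p) := by rw [add_tsub_cancel_of_le hp1]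
        _ ≤ _ := by gcongr
    · rw [if_neg hu, Finset.inter_insert_of_notMem hu, ← add_mul, add_tsub_cancel_of_le hp1]
      rw [one_mul, mul_one]

/-- The anchors of `A` that were last processed with degree at least `m`. -/
def bigAnchors (A : Finset ℕ) (m : ℕ) (Φ : Finset ℕ) (dl : ℕ → ℕ) : Finset ℕ :=
  A.filter fun w => w ∈ Φ ∧ m ≤ dl w

variable {e : Event} {h : History}

/-- Processed nodes are anchors only by a fresh coin. For all other nodes `dl` is unchanged and they
cannot become anchors. -/
lemma ev_bigAnchors_le (hP : Sizes P) {m : ℕ} (hm : 1 ≤ m) (A : Finset ℕ) (s : State)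
    (dl : ℕ → ℕ) (z : Store × Finset ℕ) :
    ev (processPhase P e h s z) (fun s' =>
        2 ^ (bigAnchors A m s'.anchors (newDegs (graphOf (e :: h)) dl z.2)).card) ≤
      (1 + tossProb P m) ^ (A ∩ z.2).card * 2 ^ (bigAnchors (A \ z.2) m s.anchors dl).card := by
  set G := graphOf (e :: h) with hG
  set B := (A ∩ z.2).filter fun u => m ≤ G.deg u with hB
  unfold processPhase
  rw [processAll_eq, ev_bind]
  have step : ∀ (acc : State × Finset ℕ × Finset ℕ) (k : Cost),
      (Pres G { baseState e s with I := z.1 } acc.1 ∧ acc.2.1 ∪ acc.2.2 = z.2) →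
      ev (finish P G acc.1 acc.2.1 acc.2.2) (fun s' =>
        2 ^ (bigAnchors A m s'.anchors (newDegs G dl z.2)).card) ≤
      2 ^ (bigAnchors (A \ z.2) m s.anchors dl).card * 2 ^ (B ∩ acc.2.1).card := by
    intro acc _ hacc
    refine ev_le_of_sure (sure_finish acc.1 acc.2.1 acc.2.2) fun s' _ hs' => ?_
    rw [← pow_add]
    refine pow_le_pow_right₀ (by norm_num) ((Finset.card_le_card ?_).trans
      (Finset.card_union_le _ _))
    intro w hw
    obtain ⟨hwA, hwΦ, hwm⟩ := Finset.mem_filter.1 hw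
    rw [hs'.2.1, newAnchors, Finset.mem_union, Finset.mem_sdiff] at hwΦ
    by_cases hz : w ∈ z.2
    · rw [newDegs, if_pos hz] at hwm
      refine Finset.mem_union_right _ (Finset.mem_inter.2 ⟨Finset.mem_filter.2
        ⟨Finset.mem_inter.2 ⟨hwA, hz⟩, hwm⟩, ?_⟩)
      rw [← hacc.2, Finset.mem_union] at hz
      tauto
    · rw [newDegs, if_neg hz] at hwm
      rw [← hacc.2, Finset.mem_union, not_or] at hz
      have : w ∈ acc.1.anchors := by tauto
      refine Finset.mem_union_left _ (Finset.mem_filter.2 ⟨Finset.mem_sdiff.2 ⟨hwA, ?_⟩, ?_, hwm⟩)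
      · rw [← hacc.2, Finset.mem_union]; tauto
      · exact baseState_anchors_subset s (hacc.1.2.1 this)
  refine (ev_mono_sure (sure_processLoop hP _ _) step).trans ?_
  rw [ev_const_mul, mul_comm]
  gcongr
  refine (ev_on_le hP hm B (fun u hu => (Finset.mem_filter.1 hu).2) _ _).trans ?_
  rw [Finset.inter_empty, Finset.card_empty, pow_zero, one_mul,
    ← List.prod_toFinset _ (hP.nodup_order z.2), (hP.order z.2).2, Finset.prod_ite,
    Finset.prod_const_one, mul_one, Finset.prod_const]
  refine pow_le_pow_right₀ le_self_add (Finset.card_le_card fun u hu => ?_)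
  exact (Finset.mem_filter.1 (Finset.mem_filter.1 hu).2).1

/-- Which toss of a node is its last one is decided by the stored samples, and these do not depend
on the coins. The weight `g` carries this information through the induction: nodes of `A` processed
in the last update contribute fresh coins, the others fall under the induction hypothesis for a
smaller set. -/
lemma ex_bigAnchors_le (hP : Sizes P) {m : ℕ} (hm : 1 ≤ m) (h : History) (g : Store → ℝ≥0∞)
    (A : Finset ℕ) :
    ex (stateLaw P h) (fun x => g x.1.I * 2 ^ (bigAnchors A m x.1.anchors x.2).card) ≤
      (1 + tossProb P m) ^ A.card * ex (stateLaw P h) (fun x => g x.1.I) := by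
  classical
  induction h generalizing g A with
  | nil =>
    rw [stateLaw, ex_pure, ex_pure]
    have : bigAnchors A m State.initial.anchors (fun _ => 0) = ∅ := by
      simp [bigAnchors, State.initial]
    rw [this, Finset.card_empty, pow_zero, mul_one]
    exact le_mul_of_one_le_left zero_le (one_le_pow₀ le_self_add)
  | cons e h ih =>
    set r := 1 + tossProb P m with hr
    rw [ex_stateLaw_cons, ex_stateLaw_cons]
    have store : ∀ (x : State × (ℕ → ℕ)) (z : Store × Finset ℕ),
        ev (processPhase P e h x.1 z) (fun s' => g s'.I) = g z.1 := by
      intro x z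
      refine le_antisymm (ev_le_of_sure (sure_processPhase_store hP x.1 z) fun s' _ hs' => by
        rw [hs']) ?_
      rw [← ev_const (processPhase P e h x.1 z) (g z.1)]
      exact ev_mono_sure (sure_processPhase_store hP x.1 z) fun s' _ hs' => by rw [hs']
    simp only [store]
    -- The event that exactly the nodes `B` of `A` are processed, as a weight on the store before
    -- the update.
    set gB : Finset ℕ → Store → ℝ≥0∞ := fun B I =>
      ev (notifyPhase P e h I) fun z => ind (A ∩ z.2 = B) * g z.1 with hgB
    have hsum : ∀ (z : Store × Finset ℕ) (f : Finset ℕ → ℝ≥0∞),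
        f (A ∩ z.2) = ∑ B ∈ A.powerset, ind (A ∩ z.2 = B) * f B := by
      intro z f
      rw [Finset.sum_eq_single (A ∩ z.2)]
      · rw [ind_of rfl, one_mul]
      · intro B _ hB
        rw [ind_of_not (Ne.symm hB), zero_mul]
      · intro hn
        exact absurd (Finset.mem_powerset.2 Finset.inter_subset_left) hn
    have evsum : ∀ (I : Store) (F : Finset ℕ → Store × Finset ℕ → ℝ≥0∞),
        ev (notifyPhase P e h I) (fun z => ∑ B ∈ A.powerset, F B z) =
          ∑ B ∈ A.powerset, ev (notifyPhase P e h I) (F B) := fun I F => ex_sum _ _ _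
    calc _ ≤ ex (stateLaw P h) (fun x => ev (notifyPhase P e h x.1.I) fun z =>
            g z.1 * (r ^ (A ∩ z.2).card * 2 ^ (bigAnchors (A \ (A ∩ z.2)) m x.1.anchors x.2).card)) := by
          refine ex_mono fun x => ev_mono fun z => ?_
          rw [Finset.sdiff_inter_self_left]
          refine le_trans ?_ (mul_le_mul_right
            (ev_bigAnchors_le (e := e) (h := h) hP hm A x.1 x.2 z) _)
          rw [← ev_const_mul]
          exact ev_mono_sure (sure_processPhase_store hP x.1 z) fun s' _ hs' => by rw [hs']
      _ = ex (stateLaw P h) (fun x => ∑ B ∈ A.powerset,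
            r ^ B.card * (gB B x.1.I * 2 ^ (bigAnchors (A \ B) m x.1.anchors x.2).card)) := by
          congr 1
          funext x
          simp only [hgB, ← ev_mul_const, ← ev_const_mul]
          rw [← evsum]
          congr 1
          funext z
          rw [hsum z fun B => g z.1 *
            (r ^ B.card * 2 ^ (bigAnchors (A \ B) m x.1.anchors x.2).card)]
          refine Finset.sum_congr rfl fun B _ => ?_
          ring
      _ = ∑ B ∈ A.powerset, r ^ B.card *
            ex (stateLaw P h) (fun x => gB B x.1.I * 2 ^ (bigAnchors (A \ B) m x.1.anchors x.2).card) := by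
          rw [ex_sum]
          simp only [ex_const_mul]
      _ ≤ ∑ B ∈ A.powerset, r ^ B.card *
            (r ^ (A \ B).card * ex (stateLaw P h) (fun x => gB B x.1.I)) := by
          gcongr with B hB
          exact ih (gB B) (A \ B)
      _ = ∑ B ∈ A.powerset, r ^ A.card * ex (stateLaw P h) (fun x => gB B x.1.I) := by
          refine Finset.sum_congr rfl fun B hB => ?_
          rw [← mul_assoc, ← pow_add, ← Finset.card_sdiff_add_card_eq_card (Finset.mem_powerset.1 hB),
            add_comm]
      _ = _ := by
          rw [← Finset.mul_sum, ← ex_sum]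
          congr 2
          funext x
          rw [hgB, ← evsum]
          congr 1
          funext z
          exact (hsum z fun _ => g z.1).symm

/-- The number of anchors in a set of size `O(m)` that were last processed with degree at least
`m` is logarithmic. -/
lemma ex_many_bigAnchors_le (hP : Sizes P) {m : ℕ} (hm : 1 ≤ m) (h : History) (A : Finset ℕ)
    (hA : A.card ≤ 64 * m) :
    ex (stateLaw P h) (fun x => ind (P.K ≤ (bigAnchors A m x.1.anchors x.2).card)) ≤ P.δ := by
  have hL := hP.one_le_logb
  have hε := hP.eps_pos
  set a := Real.logb 2 P.n / P.ε with ha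
  have ha0 : 0 ≤ a := by positivity
  have hm0 : (0 : ℝ) < m := by exact_mod_cast hm
  have h₁ := ex_bigAnchors_le hP hm h (fun _ => 1) A
  simp only [one_mul, ex_const, mul_one] at h₁
  have half : (2⁻¹ : ℝ≥0∞) = ENNReal.ofReal 2⁻¹ := by
    rw [ENNReal.ofReal_inv_of_pos (by norm_num)]; simp
  have h₂ : (1 + tossProb P m) ^ A.card ≤ ENNReal.ofReal (Real.exp (64 * 10 ^ 7 * a)) := by
    have e₁ : 1 + tossProb P m ≤ ENNReal.ofReal (Real.exp (10 ^ 7 * a / m)) := by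
      rw [tossProb, ← ENNReal.ofReal_one, ← ENNReal.ofReal_add (by norm_num) (by positivity)]
      refine ENNReal.ofReal_le_ofReal ?_
      have := Real.add_one_le_exp (10 ^ 7 * a / m)
      have e : 10 ^ 7 * Real.logb 2 P.n / (P.ε * m) = 10 ^ 7 * a / m := by
        rw [ha]; field_simp
      rw [e]; linarith
    refine (pow_le_pow_left' e₁ _).trans ?_
    rw [← ENNReal.ofReal_pow (by positivity), ← Real.exp_nat_mul]
    refine ENNReal.ofReal_le_ofReal (Real.exp_le_exp.2 ?_)
    have : (A.card : ℝ) ≤ 64 * m := by exact_mod_cast hA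
    calc (A.card : ℝ) * (10 ^ 7 * a / m) ≤ 64 * m * (10 ^ 7 * a / m) := by gcongr
      _ = _ := by field_simp
  -- With `K ≥ 10 ^ 10 * a` the factor `2 ^ (-K)` outweighs the moment `exp (64 * 10 ^ 7 * a)`.
  have h₃ : (2⁻¹ : ℝ≥0∞) ^ P.K ≤ ENNReal.ofReal (Real.exp (-(5 * 10 ^ 9 * a))) := by
    rw [half, ← ENNReal.ofReal_pow (by norm_num)]
    refine ENNReal.ofReal_le_ofReal ?_
    have h2 : (2⁻¹ : ℝ) ≤ Real.exp (-(1 / 2)) := by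
      have := Real.add_one_le_exp (-(1 / 2) : ℝ)
      linarith
    calc (2⁻¹ : ℝ) ^ P.K ≤ Real.exp (-(1 / 2)) ^ P.K := by gcongr
      _ = Real.exp (-(P.K / 2)) := by rw [← Real.exp_nat_mul]; congr 1; ring
      _ ≤ _ := by
        refine Real.exp_le_exp.2 ?_
        have := Sizes.le_size P (10 ^ 10)
        rw [mul_div_assoc, ← ha] at this
        change _ ≤ (P.K : ℝ) at this
        linarith
  calc _ ≤ ex (stateLaw P h) (fun x => 2⁻¹ ^ P.K * 2 ^ (bigAnchors A m x.1.anchors x.2).card) := by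
        refine ex_mono fun x => ?_
        by_cases hx : P.K ≤ (bigAnchors A m x.1.anchors x.2).card
        · rw [ind_of hx]
          calc (1 : ℝ≥0∞) = 2⁻¹ ^ P.K * 2 ^ P.K := by
                rw [← mul_pow, ENNReal.inv_mul_cancel (by norm_num) (by norm_num), one_pow]
            _ ≤ _ := by
                gcongr
                norm_num
        · rw [ind_of_not hx]; exact zero_le
    _ ≤ ENNReal.ofReal (Real.exp (-(5 * 10 ^ 9 * a))) * ENNReal.ofReal (Real.exp (64 * 10 ^ 7 * a)) := by
        rw [ex_const_mul]
        exact mul_le_mul' h₃ (h₁.trans h₂)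
    _ = ENNReal.ofReal (Real.exp (-(436 * 10 ^ 7 * a))) := by
        rw [← ENNReal.ofReal_mul (by positivity), ← Real.exp_add]
        congr 2; ring
    _ ≤ _ := by
        refine hP.exp_le ?_
        have := hP.logb_le (c := 1) (by norm_num)
        rw [one_mul, ← ha] at this
        linarith

/-! ### The number of anchors next to a node -/

/-- At some time of the stream `w` was a neighbor of `u` and `u` had degree `O(m)`. -/
def Witness (h : History) (m u w : ℕ) : Prop :=
  ∃ h', h' <:+ h ∧ w ∈ (graphOf h').nbhd u ∧ (graphOf h').deg u ≤ 16 * m + 16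

/-- `A` is the neighborhood of `u` at the last time when its degree had level `j`: earlier neighbors
that are still present were neighbors at that time too. -/
lemma exists_levelSet {n : ℕ} (hv : Valid n h) (u j : ℕ) : ∃ A : Finset ℕ, A.card ≤ 2 ^ (j + 1) ∧
    ∀ w ∈ (graphOf h).verts, ∀ h', h' <:+ h → w ∈ (graphOf h').nbhd u →
      Nat.log 2 ((graphOf h').deg u) = j → w ∈ A := by
  induction h with
  | nil => exact ⟨∅, by simp, fun w hw => by simp [graphOf, NodeGraph.empty] at hw⟩
  | cons e h ih =>
    -- Positivity matters because an isolated or deleted `u` also has `Nat.log` equal to 0.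
    by_cases hc : 0 < (graphOf (e :: h)).deg u ∧ Nat.log 2 ((graphOf (e :: h)).deg u) = j
    · refine ⟨(graphOf (e :: h)).nbhd u, ?_, ?_⟩
      · have := Nat.lt_pow_succ_log_self (b := 2) (by norm_num) ((graphOf (e :: h)).deg u)
        rw [hc.2] at this
        exact this.le
      · intro w hw h' hs hwu _
        obtain ⟨y, hy⟩ := Finset.card_pos.1 hc.1
        exact mem_nbhd_of_suffix hv hs (hv.wf _ _ (NodeGraph.mem_nbhd.1 hy).2) hw hwu
    · obtain ⟨A, hA, hA'⟩ := ih hv.tail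
      refine ⟨A, hA, fun w hw h' hs hwu hj => ?_⟩
      rcases List.suffix_cons_iff.1 hs with rfl | hs'
      · exact absurd ⟨Finset.card_pos.2 ⟨w, hwu⟩, hj⟩ hc
      · refine hA' w ?_ h' hs' hwu hj
        have := (hv.suffix hs).lt_arrivals (NodeGraph.nbhd_subset _ _ hwu)
        exact mem_verts_of_suffix (List.suffix_cons e h) hw (this.trans_le (arrivals_mono hs'))

open Classical in
/-- Every node has few anchors that can be connected to it in the sparse solution. -/
def Sparsely (P : Params) (h : History) (Φ : Finset ℕ) (dl : ℕ → ℕ) : Prop :=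
  ∀ u, (Φ.filter fun w => Witness h (dl w) u w).card ≤ P.K ^ 2

lemma Sizes.levels_le_n (hP : Sizes P) : P.levels ≤ P.n :=
  Nat.log_lt_self 2 (by have := hP.two_le; omega)

/-- Each level of the degree of `u` contributes at most `K` anchors. Levels below 5 have at most 32
candidates. For `j ≥ 5`, a witness gives `2 ^ j ≤ 16 * dl w + 16`, so `dl w ≥ 2 ^ (j - 5)`, while
the candidates number at most `64 * 2 ^ (j - 5)`. -/
lemma ex_not_sparsely_le (hP : Sizes P) (hv : Valid P.n (e :: h)) :
    ex (stateLaw P h) (fun x => ind (¬ Sparsely P (e :: h) (baseState e x.1).anchors x.2)) ≤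
      P.n ^ 2 * P.δ := by
  classical
  choose A hA hA' using fun u j => exists_levelSet hv u j
  have step : ∀ x ∈ (stateLaw P h).support,
      ind (¬ Sparsely P (e :: h) (baseState e x.1).anchors x.2) ≤
      ∑ u ∈ Finset.range P.n, ∑ j ∈ Finset.range P.levels,
        ind (5 ≤ j ∧ P.K ≤ (bigAnchors (A u j) (2 ^ (j - 5)) x.1.anchors x.2).card) := by
    intro x hx
    have hok := stateOK_of_mem_support hP hv.tail hx
    refine le_trans (ind_mono ?_) ((ind_exists_le _ _).trans
      (Finset.sum_le_sum fun w _ => ind_exists_le _ _))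
    intro hn
    by_contra hall
    push Not at hall
    refine hn fun u => ?_
    by_cases hu : u < P.n
    · have sub : ((baseState e x.1).anchors.filter fun w => Witness (e :: h) (x.2 w) u w) ⊆
          (Finset.range P.levels).biUnion fun j =>
            if 5 ≤ j then bigAnchors (A u j) (2 ^ (j - 5)) x.1.anchors x.2 else A u j := by
        intro w hw
        obtain ⟨hwΦ, h', hs, hwu, hd⟩ := Finset.mem_filter.1 hw
        have hpos : 0 < (graphOf h').deg u := Finset.card_pos.2 ⟨w, hwu⟩
        have hwA := hA' u _ w (hok.base_anchors hwΦ) h' hs hwu rfl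
        refine Finset.mem_biUnion.2 ⟨Nat.log 2 ((graphOf h').deg u), Finset.mem_range.2 ?_, ?_⟩
        · exact Nat.lt_succ_of_le (Nat.log_mono_right ((hv.suffix hs).deg_le u))
        · set j := Nat.log 2 ((graphOf h').deg u) with hj
          split_ifs with h5
          · refine Finset.mem_filter.2 ⟨hwA, baseState_anchors_subset _ hwΦ, ?_⟩
            have h1 := Nat.pow_log_le_self 2 hpos.ne'
            rw [← hj] at h1
            obtain ⟨i, hi⟩ := Nat.exists_eq_add_of_le h5
            rw [hi, pow_add] at h1
            rw [hi, Nat.add_sub_cancel_left]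
            have : 1 ≤ 2 ^ i := Nat.one_le_two_pow
            omega
          · exact hwA
      refine (Finset.card_le_card sub).trans (Finset.card_biUnion_le.trans ?_)
      have : ∀ j ∈ Finset.range P.levels, (if 5 ≤ j then
          bigAnchors (A u j) (2 ^ (j - 5)) x.1.anchors x.2 else A u j).card ≤ P.K := by
        intro j hj
        split_ifs with h5
        · exact (hall u (Finset.mem_range.2 hu) j hj h5).le
        · refine (hA u j).trans ?_
          have : 2 ^ (j + 1) ≤ 2 ^ 5 := Nat.pow_le_pow_right (by norm_num) (by omega)
          have := hP.hundred_le_K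
          omega
      refine (Finset.sum_le_sum this).trans ?_
      rw [Finset.sum_const, Finset.card_range, smul_eq_mul, pow_two]
      exact Nat.mul_le_mul_right _ hP.levels_le
    · have : ((baseState e x.1).anchors.filter fun w => Witness (e :: h) (x.2 w) u w) = ∅ := by
        refine Finset.filter_eq_empty_iff.2 fun w _ => ?_
        rintro ⟨h', hs, hwu, _⟩
        have := (hv.suffix hs).wf u w (NodeGraph.mem_nbhd.1 hwu).2
        exact hu ((hv.suffix hs).lt this)
      rw [this]; simp
  refine (ex_mono_support step).trans ?_
  simp only [ex_sum]
  calc _ ≤ ∑ u ∈ Finset.range P.n, ∑ j ∈ Finset.range P.levels, P.δ := by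
        refine Finset.sum_le_sum fun u _ => Finset.sum_le_sum fun j _ => ?_
        by_cases h5 : 5 ≤ j
        · refine le_trans (ex_mono fun x => ind_mono fun hx => hx.2)
            (ex_many_bigAnchors_le hP Nat.one_le_two_pow h (A u j) ((hA u j).trans ?_))
          obtain ⟨i, rfl⟩ := Nat.exists_eq_add_of_le h5
          rw [Nat.add_sub_cancel_left, show 5 + i + 1 = 6 + i by ring, pow_add]
          norm_num
        · refine le_trans (ex_le_of_le (c := 0) fun x _ => (ind_of_not ?_).le) zero_le
          tauto
    _ = (P.n * P.levels : ℝ≥0∞) * P.δ := by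
        simp only [Finset.sum_const, Finset.card_range, nsmul_eq_mul]
        ring
    _ ≤ _ := by
        rw [pow_two]
        gcongr
        exact hP.levels_le_n

end
end DynCC
end

noncomputable section
namespace DynCC
open DynCC.Comp

/-! ### The edges of the sparse solution -/

/-- Most neighbors of `w` have degree at most `1.3` times the degree of `w`. -/
def Dense (G : NodeGraph) (w : ℕ) : Prop :=
  7 * G.deg w ≤ 10 * ((G.nbhd w).filter fun x => 10 * G.deg x ≤ 13 * G.deg w).card

/-- What the tests guarantee for the edges that enter the sparse solution. -/
structure NewEdge (G : NodeGraph) (a b : ℕ) : Prop where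
  adj : G.graph.Adj a b
  left_le : G.deg a ≤ 2 * G.deg b
  right_le : G.deg b ≤ 2 * G.deg a
  left_dense : Dense G a
  right_dense : Dense G b

lemma NewEdge.symm {G : NodeGraph} {a b : ℕ} (h : NewEdge G a b) : NewEdge G b a :=
  ⟨h.adj.symm, h.right_le, h.left_le, h.right_dense, h.left_dense⟩

lemma Agr.bounds {G : NodeGraph} {a b : ℕ} (h : Agr G a b) :
    9 * G.deg a ≤ 10 * G.deg b ∧ 9 * G.deg b ≤ 10 * G.deg a := by
  have h₁ : (G.nbhd a ∩ G.nbhd b).card ≤ G.deg a := Finset.card_le_card Finset.inter_subset_left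
  have h₂ : (G.nbhd a ∩ G.nbhd b).card ≤ G.deg b := Finset.card_le_card Finset.inter_subset_right
  obtain ⟨h₃, h₄⟩ := h
  omega

/-- Agreement makes degrees equal up to a factor 10/9. At `b` the density comes from the nodes that
agree with `a` and are common neighbors: both sets fill nine tenths of `N(a)`, so they share at
least eight tenths of it. -/
lemma newEdge_of_tests {G : NodeGraph} {a b : ℕ} (hab : G.graph.Adj a b) (h : Agr G a b)
    (ha : Hvy G a) : NewEdge G a b := by
  classical
  have hb := h.bounds
  unfold Hvy at ha
  refine ⟨hab, by omega, by omega, ?_, ?_⟩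
  · unfold Dense
    have : (G.nbhd a).filter (fun v => Agr G a v) ⊆
        (G.nbhd a).filter fun x => 10 * G.deg x ≤ 13 * G.deg a := by
      intro x hx
      obtain ⟨hx₁, hx₂⟩ := Finset.mem_filter.1 hx
      have := hx₂.bounds
      exact Finset.mem_filter.2 ⟨hx₁, by omega⟩
    have := Finset.card_le_card this
    omega
  · unfold Dense
    have h₁ : (G.nbhd a).filter (fun v => Agr G a v) ∩ (G.nbhd a ∩ G.nbhd b) ⊆
        (G.nbhd b).filter fun x => 10 * G.deg x ≤ 13 * G.deg b := by
      intro x hx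
      obtain ⟨hx₁, hx₂⟩ := Finset.mem_inter.1 hx
      have := (Finset.mem_filter.1 hx₁).2.bounds
      exact Finset.mem_filter.2 ⟨(Finset.mem_inter.1 hx₂).2, by omega⟩
    have h₂ := Finset.card_le_card h₁
    have h₃ := Finset.card_union_add_card_inter ((G.nbhd a).filter (fun v => Agr G a v))
      (G.nbhd a ∩ G.nbhd b)
    have h₄ : ((G.nbhd a).filter (fun v => Agr G a v) ∪ (G.nbhd a ∩ G.nbhd b)).card ≤ G.deg a :=
      Finset.card_le_card (Finset.union_subset (Finset.filter_subset _ _) Finset.inter_subset_left)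
    have h₅ := h.1
    omega

/-- The invariant of an iteration: `Φ₀` is the anchor set at its beginning, `Wt` is a property of
the edges at anchors, and the nodes of `S` have been processed. -/
structure Inv (G : NodeGraph) (Φ₀ : Finset ℕ) (Wt : ℕ → ℕ → Prop) (S : Set ℕ) (s : State) :
    Prop where
  anchors : s.anchors ⊆ Φ₀
  sparse : s.sparse ≤ G.graph
  witness : ∀ w ∈ s.anchors, ∀ u, s.sparse.Adj w u → Wt w u
  endpoint : ∀ a b, s.sparse.Adj a b → a ∈ s.anchors ∨ b ∈ s.anchors ∨ NewEdge G a b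
  processed : ∀ w ∈ S, ∀ u, s.sparse.Adj w u → G.deg u ≤ 2 * G.deg w

section
variable {P : Params} {G : NodeGraph} {Φ₀ : Finset ℕ} {Wt : ℕ → ℕ → Prop} {S : Set ℕ} {s : State}

lemma Inv.mono_set {T : Set ℕ} (h : Inv G Φ₀ Wt S s) (hT : T ⊆ S) : Inv G Φ₀ Wt T s :=
  ⟨h.anchors, h.sparse, h.witness, h.endpoint, fun w hw => h.processed w (hT hw)⟩

lemma Inv.shrink (h : Inv G Φ₀ Wt S s) {H : SimpleGraph ℕ} (hH : H ≤ s.sparse) :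
    Inv G Φ₀ Wt S { s with sparse := H } :=
  ⟨h.anchors, hH.trans h.sparse, fun w hw u hu => h.witness w hw u (hH hu),
    fun a b hab => h.endpoint a b (hH hab), fun w hw u hu => h.processed w hw u (hH hu)⟩

lemma Inv.removeAnchor (h : Inv G Φ₀ Wt S s) (w : ℕ) :
    Inv G Φ₀ Wt S { s with
      sparse := s.sparse.deleteIncidenceSet w, anchors := s.anchors.erase w } := by
  have h' := h.shrink (SimpleGraph.deleteIncidenceSet_le s.sparse w)
  refine ⟨(Finset.erase_subset _ _).trans h.anchors, h'.sparse,
    fun x hx u hu => h'.witness x (Finset.mem_of_mem_erase hx) u hu, fun a b hab => ?_, h'.processed⟩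
  obtain ⟨hab, ha, hb⟩ := SimpleGraph.deleteIncidenceSet_adj.1 hab
  rcases h.endpoint a b hab with h | h | h
  · exact Or.inl (Finset.mem_erase.2 ⟨ha, h⟩)
  · exact Or.inr (Or.inl (Finset.mem_erase.2 ⟨hb, h⟩))
  · exact Or.inr (Or.inr h)

/-- `NewEdge` is symmetric, so it does not matter which end was tested or already processed. -/
lemma Inv.addEdge (hW : ∀ a b, a ∈ Φ₀ → NewEdge G a b → Wt a b) (h : Inv G Φ₀ Wt S s) {a b : ℕ}
    (hab : NewEdge G a b) : Inv G Φ₀ Wt S { s with sparse := s.sparse ⊔ SimpleGraph.edge a b } := by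
  have key : ∀ x y, (s.sparse ⊔ SimpleGraph.edge a b).Adj x y → s.sparse.Adj x y ∨ NewEdge G x y := by
    intro x y hxy
    rw [SimpleGraph.sup_adj, SimpleGraph.edge_adj] at hxy
    rcases hxy with hxy | ⟨⟨rfl, rfl⟩ | ⟨rfl, rfl⟩, _⟩
    · exact Or.inl hxy
    · exact Or.inr hab
    · exact Or.inr hab.symm
  refine ⟨h.anchors, sup_le h.sparse (edge_le_graph hab.adj), fun w hw u hu => ?_,
    fun x y hxy => ?_, fun w hw u hu => ?_⟩
  · exact (key w u hu).elim (h.witness w hw u) (hW w u (h.anchors hw))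
  · exact (key x y hxy).elim (h.endpoint x y) fun h => Or.inr (Or.inr h)
  · exact (key w u hu).elim (h.processed w hw u) NewEdge.right_le

/-! ### Clean, Anchor and Connect preserve the invariant -/

lemma mem_anchorNbhd {u w : ℕ} :
    w ∈ s.anchorNbhd G u ↔ (w ∈ G.verts ∧ s.sparse.Adj u w) ∧ w ∈ s.anchors := by
  simp [State.anchorNbhd, State.sparseNbhd]

lemma card_anchorNbhd_le (u : ℕ) : (s.anchorNbhd G u).card ≤ G.verts.card :=
  Finset.card_le_card fun _ hw => (mem_anchorNbhd.1 hw).1.1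

/-- An edge to an anchor survives only a positive agreement test, which bounds the degree of the
anchor by that of `u`. -/
lemma pr_cleanStep (hP : Sizes P) (u w : ℕ) (l : List ℕ)
    (h : Inv G Φ₀ Wt S s ∧ ∀ x ∈ s.anchors, s.sparse.Adj u x → x ∈ w :: l ∨ G.deg x ≤ 2 * G.deg u) :
    (cleanStep P G u s w).pr (fun s' => ¬ (Inv G Φ₀ Wt S s' ∧
      ∀ x ∈ s'.anchors, s'.sparse.Adj u x → x ∈ l ∨ G.deg x ≤ 2 * G.deg u)) ≤ P.δ := by
  unfold cleanStep
  rw [← add_zero P.δ]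
  refine pr_bind_le (pr_probAgreement hP w u) fun a ha => ?_
  refine (pr_eq_zero_of_sure ?_).le
  refine sure_bind_val (sure_true _) fun b _ => ?_
  refine sure_bind_val (R := fun s' => Inv G Φ₀ Wt S s' ∧
      ∀ x ∈ s'.anchors, s'.sparse.Adj u x → x ∈ l ∨ G.deg x ≤ 2 * G.deg u) ?_ ?_
  · split_ifs with hab
    · refine sure_pure ⟨h.1, fun x hx hux => ?_⟩
      rcases h.2 x hx hux with hxl | hd
      · rcases List.mem_cons.1 hxl with rfl | hxl
        · have ha' : a = true := by cases a <;> simp_all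
          have := (ha ha').bounds
          exact Or.inr (by omega)
        · exact Or.inl hxl
      · exact Or.inr hd
    · refine (sure_setSparse _ _).mono fun s' _ hs' => ?_
      obtain ⟨rfl, _⟩ := hs'
      refine ⟨h.1.shrink (SimpleGraph.deleteEdges_le _), fun x hx hux => ?_⟩
      rw [SimpleGraph.deleteEdges_adj] at hux
      rcases h.2 x hx hux.1 with hxl | hd
      · rcases List.mem_cons.1 hxl with rfl | hxl
        · exact absurd (by simp [Sym2.eq_swap]) hux.2
        · exact Or.inl hxl
      · exact Or.inr hd
  · intro s₁ h₁
    refine sure_bind_val (sure_true _) fun _ _ => ?_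
    split_ifs
    · refine sure_bind_val ((sure_setSparse _ _).mono fun _ _ h => h.1) fun s₂ h₂ => ?_
      subst h₂
      refine sure_bind_val (sure_true _) fun _ _ => sure_pure (not_not.2 ⟨h₁.1.removeAnchor w, ?_⟩)
      intro x hx hux
      exact h₁.2 x (Finset.mem_of_mem_erase hx) (SimpleGraph.deleteIncidenceSet_adj.1 hux).1
    · exact sure_pure (not_not.2 h₁)

lemma pr_clean (hP : Sizes P) (hG : G.Wf) (hn : G.verts.card ≤ P.n) (u : ℕ)
    (h : Inv G Φ₀ Wt S s) :
    (clean P G s u).pr (fun s' => ¬ (Inv G Φ₀ Wt S s' ∧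
      ∀ x ∈ s'.anchors, s'.sparse.Adj u x → G.deg x ≤ 2 * G.deg u)) ≤ P.n * P.δ := by
  rw [clean_eq]
  refine le_trans (pr_mono ?_) ((pr_foldlM_le (J := fun l s' => Inv G Φ₀ Wt S s' ∧
    ∀ x ∈ s'.anchors, s'.sparse.Adj u x → x ∈ l ∨ G.deg x ≤ 2 * G.deg u) (δ := P.δ)
    (fun w l s hs => pr_cleanStep hP u w l hs) (P.order (s.anchorNbhd G u)) s ⟨h, ?_⟩).trans ?_)
  · intro s' hs' hn
    exact hs' ⟨hn.1, fun x hx hux => (hn.2 x hx hux).resolve_left (by simp)⟩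
  · intro x hx hux
    refine Or.inl (hP.mem_order.2 (mem_anchorNbhd.2 ⟨⟨?_, hux⟩, hx⟩))
    exact hG x u (h.sparse hux).symm
  · rw [hP.length_order]
    gcongr
    exact (card_anchorNbhd_le u).trans hn

/-- After the reset every edge at `u` has a bounded other end. If `u` is an anchor, only edges to
anchors remain, and Clean has checked those. If it is not, the other end is an anchor or the edge
was added in this very iteration. -/
lemma sure_anchorReset_inv (u : ℕ) (h : Inv G Φ₀ Wt S s)
    (hu : ∀ x ∈ s.anchors, s.sparse.Adj u x → G.deg x ≤ 2 * G.deg u) :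
    (anchorReset s u).Sure fun s' _ => Inv G Φ₀ Wt (insert u S) s' := by
  have aux : ∀ H : SimpleGraph ℕ, H ≤ s.sparse → (∀ x, H.Adj u x → G.deg x ≤ 2 * G.deg u) →
      Inv G Φ₀ Wt (insert u S) { s with sparse := H } := by
    intro H hH hux
    have h' := h.shrink hH
    refine ⟨h'.anchors, h'.sparse, h'.witness, h'.endpoint, fun w hw x hx => ?_⟩
    rcases hw with rfl | hw
    · exact hux x hx
    · exact h'.processed w hw x hx
  unfold anchorReset
  split_ifs with hm
  · refine (sure_setSparse _ _).mono fun s' _ hs' => ?_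
    obtain ⟨rfl, _⟩ := hs'
    refine aux _ (SimpleGraph.deleteEdges_le _) fun x hx => ?_
    rw [SimpleGraph.deleteEdges_adj] at hx
    refine hu x ?_ hx.1
    by_contra hxa
    exact hx.2 ⟨x, hxa, rfl⟩
  · refine sure_pure (aux s.sparse le_rfl fun x hx => ?_)
    rcases h.endpoint u x hx with h | h | h
    · exact absurd h hm
    · exact hu x h hx
    · exact h.right_le

lemma pr_anchor (hP : Sizes P) (hn : G.verts.card ≤ P.n)
    (hW : ∀ a b, a ∈ Φ₀ → NewEdge G a b → Wt a b) (u : ℕ) (h : Inv G Φ₀ Wt S s)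
    (hu : ∀ x ∈ s.anchors, s.sparse.Adj u x → G.deg x ≤ 2 * G.deg u) :
    (anchor P G s u).pr (fun y => ¬ Inv G Φ₀ Wt (insert u S) y.1) ≤ P.δ + P.n * P.δ := by
  rw [anchor_eq]
  refine pr_bind_sure (sure_true _) fun d _ _ => pr_bind_sure (sure_true _) fun _ _ _ =>
    pr_bind_sure (sure_true _) fun X _ _ => ?_
  refine pr_bind_sure (sure_anchorReset_inv u h hu) fun s₁ _ h₁ => ?_
  refine pr_bind_le (pr_heavy hP u) fun b hb => ?_
  rw [← add_zero (_ * P.δ)]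
  refine pr_bind_le (R := fun s' => Inv G Φ₀ Wt (insert u S) s') ?_ fun s₂ h₂ =>
    pr_pure_le (a := (s₂, X)) (Q := fun y : State × Bool => ¬ Inv G Φ₀ Wt (insert u S) y.1)
      (not_not.2 h₂) 0
  split_ifs with hbX
  · have hb' : b = true := by cases b <;> simp_all
    have step := pr_foldlM_le (f := anchorStep P G u) (J := fun l s' => (∀ v ∈ l, v ∈ G.nbhd u) ∧
      Inv G Φ₀ Wt (insert u S) s') (δ := P.δ) ?_ (P.order (G.nbhd u)) s₁
      ⟨fun v hv => hP.mem_order.1 hv, h₁⟩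
    · refine le_trans (pr_mono ?_) (step.trans ?_)
      · exact fun s' hs' hs => hs' hs.2
      rw [hP.length_order]
      gcongr
      exact (G.deg_le_card u).trans hn
    · rintro v l s' ⟨hl, hs'⟩
      unfold anchorStep
      refine pr_bind_sure (sure_true _) fun _ _ _ => ?_
      rw [← add_zero P.δ]
      refine pr_bind_le (pr_probAgreement hP u v) fun a ha => (pr_eq_zero_of_sure ?_).le
      have hl' : ∀ v ∈ l, v ∈ G.nbhd u := fun x hx => hl x (by simp [hx])
      split_ifs with haa
      · refine (sure_setSparse _ _).mono fun s'' _ hs'' => ?_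
        obtain ⟨rfl, _⟩ := hs''
        refine not_not.2 ⟨hl', hs'.addEdge hW ?_⟩
        exact newEdge_of_tests (NodeGraph.mem_nbhd.1 (hl v (by simp))).2 (ha haa) (hb hb')
      · exact sure_pure (not_not.2 ⟨hl', hs'⟩)
  · exact pr_pure_le (Q := fun y : State => ¬ Inv G Φ₀ Wt (insert u S) y) (not_not.2 h₁) _

lemma pr_connectStep (hP : Sizes P) (hW : ∀ a b, a ∈ Φ₀ → NewEdge G a b → Wt a b) (u r : ℕ)
    (h : Inv G Φ₀ Wt S s) :
    (connectStep P G u s r).pr (fun s' => ¬ Inv G Φ₀ Wt S s') ≤ 2 * P.δ := by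
  unfold connectStep
  refine pr_bind_sure (sure_edgeQuery r u) fun e _ he => ?_
  rw [two_mul]
  refine pr_bind_le (pr_heavy hP r) fun b hb => ?_
  rw [← add_zero P.δ]
  refine pr_bind_le (pr_probAgreement hP r u) fun a ha => (pr_eq_zero_of_sure ?_).le
  split_ifs with hc
  · refine (sure_setSparse _ _).mono fun s'' _ hs'' => ?_
    obtain ⟨rfl, _⟩ := hs''
    simp only [Bool.and_eq_true] at hc
    exact not_not.2 (h.addEdge hW (newEdge_of_tests (he.1 hc.1.1) (ha hc.2) (hb hc.1.2)))
  · exact sure_pure (not_not.2 h)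

lemma pr_connectInner (hP : Sizes P) (hn : G.verts.card ≤ P.n)
    (hW : ∀ a b, a ∈ Φ₀ → NewEdge G a b → Wt a b) (u w : ℕ) (h : Inv G Φ₀ Wt S s) :
    ((P.order (s.anchorNbhd G w)).foldlM (connectStep P G u) s).pr
      (fun s' => ¬ Inv G Φ₀ Wt S s') ≤ P.n * (2 * P.δ) := by
  refine (pr_foldlM_le (J := fun _ s' => Inv G Φ₀ Wt S s') (fun r _ s hs =>
    pr_connectStep hP hW u r hs) _ s h).trans ?_
  rw [hP.length_order]
  gcongr
  exact (card_anchorNbhd_le w).trans hn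

lemma pr_connect (hP : Sizes P) (hn : G.verts.card ≤ P.n)
    (hW : ∀ a b, a ∈ Φ₀ → NewEdge G a b → Wt a b) (u : ℕ) (h : Inv G Φ₀ Wt S s) :
    (connect P G s u).pr (fun s' => ¬ Inv G Φ₀ Wt S s') ≤ P.n * (P.n * (2 * P.δ)) := by
  rw [connect_eq]
  refine pr_bind_sure (sure_sampleSet u _) fun J _ hJ => ?_
  refine (pr_foldlM_le (J := fun _ s' => Inv G Φ₀ Wt S s') (fun r _ s hs =>
    pr_connectInner hP hn hW u r hs) _ s h).trans ?_
  rw [hP.length_order]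
  gcongr
  exact (Finset.card_le_card (hJ.1.trans (G.nbhd_subset u))).trans hn

lemma pr_clean_anchor (hP : Sizes P) (hG : G.Wf) (hn : G.verts.card ≤ P.n)
    (hW : ∀ a b, a ∈ Φ₀ → NewEdge G a b → Wt a b) (u : ℕ) (h : Inv G Φ₀ Wt S s) :
    (clean P G s u >>= fun s => anchor P G s u).pr (fun y => ¬ Inv G Φ₀ Wt (insert u S) y.1) ≤
      3 * P.n * P.δ := by
  refine (pr_bind_le (pr_clean hP hG hn u h) fun s₁ h₁ => pr_anchor hP hn hW u h₁.1 h₁.2).trans ?_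
  have h1 : (1 : ℝ≥0∞) ≤ P.n := by exact_mod_cast (le_trans (by norm_num) hP.two_le : 1 ≤ P.n)
  calc (P.n : ℝ≥0∞) * P.δ + (P.δ + P.n * P.δ) ≤ P.n * P.δ + (P.n * P.δ + P.n * P.δ) := by
        gcongr
        exact le_mul_of_one_le_left zero_le h1
    _ = _ := by ring

lemma pr_processStep (hP : Sizes P) (hG : G.Wf) (hn : G.verts.card ≤ P.n)
    (hW : ∀ a b, a ∈ Φ₀ → NewEdge G a b → Wt a b) (u : ℕ) (acc : State × Finset ℕ × Finset ℕ)
    (h : Inv G Φ₀ Wt S acc.1) :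
    (processStep P G acc u).pr (fun a => ¬ Inv G Φ₀ Wt (insert u S) a.1) ≤
      5 * P.n ^ 2 * P.δ := by
  have h1 : (1 : ℝ≥0∞) ≤ P.n := by exact_mod_cast (le_trans (by norm_num) hP.two_le : 1 ≤ P.n)
  have key : (processStep P G acc u).pr (fun a => ¬ Inv G Φ₀ Wt (insert u S) a.1) =
      ((clean P G acc.1 u >>= fun s => anchor P G s u) >>= fun y => connect P G y.1 u).pr
        (fun s => ¬ Inv G Φ₀ Wt (insert u S) s) := by
    unfold processStep pr
    simp only [ev_bind, ev_pure]
  rw [key]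
  refine (pr_bind_le (pr_clean_anchor hP hG hn hW u h) fun y hy =>
    pr_connect hP hn hW u hy).trans ?_
  calc 3 * (P.n : ℝ≥0∞) * P.δ + P.n * (P.n * (2 * P.δ))
      ≤ 3 * (P.n * P.n) * P.δ + P.n * (P.n * (2 * P.δ)) := by
        gcongr
        exact le_mul_of_one_le_left zero_le h1
    _ = _ := by ring

/-- The invariant while the nodes of `l` remain to be processed. -/
def LoopInv (G : NodeGraph) (Φ₀ : Finset ℕ) (Wt : ℕ → ℕ → Prop) (𝓘 : Finset ℕ) (l : List ℕ)
    (acc : State × Finset ℕ × Finset ℕ) : Prop :=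
  Inv G Φ₀ Wt {x | x ∈ 𝓘 ∧ x ∉ l} acc.1

lemma pr_processStep_loopInv (hP : Sizes P) (hG : G.Wf) (hn : G.verts.card ≤ P.n)
    (hW : ∀ a b, a ∈ Φ₀ → NewEdge G a b → Wt a b) (𝓘 : Finset ℕ) (u : ℕ) (l : List ℕ)
    (acc : State × Finset ℕ × Finset ℕ) (h : LoopInv G Φ₀ Wt 𝓘 (u :: l) acc) :
    (processStep P G acc u).pr (fun a => ¬ LoopInv G Φ₀ Wt 𝓘 l a) ≤ 5 * P.n ^ 2 * P.δ := by
  refine le_trans (pr_mono ?_) (pr_processStep hP hG hn hW u acc h)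
  intro a ha hn
  refine ha (hn.mono_set ?_)
  rintro x ⟨hx₁, hx₂⟩
  by_cases hxu : x = u
  · exact Or.inl hxu
  · exact Or.inr ⟨hx₁, by simp [hxu, hx₂]⟩

end
end DynCC
end

noncomputable section
namespace DynCC
open DynCC.Comp

/-! ### The edges at anchors -/

/-- Every edge of the sparse solution at an anchor `w` was an edge when its other end had a degree
that is not much larger than the degree of `w` when `w` was last processed. -/
def EdgeInv (h : History) (s : State) (dl : ℕ → ℕ) : Prop :=
  ∀ w ∈ s.anchors, ∀ u, s.sparse.Adj w u → Witness h (dl w) u w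

section
variable {P : Params} {h : History} {e : Event} {s : State} {dl : ℕ → ℕ}

lemma Witness.cons {m u w : ℕ} (hw : Witness h m u w) : Witness (e :: h) m u w := by
  obtain ⟨h', hs, hw⟩ := hw
  exact ⟨h', hs.trans (List.suffix_cons e h), hw⟩

lemma witness_of_deg_le {m u w : ℕ} (hv : Valid P.n h) (ha : (graphOf h).graph.Adj w u)
    (hd : (graphOf h).deg u ≤ 16 * m + 16) : Witness h m u w :=
  ⟨h, List.suffix_rfl, hv.wf.mem_nbhd.2 ha.symm, hd⟩

/-- The present time is a witness. With `D = deg a`, density gives at least `0.7 * D` neighbors of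
degree at most `1.3 * D`. Before the update at most one of them was absent and degrees were larger
by at most one, so for `D > 8` freshness yields `deg b ≤ 2 * D ≤ 16 * dl a`. For `D ≤ 8` the summand
16 suffices. -/
lemma witness_of_newEdge (hv : Valid P.n (e :: h)) (hF : Fresh h dl) {a b : ℕ}
    (ha : a ∈ (graphOf h).verts) (ha' : a ∈ (graphOf (e :: h)).verts)
    (hab : NewEdge (graphOf (e :: h)) a b) : Witness (e :: h) (dl a) b a := by
  refine witness_of_deg_le hv hab.adj (hab.right_le.trans ?_)
  set D := (graphOf (e :: h)).deg a with hD
  by_cases h8 : D ≤ 8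
  · omega
  have hd := hab.left_dense
  unfold Dense at hd
  rw [← hD] at hd
  have hsub : ((graphOf (e :: h)).nbhd a).filter (fun x => 10 * (graphOf (e :: h)).deg x ≤ 13 * D) ⊆
      insert (arrivals h) (lowNbhd (graphOf h) a D) := by
    intro x hx
    obtain ⟨hx₁, hx₂⟩ := Finset.mem_filter.1 hx
    rcases Finset.mem_insert.1 (nbhd_cons_subset hv ha ha' hx₁) with rfl | hx₃
    · exact Finset.mem_insert_self _ _
    · refine Finset.mem_insert_of_mem (mem_lowNbhd.2 ⟨hx₃, ?_⟩)
      have := deg_le_deg_cons_add_one hv ((graphOf h).nbhd_subset a hx₃)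
        ((graphOf (e :: h)).nbhd_subset a hx₁)
      omega
  have hc := (Finset.card_le_card hsub).trans (Finset.card_insert_le _ _)
  have := hF a ha D (by omega) (by omega)
  omega

lemma StateOK.base_mem_verts (hs : StateOK P h s) {a : ℕ} (ha : a ∈ (baseState e s).anchors) :
    a ∈ (graphOf h).verts := hs.anchors (baseState_anchors_subset s ha)

lemma inv_base (hs : StateOK P h s) (hE : EdgeInv h s dl) (I : Store) :
    Inv (graphOf (e :: h)) (baseState e s).anchors (fun a b => Witness (e :: h) (dl a) b a) ∅
      { baseState e s with I := I } :=
  ⟨subset_rfl, hs.base_sparse, fun w hw u hu =>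
      (hE w (baseState_anchors_subset s hw) u (baseState_sparse_le s hu)).cons,
    fun _ _ hab => (hs.base_endpoint hab).elim Or.inl fun h => Or.inr (Or.inl h),
    fun w hw => absurd hw (Set.notMem_empty w)⟩

/-- The conditions under which an iteration is cheap. -/
structure Good (P : Params) (e : Event) (h : History) (s : State) (dl : ℕ → ℕ) : Prop where
  edges : EdgeInv h s dl
  fresh : Fresh h dl
  sparsely : Sparsely P (e :: h) (baseState e s).anchors dl

lemma loopInv_start (hP : Sizes P) (hs : StateOK P h s) (hE : EdgeInv h s dl)
    (z : Store × Finset ℕ) :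
    LoopInv (graphOf (e :: h)) (baseState e s).anchors (fun a b => Witness (e :: h) (dl a) b a) z.2
      (P.order z.2) ({ baseState e s with I := z.1 }, ∅, ∅) := by
  unfold LoopInv
  refine (inv_base hs hE z.1).mono_set ?_
  rintro x ⟨hx₁, hx₂⟩
  exact hx₂ (hP.mem_order.2 hx₁)

/-- A processed node has `dl` equal to its present degree, and `Inv.processed` makes the present
time a witness. Any other anchor was an anchor before with the same `dl`, and `Inv.witness` applies.
-/
lemma pr_not_edgeInv_le (hP : Sizes P) (hv : Valid P.n (e :: h)) (hs : StateOK P h s)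
    (hE : EdgeInv h s dl) (hF : Fresh h dl) {z : Store × Finset ℕ}
    (hz : z.2 ⊆ (graphOf (e :: h)).verts) :
    (processPhase P e h s z).pr
      (fun s' => ¬ EdgeInv (e :: h) s' (newDegs (graphOf (e :: h)) dl z.2)) ≤
        5 * P.n ^ 3 * P.δ := by
  set G := graphOf (e :: h) with hG
  have hcard : G.verts.card ≤ P.n := hv.card_le
  have hW : ∀ a b, a ∈ (baseState e s).anchors → NewEdge G a b → Witness (e :: h) (dl a) b a :=
    fun a b ha hab => witness_of_newEdge hv hF (hs.base_mem_verts ha) (hs.base_anchors ha) hab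
  unfold processPhase
  rw [processAll_eq]
  have loop := pr_foldlM_le (pr_processStep_loopInv hP hv.wf hcard hW z.2) (P.order z.2) _
    (loopInv_start hP hs hE z)
  have key : ((P.order z.2).foldlM (processStep P G) ({ baseState e s with I := z.1 }, ∅, ∅)).pr
      (fun acc => ¬ (LoopInv G (baseState e s).anchors (fun a b => Witness (e :: h) (dl a) b a) z.2
        [] acc ∧ acc.2.1 ∪ acc.2.2 = z.2)) ≤ 5 * P.n ^ 3 * P.δ := by
    refine le_trans (pr_mono_sure (sure_processLoop hP _ _) fun acc _ hacc hn hl => ?_)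
      (loop.trans ?_)
    · exact hn ⟨hl, hacc.2⟩
    · rw [hP.length_order]
      calc (z.2.card : ℝ≥0∞) * (5 * P.n ^ 2 * P.δ) ≤ P.n * (5 * P.n ^ 2 * P.δ) := by
            gcongr
            exact (Finset.card_le_card hz).trans hcard
        _ = _ := by ring
  rw [← add_zero (5 * (P.n : ℝ≥0∞) ^ 3 * P.δ)]
  refine pr_bind_le key fun acc hacc => (pr_eq_zero_of_sure ?_).le
  refine (sure_finish _ _ _).mono fun s' _ hs' => not_not.2 ?_
  obtain ⟨hI, hon⟩ := hacc
  intro w hw u hu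
  rw [hs'.2.2, SimpleGraph.deleteEdges_adj] at hu
  by_cases hwz : w ∈ z.2
  · have := hI.processed w ⟨hwz, by simp⟩ u hu.1
    refine witness_of_deg_le hv (hI.sparse hu.1) ?_
    rw [newDegs, if_pos hwz]
    exact this.trans (by omega)
  · rw [newDegs, if_neg hwz]
    refine hI.witness w ?_ u hu.1
    rw [hs'.2.1, newAnchors] at hw
    rw [← hon] at hwz
    simp only [Finset.mem_union, Finset.mem_sdiff] at hw hwz
    tauto

/-- In each update the invariant is lost only if freshness or some test fails. -/
lemma ex_not_edgeInv_le (hP : Sizes P) (hv : Valid P.n h) :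
    ex (stateLaw P h) (fun x => ind (¬ EdgeInv h x.1 x.2)) ≤ h.length * (35 * P.n ^ 4 * P.δ) := by
  induction h with
  | nil =>
    rw [stateLaw, ex_pure, ind_of_not]
    · exact zero_le
    · exact not_not.2 fun w hw => by simp [State.initial] at hw
  | cons e h ih =>
    rw [ex_stateLaw_cons]
    have h1 : (1 : ℝ≥0∞) ≤ P.n := by exact_mod_cast (le_trans (by norm_num) hP.two_le : 1 ≤ P.n)
    calc _ ≤ ex (stateLaw P h) (fun x => ind (¬ EdgeInv h x.1 x.2) + (ind (¬ Fresh h x.2) +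
          5 * P.n ^ 3 * P.δ)) := by
          refine ex_mono_support fun x hx => ?_
          have hs := stateOK_of_mem_support hP hv.tail hx
          refine ev_le_of_sure (sure_notifyPhase hP hv hs.store) fun z _ hz => ?_
          by_cases hE : EdgeInv h x.1 x.2
          · by_cases hF : Fresh h x.2
            · exact (pr_not_edgeInv_le hP hv hs hE hF hz.2.1).trans (le_add_self.trans le_add_self)
            · rw [ind_of hF]
              exact (pr_le_one _ _).trans (le_self_add.trans le_add_self)
          · rw [ind_of hE]
            exact (pr_le_one _ _).trans le_self_add
      _ ≤ h.length * (35 * P.n ^ 4 * P.δ) + (30 * P.n ^ 4 * P.δ + 5 * P.n ^ 4 * P.δ) := by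
          rw [ex_add, ex_add, ex_const]
          refine add_le_add (ih hv.tail) (add_le_add (ex_not_fresh_le hP hv.tail) ?_)
          gcongr
          norm_num
      _ = _ := by
          rw [List.length_cons]; push_cast; ring

/-- Polynomial factors do not matter. -/
lemma Sizes.mul_delta_le_one (hP : Sizes P) {a j : ℕ} (ha : a ≤ 2 ^ 20) (hj : j ≤ 80) :
    (a : ℝ≥0∞) * P.n ^ j * P.δ ≤ 1 := by
  have h2 := hP.two_le
  have h0 : (P.n : ℝ≥0∞) ^ 100 ≠ 0 := pow_ne_zero _ (by
    have : P.n ≠ 0 := by omega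
    exact_mod_cast this)
  unfold Params.δ
  rw [← div_eq_mul_inv]
  refine ENNReal.div_le_of_le_mul ?_
  rw [one_mul]
  have : a * P.n ^ j ≤ P.n ^ 100 :=
    calc a * P.n ^ j ≤ P.n ^ 20 * P.n ^ 80 := by
          gcongr
          · exact ha.trans (Nat.pow_le_pow_left h2 20)
          · omega
      _ = P.n ^ 100 := by rw [← pow_add]
  exact_mod_cast this

lemma ex_not_good_le (hP : Sizes P) (hv : Valid P.n (e :: h)) :
    ex (stateLaw P h) (fun x => ind (¬ Good P e h x.1 x.2)) ≤ 101 * P.n ^ 5 * P.δ := by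
  have h1 : (1 : ℝ≥0∞) ≤ P.n := by exact_mod_cast (le_trans (by norm_num) hP.two_le : 1 ≤ P.n)
  calc _ ≤ ex (stateLaw P h) (fun x => ind (¬ EdgeInv h x.1 x.2) + (ind (¬ Fresh h x.2) +
        ind (¬ Sparsely P (e :: h) (baseState e x.1).anchors x.2))) := by
        refine ex_mono fun x => ?_
        refine le_trans (ind_mono ?_) ((ind_or_le _ _).trans (add_le_add le_rfl (ind_or_le _ _)))
        intro hn
        by_contra hc
        push Not at hc
        exact hn ⟨hc.1, hc.2.1, hc.2.2⟩
    _ ≤ (2 * P.n : ℕ) * (35 * P.n ^ 4 * P.δ) + (30 * P.n ^ 5 * P.δ + 1 * P.n ^ 5 * P.δ) := by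
        rw [ex_add, ex_add]
        refine add_le_add ((ex_not_edgeInv_le hP hv.tail).trans ?_) (add_le_add
          ((ex_not_fresh_le hP hv.tail).trans ?_) ((ex_not_sparsely_le hP hv).trans ?_))
        · gcongr
          exact hv.tail.length_le
        · gcongr
          norm_num
        · rw [one_mul]
          gcongr
          norm_num
    _ = _ := by push_cast; ring

end
end DynCC
end

noncomputable section
namespace DynCC
open DynCC.Comp

/-! ### The expected cost of an iteration -/

section
variable {P : Params} {G : NodeGraph} {Φ₀ : Finset ℕ} {Wt : ℕ → ℕ → Prop} {S : Set ℕ} {s : State}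

lemma Sizes.K_le_testCost (hP : Sizes P) : P.K ≤ P.testCost := by
  have := hP.hundred_le_K
  unfold Params.testCost
  calc P.K = 1 * P.K ^ 1 := by ring
    _ ≤ 8 * P.K ^ 3 := by gcongr <;> omega

lemma ec_probAgreement_le (hP : Sizes P) (hG : G.verts.card ≤ P.n) (u v : ℕ) :
    ec (probAgreement P G u v) ≤ P.testCost :=
  ec_le_of_sure ((sure_probAgreement hP hG u v).mono fun _ _ h => h.1)

lemma ec_heavy_le (hP : Sizes P) (hG : G.verts.card ≤ P.n) (u : ℕ) :
    ec (heavy P G u) ≤ P.testCost :=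
  ec_le_of_sure ((sure_heavy hP hG u).mono fun _ _ h => h.1)

lemma ec_chargeOps (k : ℕ) : ec (chargeOps k) = 0 := by
  simp [chargeOps, ec_charge]

lemma ec_chargeQuery_le (hP : Sizes P) (hG : G.verts.card ≤ P.n) :
    ec (chargeQuery G) ≤ P.testCost := by
  unfold chargeQuery
  rw [ec_charge, Cost.cq_mk, zero_add]
  exact_mod_cast (hP.natLog_add_one_le hG).trans hP.K_le_testCost

lemma ec_degreeQuery_le (hP : Sizes P) (hG : G.verts.card ≤ P.n) (u : ℕ) :
    ec (degreeQuery G u) ≤ P.testCost := by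
  unfold degreeQuery
  rw [ec_bind]
  simp only [ec_pure, ev_const, add_zero]
  exact ec_chargeQuery_le hP hG

lemma ec_edgeQuery_le (hP : Sizes P) (hG : G.verts.card ≤ P.n) (u v : ℕ) :
    ec (edgeQuery G u v) ≤ P.testCost := by
  unfold edgeQuery
  rw [ec_bind]
  simp only [ec_pure, ev_const, add_zero]
  exact ec_chargeQuery_le hP hG

lemma ec_bind_le {α β : Type} {c : Comp α} {k : α → Comp β} {a b : ℝ≥0∞} (h : ec c ≤ a)
    (h' : ∀ x, ec (k x) ≤ b) : ec (c >>= k) ≤ a + b := by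
  rw [ec_bind]
  exact add_le_add h (ev_le h')

lemma ec_cleanStep_le (hP : Sizes P) (hG : G.verts.card ≤ P.n) (u w : ℕ) (s : State) :
    ec (cleanStep P G u s w) ≤ 2 * P.testCost := by
  unfold cleanStep
  rw [two_mul]
  refine ec_bind_le (ec_probAgreement_le hP hG w u) fun a => ?_
  rw [← add_zero (P.testCost : ℝ≥0∞)]
  refine ec_bind_le (ec_heavy_le hP hG w) fun b => ?_
  rw [← add_zero (0 : ℝ≥0∞)]
  refine ec_bind_le ?_ fun s => ?_
  · split_ifs
    · exact (ec_pure _).le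
    · exact (ec_setSparse _ _).le
  · rw [← add_zero (0 : ℝ≥0∞)]
    refine ec_bind_le (ec_chargeOps _).le fun _ => ?_
    split_ifs
    · rw [← add_zero (0 : ℝ≥0∞)]
      refine ec_bind_le (ec_setSparse _ _).le fun _ => ?_
      rw [← add_zero (0 : ℝ≥0∞)]
      exact ec_bind_le (ec_chargeOps _).le fun _ => (ec_pure _).le
    · exact (ec_pure _).le

lemma ec_clean_le (hP : Sizes P) (hG : G.verts.card ≤ P.n) (s : State) (u : ℕ) {M : ℕ}
    (hM : (s.anchorNbhd G u).card ≤ M) : ec (clean P G s u) ≤ M * (2 * P.testCost) := by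
  rw [clean_eq]
  refine (ec_foldlM_le (fun s w => ec_cleanStep_le hP hG u w s) _ s).trans ?_
  rw [hP.length_order]
  gcongr

lemma ec_anchorStep_le (hP : Sizes P) (hG : G.verts.card ≤ P.n) (u v : ℕ) (s : State) :
    ec (anchorStep P G u s v) ≤ 2 * P.testCost := by
  unfold anchorStep
  rw [two_mul]
  refine ec_bind_le (ec_chargeQuery_le hP hG) fun _ => ?_
  rw [← add_zero (P.testCost : ℝ≥0∞)]
  refine ec_bind_le (ec_probAgreement_le hP hG u v) fun a => ?_
  split_ifs
  · exact (ec_setSparse _ _).le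
  · exact (ec_pure _).le

/-- The expected number of neighbors of a node that becomes an anchor. -/
lemma min_anchorProb_mul_le (hP : Sizes P) (d : ℕ) :
    min (anchorProb P d : ℝ≥0∞) 1 * d ≤ P.K := by
  by_cases hd : d = 0
  · simp [hd]
  have hL := hP.one_le_logb
  have hε := hP.eps_pos
  have hd' : (0 : ℝ) < d := by exact_mod_cast Nat.pos_of_ne_zero hd
  refine (mul_le_mul_left (min_le_left _ _) _).trans ?_
  unfold anchorProb
  rw [if_neg hd]
  change ENNReal.ofReal _ * _ ≤ _
  rw [← ENNReal.ofReal_natCast d, ← ENNReal.ofReal_mul (by positivity),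
    ← ENNReal.ofReal_natCast P.K]
  refine ENNReal.ofReal_le_ofReal ?_
  have h : 10 ^ 7 * Real.logb 2 P.n / (P.ε * d) * d = 10 ^ 7 * Real.logb 2 P.n / P.ε := by
    field_simp
  rw [h]
  refine (Sizes.le_size P (10 ^ 7)).trans ?_
  exact_mod_cast hP.size_le_K (c := 10 ^ 7) (by norm_num)

lemma ec_anchorReset (s : State) (u : ℕ) : ec (anchorReset s u) = 0 := by
  unfold anchorReset
  split_ifs
  · exact ec_setSparse _ _
  · exact ec_pure _

/-- The neighborhood is listed only if the coin shows 1, so the expected number of listed neighbors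
is at most `K`, however large the degree is. -/
lemma ec_anchor_le (hP : Sizes P) (hG : G.verts.card ≤ P.n) (s : State) (u : ℕ) :
    ec (anchor P G s u) ≤ 4 * P.K * P.testCost := by
  have hK : (1 : ℝ≥0∞) ≤ P.K := by exact_mod_cast le_trans (by norm_num) hP.hundred_le_K
  rw [anchor_eq, ec_bind]
  have hd : (degreeQuery G u).Sure fun d _ => d = G.deg u :=
    (sure_degreeQuery u).mono fun _ _ h => h.1
  have key : ∀ X : Bool, ec (anchorReset s u >>= fun s => heavy P G u >>= fun b =>
      (if b && X then (P.order (G.nbhd u)).foldlM (anchorStep P G u) s else pure s) >>= fun s =>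
        pure (s, X)) ≤ P.testCost + if X then G.deg u * (2 * P.testCost : ℝ≥0∞) else 0 := by
    intro X
    rw [← zero_add (_ + _)]
    refine ec_bind_le (ec_anchorReset s u).le fun s₁ => ?_
    refine ec_bind_le (ec_heavy_le hP hG u) fun b => ?_
    refine (ec_bind_le ?_ fun _ => (ec_pure _).le).trans_eq (add_zero _)
    cases X
    · simp [ec_pure]
    · simp only [Bool.and_true, if_true]
      split_ifs
      · refine (ec_foldlM_le (fun s w => ec_anchorStep_le hP hG u w s) _ _).trans_eq ?_
        rw [hP.length_order]
        rfl
      · rw [ec_pure]; exact zero_le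
  refine (add_le_add (ec_degreeQuery_le hP hG u) (ev_le_of_sure hd fun d _ hd => ?_)).trans
    (b := P.testCost + (P.testCost + P.K * (2 * P.testCost) : ℝ≥0∞)) ?_
  · subst hd
    rw [ec_bind, ec_chargeOps, zero_add]
    refine ev_le fun _ => ?_
    rw [ec_bind, ec_sample, zero_add, ev_sample]
    refine (ex_mono key).trans ?_
    rw [ex_add, ex_const, ex_coin]
    simp only [if_true, Bool.false_eq_true, if_false, mul_zero, add_zero]
    rw [← mul_assoc]
    gcongr
    exact min_anchorProb_mul_le hP _
  · calc (P.testCost : ℝ≥0∞) + (P.testCost + P.K * (2 * P.testCost))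
        ≤ P.K * P.testCost + (P.K * P.testCost + P.K * (2 * P.testCost)) := by
          gcongr <;> exact le_mul_of_one_le_left zero_le hK
      _ = _ := by ring

lemma ec_connectStep_le (hP : Sizes P) (hG : G.verts.card ≤ P.n) (u r : ℕ) (s : State) :
    ec (connectStep P G u s r) ≤ 3 * P.testCost := by
  unfold connectStep
  rw [show (3 : ℝ≥0∞) * P.testCost = P.testCost + (P.testCost + (P.testCost + 0)) by ring]
  refine ec_bind_le (ec_edgeQuery_le hP hG r u) fun _ => ec_bind_le (ec_heavy_le hP hG r) fun _ =>
    ec_bind_le (ec_probAgreement_le hP hG r u) fun _ => ?_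
  split_ifs
  · exact (ec_setSparse _ _).le
  · exact (ec_pure _).le

lemma ec_connectInner_le (hP : Sizes P) (hG : G.verts.card ≤ P.n) (u w : ℕ) (s : State) {M : ℕ}
    (hM : (s.anchorNbhd G w).card ≤ M) :
    ec ((P.order (s.anchorNbhd G w)).foldlM (connectStep P G u) s) ≤ M * (3 * P.testCost) := by
  refine (ec_foldlM_le (fun s w => ec_connectStep_le hP hG u w s) _ s).trans ?_
  rw [hP.length_order]
  gcongr

lemma sure_sampleSet_le (hP : Sizes P) (hG : G.verts.card ≤ P.n) (u : ℕ) :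
    (sampleSet G u (P.size (10 ^ 5))).Sure fun J m =>
      (J.card ≤ P.K ∧ J.card ≤ P.n) ∧ m.cq ≤ P.K * P.testCost := by
  have hK := hP.size_le_K (c := 10 ^ 5) (by norm_num)
  refine (sure_sampleSet u _).mono fun J m h => ⟨⟨h.2.1.trans hK,
    (Finset.card_le_card (h.1.trans (G.nbhd_subset u))).trans hG⟩, ?_⟩
  rw [h.2.2.1]
  exact Nat.mul_le_mul hK ((hP.natLog_add_one_le hG).trans hP.K_le_testCost)

/-- Common part of the worst-case bound and of the bound under the invariant, which differ in how
the loop over the sample is estimated. -/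
lemma ec_connect_le_of {b : ℝ≥0∞} (hP : Sizes P) (hG : G.verts.card ≤ P.n) (s : State) (u : ℕ)
    (h : ∀ l : List ℕ, l.length ≤ P.n → ec (l.foldlM (fun s w =>
        (P.order (s.anchorNbhd G w)).foldlM (connectStep P G u) s) s) ≤ l.length * b) :
    ec (connect P G s u) ≤ P.K * (P.testCost + b) := by
  rw [connect_eq, ec_bind, mul_add]
  refine add_le_add ?_ (ev_le_of_sure (sure_sampleSet_le hP hG u) fun J m hJ => ?_)
  · have := ec_le_of_sure ((sure_sampleSet_le hP hG u).mono fun _ _ h => h.2)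
    exact_mod_cast this
  · refine (h _ ?_).trans ?_
    · rw [hP.length_order]; exact hJ.1.2
    · rw [hP.length_order]
      gcongr
      exact hJ.1.1

lemma ec_connect_le_worst (hP : Sizes P) (hG : G.verts.card ≤ P.n) (s : State) (u : ℕ) :
    ec (connect P G s u) ≤ 4 * P.K * P.n * P.testCost := by
  have h1 : (1 : ℝ≥0∞) ≤ P.n := by exact_mod_cast (le_trans (by norm_num) hP.two_le : 1 ≤ P.n)
  refine (ec_connect_le_of hP hG s u (b := P.n * (3 * P.testCost)) fun l _ => ?_).trans ?_
  · exact ec_foldlM_le (fun s w => ec_connectInner_le hP hG u w s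
      ((card_anchorNbhd_le w).trans hG)) l s
  · calc (P.K : ℝ≥0∞) * (P.testCost + P.n * (3 * P.testCost))
        ≤ P.K * (P.n * P.testCost + P.n * (3 * P.testCost)) := by
          gcongr
          exact le_mul_of_one_le_left zero_le h1
      _ = _ := by ring

/-- Under the invariant, a node has few anchors. -/
lemma Inv.card_anchorNbhd_le {M : ℕ} (h : Inv G Φ₀ Wt S s)
    (hM : ∀ u, ∀ A ⊆ Φ₀, (∀ w ∈ A, Wt w u) → A.card ≤ M) (u : ℕ) :
    (s.anchorNbhd G u).card ≤ M :=
  hM u _ (fun _ hw => h.anchors (mem_anchorNbhd.1 hw).2) fun w hw =>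
    h.witness w (mem_anchorNbhd.1 hw).2 u (mem_anchorNbhd.1 hw).1.2.symm

/-- The assumptions on the edges at anchors during an iteration. -/
structure Tame (P : Params) (G : NodeGraph) (Φ₀ : Finset ℕ) (Wt : ℕ → ℕ → Prop) : Prop where
  new : ∀ a b, a ∈ Φ₀ → NewEdge G a b → Wt a b
  few : ∀ u, ∀ A ⊆ Φ₀, (∀ w ∈ A, Wt w u) → A.card ≤ P.K ^ 2

/-- At most `K` sampled neighbors with at most `K ^ 2` anchors each. The sparse solution grows
during the loop, so the invariant has to survive every step; its failure costs at most one more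
`testCost` per step in expectation. -/
lemma ec_connect_le (hP : Sizes P) (hG : G.verts.card ≤ P.n) (hT : Tame P G Φ₀ Wt)
    (h : Inv G Φ₀ Wt S s) (u : ℕ) : ec (connect P G s u) ≤ 5 * P.K ^ 3 * P.testCost := by
  have hK : (1 : ℝ≥0∞) ≤ P.K := by exact_mod_cast le_trans (by norm_num) hP.hundred_le_K
  refine (ec_connect_le_of hP hG s u (b := (P.K ^ 2 : ℕ) * (3 * P.testCost) + P.testCost)
    fun l hl => ?_).trans ?_
  · refine (ec_foldlM_le_of_inv (J := fun _ s => Inv G Φ₀ Wt S s)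
      (fun s w => ec_connectInner_le hP hG u w s ((card_anchorNbhd_le w).trans hG))
      (fun w _ s hs => ec_connectInner_le hP hG u w s (hs.card_anchorNbhd_le hT.few w))
      (fun w _ s hs => pr_connectInner hP hG hT.new u w hs) l s h hl).trans ?_
    gcongr
    calc (P.n : ℝ≥0∞) * (P.n * (2 * P.δ)) * (P.n * (3 * P.testCost))
        = ((6 : ℕ) * P.n ^ 3 * P.δ) * P.testCost := by push_cast; ring
      _ ≤ 1 * P.testCost := by
          gcongr
          exact hP.mul_delta_le_one (by norm_num) (by norm_num)
      _ = _ := one_mul _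
  · push_cast
    calc (P.K : ℝ≥0∞) * (P.testCost + (P.K ^ 2 * (3 * P.testCost) + P.testCost))
        = 3 * (P.K : ℝ≥0∞) ^ 3 * P.testCost + 2 * (P.K : ℝ≥0∞) ^ 1 * P.testCost := by ring
      _ ≤ 3 * (P.K : ℝ≥0∞) ^ 3 * P.testCost + 2 * (P.K : ℝ≥0∞) ^ 3 * P.testCost := by
          gcongr
          norm_num
      _ = _ := by ring

lemma ec_processStep_eq (acc : State × Finset ℕ × Finset ℕ) (u : ℕ) :
    ec (processStep P G acc u) = ec (clean P G acc.1 u >>= fun s => anchor P G s u) +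
      ev (clean P G acc.1 u >>= fun s => anchor P G s u) fun y => ec (connect P G y.1 u) := by
  unfold processStep
  simp only [ec_bind, ev_bind, ec_pure, ev_const, ev_add, add_zero, add_assoc]

lemma ec_processStep_le_worst (hP : Sizes P) (hG : G.verts.card ≤ P.n)
    (acc : State × Finset ℕ × Finset ℕ) (u : ℕ) :
    ec (processStep P G acc u) ≤ 10 * P.K * P.n * P.testCost := by
  have h1 : (1 : ℝ≥0∞) ≤ P.n := by exact_mod_cast (le_trans (by norm_num) hP.two_le : 1 ≤ P.n)
  have hK : (1 : ℝ≥0∞) ≤ P.K := by exact_mod_cast le_trans (by norm_num) hP.hundred_le_K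
  have hc : ec (clean P G acc.1 u >>= fun s => anchor P G s u) ≤
      P.n * (2 * P.testCost) + 4 * P.K * P.testCost :=
    ec_bind_le (ec_clean_le hP hG acc.1 u ((card_anchorNbhd_le u).trans hG))
      fun s => ec_anchor_le hP hG s u
  have hd : ev (clean P G acc.1 u >>= fun s => anchor P G s u) (fun y => ec (connect P G y.1 u)) ≤
      4 * P.K * P.n * P.testCost := ev_le fun y => ec_connect_le_worst hP hG y.1 u
  have hle : (P.n : ℝ≥0∞) * (2 * P.testCost) ≤ P.K * (P.n * (2 * P.testCost)) :=
    le_mul_of_one_le_left zero_le hK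
  have hle' : (4 * P.K * P.testCost : ℝ≥0∞) ≤ P.n * (4 * P.K * P.testCost) :=
    le_mul_of_one_le_left zero_le h1
  rw [ec_processStep_eq]
  refine (add_le_add (hc.trans (add_le_add hle hle')) hd).trans_eq ?_
  ring

lemma ec_processStep_le (hP : Sizes P) (hGw : G.Wf) (hG : G.verts.card ≤ P.n)
    (hT : Tame P G Φ₀ Wt) (acc : State × Finset ℕ × Finset ℕ) (h : Inv G Φ₀ Wt S acc.1) (u : ℕ) :
    ec (processStep P G acc u) ≤ 12 * P.K ^ 3 * P.testCost := by
  have hK : (1 : ℝ≥0∞) ≤ P.K := by exact_mod_cast le_trans (by norm_num) hP.hundred_le_K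
  rw [ec_processStep_eq]
  have hc : ev (clean P G acc.1 u >>= fun s => anchor P G s u) (fun y => ec (connect P G y.1 u)) ≤
      5 * P.K ^ 3 * P.testCost + 4 * P.K * P.n * P.testCost * (3 * P.n * P.δ) := by
    refine (ev_mono (g := fun y => 5 * P.K ^ 3 * P.testCost + 4 * P.K * P.n * P.testCost *
      ind (¬ Inv G Φ₀ Wt (insert u S) y.1)) fun y => ?_).trans ?_
    · by_cases hy : Inv G Φ₀ Wt (insert u S) y.1
      · exact (ec_connect_le hP hG hT hy u).trans le_self_add
      · rw [ind_of hy, mul_one]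
        exact (ec_connect_le_worst hP hG y.1 u).trans le_add_self
    · rw [ev_add, ev_const, ev_const_mul]
      gcongr
      exact pr_clean_anchor hP hGw hG hT.new u h
  have hs : (4 : ℝ≥0∞) * P.K * P.n * P.testCost * (3 * P.n * P.δ) ≤ P.K * P.testCost := by
    calc (4 : ℝ≥0∞) * P.K * P.n * P.testCost * (3 * P.n * P.δ)
        = ((12 : ℕ) * P.n ^ 2 * P.δ) * (P.K * P.testCost) := by push_cast; ring
      _ ≤ 1 * (P.K * P.testCost) := by
          gcongr
          exact hP.mul_delta_le_one (by norm_num) (by norm_num)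
      _ = _ := one_mul _
  refine (add_le_add (ec_bind_le (ec_clean_le hP hG acc.1 u (h.card_anchorNbhd_le hT.few u))
    fun s => ec_anchor_le hP hG s u) (hc.trans (add_le_add le_rfl hs))).trans ?_
  push_cast
  calc (P.K ^ 2 * (2 * P.testCost) + 4 * P.K * P.testCost : ℝ≥0∞) +
        (5 * P.K ^ 3 * P.testCost + P.K * P.testCost)
      = 2 * (P.K : ℝ≥0∞) ^ 2 * P.testCost + 5 * (P.K : ℝ≥0∞) ^ 1 * P.testCost +
          5 * (P.K : ℝ≥0∞) ^ 3 * P.testCost := by ring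
    _ ≤ 2 * (P.K : ℝ≥0∞) ^ 3 * P.testCost + 5 * (P.K : ℝ≥0∞) ^ 3 * P.testCost +
          5 * (P.K : ℝ≥0∞) ^ 3 * P.testCost := by
        gcongr <;> norm_num
    _ = _ := by ring

lemma ec_finish (s : State) (on off : Finset ℕ) : ec (finish P G s on off) = 0 := by
  rw [finish_eq]
  refine le_antisymm ?_ zero_le
  rw [← add_zero (0 : ℝ≥0∞)]
  refine ec_bind_le (ec_chargeOps _).le fun _ => ?_
  rw [← add_zero (0 : ℝ≥0∞)]
  refine ec_bind_le (ec_setSparse _ _).le fun _ => ?_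
  refine (ec_foldlM_le (B := 0) (fun s u => ?_) _ _).trans_eq (mul_zero _)
  unfold recordStep
  rw [← add_zero (0 : ℝ≥0∞)]
  exact ec_bind_le (ec_chargeOps _).le fun _ => (ec_pure _).le

lemma ec_processAll (s : State) (𝓘 : Finset ℕ) : ec (processAll P G s 𝓘) =
    ec ((P.order 𝓘).foldlM (processStep P G) (s, ∅, ∅)) := by
  rw [processAll_eq, ec_bind]
  simp only [ec_finish, ev_const, add_zero]

variable {e : Event} {h : History} {dl : ℕ → ℕ}

lemma tame_of_good (hv : Valid P.n (e :: h)) (hs : StateOK P h s) (hg : Good P e h s dl) :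
    Tame P (graphOf (e :: h)) (baseState e s).anchors fun a b => Witness (e :: h) (dl a) b a := by
  refine ⟨fun a b ha hab => witness_of_newEdge hv hg.fresh (hs.base_mem_verts ha)
    (hs.base_anchors ha) hab, fun u A hA hw => ?_⟩
  classical
  refine (Finset.card_le_card ?_).trans (hg.sparsely u)
  intro w hwA
  exact Finset.mem_filter.2 ⟨hA hwA, hw w hwA⟩

/-- Starting from a bad state, the iteration is charged its polynomial worst case; the indicator is
averaged out later against `ex_not_good_le`. -/
lemma ec_processPhase_le (hP : Sizes P) (hv : Valid P.n (e :: h)) (hs : StateOK P h s)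
    (dl : ℕ → ℕ) {z : Store × Finset ℕ} (hz : z.2 ⊆ (graphOf (e :: h)).verts) :
    ec (processPhase P e h s z) ≤ z.2.card * (13 * P.K ^ 3 * P.testCost) +
      10 * P.K * P.n ^ 2 * P.testCost * ind (¬ Good P e h s dl) := by
  have hK : (1 : ℝ≥0∞) ≤ P.K := by exact_mod_cast le_trans (by norm_num) hP.hundred_le_K
  have hG := hv.card_le
  have hz' : z.2.card ≤ P.n := (Finset.card_le_card hz).trans hG
  unfold processPhase
  rw [ec_processAll]
  by_cases hg : Good P e h s dl
  · refine le_trans ?_ le_self_add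
    have hT := tame_of_good hv hs hg
    refine (ec_foldlM_le_of_inv (N := P.n) (J := LoopInv _ _ _ z.2)
      (fun acc u => ec_processStep_le_worst hP hG acc u)
      (fun u l acc hacc => ec_processStep_le hP hv.wf hG hT acc hacc u)
      (pr_processStep_loopInv hP hv.wf hG hT.new z.2) _ _ (loopInv_start hP hs hg.edges z)
      (by rwa [hP.length_order])).trans ?_
    rw [hP.length_order]
    gcongr
    calc 12 * (P.K : ℝ≥0∞) ^ 3 * P.testCost +
          P.n * (5 * P.n ^ 2 * P.δ) * (10 * P.K * P.n * P.testCost)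
        = 12 * (P.K : ℝ≥0∞) ^ 3 * P.testCost +
          ((50 : ℕ) * P.n ^ 4 * P.δ) * ((P.K : ℝ≥0∞) ^ 1 * P.testCost) := by push_cast; ring
      _ ≤ 12 * (P.K : ℝ≥0∞) ^ 3 * P.testCost + 1 * ((P.K : ℝ≥0∞) ^ 3 * P.testCost) := by
          gcongr
          · exact hP.mul_delta_le_one (by norm_num) (by norm_num)
          · norm_num
      _ = _ := by ring
  · rw [ind_of hg, mul_one]
    refine le_trans ?_ le_add_self
    refine (ec_foldlM_le (fun acc u => ec_processStep_le_worst hP hG acc u) _ _).trans ?_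
    rw [hP.length_order]
    calc (z.2.card : ℝ≥0∞) * (10 * P.K * P.n * P.testCost)
        ≤ P.n * (10 * P.K * P.n * P.testCost) := by gcongr
      _ = _ := by ring

/-- The expected cost of an iteration in terms of the number of the first notifications. -/
lemma ec_stepC_le (hP : Sizes P) (hv : Valid P.n (e :: h)) (hs : StateOK P h s) (dl : ℕ → ℕ) :
    ec (stepC P e h s) ≤ 36 * P.K ^ 4 * P.testCost * (load P e h s.I + 1) +
      10 * P.K * P.n ^ 2 * P.testCost * ind (¬ Good P e h s dl) := by
  have hc : (1 : ℝ≥0∞) ≤ P.testCost := by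
    exact_mod_cast (le_trans (by norm_num) hP.hundred_le_K).trans hP.K_le_testCost
  have hn := sure_notifyPhase hP hv hs.store
  rw [ec_stepC]
  refine (add_le_add (ec_le_of_sure (hn.mono fun _ _ h => h.2.2.2.1))
    (ev_le_of_sure hn fun z _ hz => (ec_processPhase_le hP hv hs dl hz.2.1).trans
      (add_le_add (mul_le_mul_left (Nat.cast_le.2 hz.2.2.1) _) le_rfl))).trans ?_
  rw [← add_assoc]
  refine add_le_add ?_ le_rfl
  push_cast
  calc 10 * (P.K : ℝ≥0∞) ^ 4 * (load P e h s.I + 1) +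
        2 * P.K * (load P e h s.I + 1) * (13 * P.K ^ 3 * P.testCost)
      ≤ P.testCost * (10 * P.K ^ 4 * (load P e h s.I + 1)) +
        2 * P.K * (load P e h s.I + 1) * (13 * P.K ^ 3 * P.testCost) := by
        exact add_le_add (le_mul_of_one_le_left zero_le hc) le_rfl
    _ = _ := by ring

lemma ex_ec_stepC_le (hP : Sizes P) (hv : Valid P.n (e :: h)) :
    ex (stateLaw P h) (fun x => ec (stepC P e h x.1)) ≤
      37 * P.K ^ 4 * P.testCost * (ex (stateLaw P h) (fun x => load P e h x.1.I) + 1) := by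
  have hK : (1 : ℝ≥0∞) ≤ P.K := by exact_mod_cast le_trans (by norm_num) hP.hundred_le_K
  refine (ex_mono_support fun x hx => ec_stepC_le hP hv (stateOK_of_mem_support hP hv.tail hx)
    x.2).trans ?_
  rw [ex_add, ex_const_mul, ex_const_mul, ex_add, ex_const]
  refine (add_le_add le_rfl (mul_le_mul_right (ex_not_good_le hP hv) _)).trans ?_
  calc 36 * (P.K : ℝ≥0∞) ^ 4 * P.testCost * (ex (stateLaw P h) (fun x => load P e h x.1.I) + 1) +
        10 * P.K * P.n ^ 2 * P.testCost * (101 * P.n ^ 5 * P.δ)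
      = 36 * P.K ^ 4 * P.testCost * (ex (stateLaw P h) (fun x => load P e h x.1.I) + 1) +
        ((1010 : ℕ) * P.n ^ 7 * P.δ) * (P.K ^ 1 * P.testCost * 1) := by push_cast; ring
    _ ≤ 36 * P.K ^ 4 * P.testCost * (ex (stateLaw P h) (fun x => load P e h x.1.I) + 1) +
        1 * (P.K ^ 4 * P.testCost * (ex (stateLaw P h) (fun x => load P e h x.1.I) + 1)) := by
        gcongr
        · exact hP.mul_delta_le_one (by norm_num) (by norm_num)
        · norm_num
        · exact le_add_self
    _ = _ := by ring

end
end DynCC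
end

noncomputable section
namespace DynCC
open DynCC.Comp

/-! ### Amortized operations -/

namespace Comp
variable {α β : Type} {c : Comp α} {γ V₀ : ℝ≥0∞}

lemma Amortized.add_const {V : α → ℝ≥0∞} (h : c.Amortized V₀ V γ) (r : ℝ≥0∞) :
    c.Amortized (V₀ + r) (fun a => V a + r) γ := by
  unfold Amortized at *
  simp only [← add_assoc]
  rw [wp_add, wp_const]
  calc _ ≤ V₀ + γ * c.ec + r := by gcongr
    _ = _ := by ring

lemma amortized_chargeOps (k : ℕ) (V γ : ℝ≥0∞) :
    (chargeOps k).Amortized (V + k) (fun _ => V) γ := by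
  unfold Amortized chargeOps
  rw [wp_charge]
  refine le_trans ?_ le_self_add
  rw [add_comm]

lemma amortized_sample {p : PMF α} {V : α → ℝ≥0∞} (h : ex p V ≤ V₀) :
    (sample p).Amortized V₀ V γ := by
  unfold Amortized
  rw [wp_sample]
  simpa using h.trans le_self_add

/-- A computation without operations whose cost is at least one pays for later operations. -/
lemma amortized_pays (h : c.Sure fun _ k => k.ops = 0 ∧ 1 ≤ k.cq) {r : ℝ≥0∞} (hr : r ≤ γ) :
    c.Amortized V₀ (fun _ => V₀ + r) γ := by
  unfold Amortized
  refine (wp_mono_sure h (g := fun _ k => V₀ + γ * (k.cq : ℝ≥0∞)) fun a k hk => ?_).trans ?_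
  · rw [hk.1, Nat.cast_zero, zero_add]
    refine add_le_add le_rfl (hr.trans (le_mul_of_one_le_right zero_le ?_))
    exact_mod_cast hk.2
  · rw [wp_add, wp_const, wp_const_mul]
    rfl

lemma amortized_of_ops_le {b : ℕ} (h : c.Sure fun _ k => k.ops ≤ b * k.cq)
    (hb : (b : ℝ≥0∞) ≤ γ) : c.Amortized V₀ (fun _ => V₀) γ := by
  unfold Amortized
  refine (wp_mono_sure h (g := fun _ k => V₀ + γ * (k.cq : ℝ≥0∞)) fun a k hk => ?_).trans ?_
  · rw [add_comm]
    gcongr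
    calc (k.ops : ℝ≥0∞) ≤ (b * k.cq : ℕ) := Nat.cast_le.2 hk
      _ = b * k.cq := by push_cast; rfl
      _ ≤ _ := by gcongr
  · rw [wp_add, wp_const, wp_const_mul]
    rfl

end Comp

/-- The potential: the number of edges of the sparse solution. -/
def pot (s : State) : ℝ≥0∞ := (s.sparse.edgeSet.encard : ℝ≥0∞)

section
variable {P : Params} {G : NodeGraph} {γ : ℝ≥0∞}

/-- `ncard` is 0 on infinite sets, so charging `ncard` against an `encard` potential needs no
finiteness of the sparse solution. -/
lemma ncard_le_encard {α : Type*} (A : Set α) : ((A.ncard : ℕ) : ℝ≥0∞) ≤ (A.encard : ℝ≥0∞) := by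
  have : ((A.ncard : ℕ) : ℕ∞) ≤ A.encard := A.ncard_le_encard
  calc ((A.ncard : ℕ) : ℝ≥0∞) = (((A.ncard : ℕ) : ℕ∞) : ℝ≥0∞) := by simp
    _ ≤ _ := ENat.toENNReal_le.2 this

lemma amortized_setSparse_le (s : State) {H : SimpleGraph ℕ} (hH : H ≤ s.sparse) :
    (setSparse s H).Amortized (pot s) pot γ := by
  have hE : H.edgeSet ⊆ s.sparse.edgeSet := SimpleGraph.edgeSet_subset_edgeSet.2 hH
  refine Amortized.bind (V₁ := fun _ => pot { s with sparse := H })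
    ((amortized_chargeOps _ (pot { s with sparse := H }) γ).mono ?_ (fun _ => le_rfl) le_rfl)
    fun _ => amortized_pure le_rfl
  unfold pot
  have hsd : symmDiff s.sparse.edgeSet H.edgeSet = s.sparse.edgeSet \ H.edgeSet := by
    rw [Set.symmDiff_def, Set.sdiff_eq_empty.2 hE, Set.union_empty]
  rw [hsd, ← Set.encard_sdiff_add_encard_of_subset hE, ENat.toENNReal_add, add_comm]
  gcongr
  exact ncard_le_encard _

/-- One unit for the insertion and one for the increase of the potential. -/
lemma amortized_setSparse_edge (s : State) (a b : ℕ) :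
    (setSparse s (s.sparse ⊔ SimpleGraph.edge a b)).Amortized (pot s + 2) pot γ := by
  have hE : (s.sparse ⊔ SimpleGraph.edge a b).edgeSet ⊆ s.sparse.edgeSet ∪ {s(a, b)} := by
    intro x hx
    induction x with | _ x y =>
    rw [SimpleGraph.mem_edgeSet, SimpleGraph.sup_adj, SimpleGraph.edge_adj] at hx
    rcases hx with hx | ⟨hx, _⟩
    · exact Or.inl hx
    · refine Or.inr ?_
      rw [Set.mem_singleton_iff, Sym2.eq_iff]
      tauto
  have hE' : s.sparse.edgeSet ⊆ (s.sparse ⊔ SimpleGraph.edge a b).edgeSet :=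
    SimpleGraph.edgeSet_subset_edgeSet.2 le_sup_left
  refine Amortized.bind (V₁ := fun _ => pot { s with sparse := s.sparse ⊔ SimpleGraph.edge a b })
    ((amortized_chargeOps _ _ γ).mono ?_ (fun _ => le_rfl) le_rfl) fun _ => amortized_pure le_rfl
  have h₁ : pot { s with sparse := s.sparse ⊔ SimpleGraph.edge a b } ≤ pot s + 1 := by
    unfold pot
    rw [← ENat.toENNReal_one, ← ENat.toENNReal_add, ENat.toENNReal_le]
    refine (Set.encard_le_encard hE).trans ((Set.encard_union_le _ _).trans ?_)
    rw [Set.encard_singleton]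
  have h₂ : (symmDiff s.sparse.edgeSet (s.sparse ⊔ SimpleGraph.edge a b).edgeSet).ncard ≤ 1 := by
    rw [← Set.ncard_singleton s(a, b)]
    refine Set.ncard_le_ncard ?_ (Set.finite_singleton _)
    rw [Set.symmDiff_def, Set.sdiff_eq_empty.2 hE', Set.empty_union]
    exact fun x hx => (hE hx.1).resolve_left hx.2
  calc _ ≤ pot s + 1 + 1 := add_le_add h₁ (by exact_mod_cast h₂)
    _ = _ := by rw [add_assoc, one_add_one_eq_two]

lemma amortized_agreement (hP : Sizes P) (hG : G.verts.card ≤ P.n) {r : ℝ≥0∞} (hr : r ≤ γ)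
    (V₀ : ℝ≥0∞) (u v : ℕ) : (probAgreement P G u v).Amortized V₀ (fun _ => V₀ + r) γ :=
  amortized_pays ((sure_probAgreement hP hG u v).mono fun _ _ h => h.2) hr

lemma amortized_heavy (hP : Sizes P) (hG : G.verts.card ≤ P.n) (V₀ : ℝ≥0∞) (u : ℕ) :
    (heavy P G u).Amortized V₀ (fun _ => V₀) γ :=
  amortized_of_ops_eq_zero ((sure_heavy hP hG u).mono fun _ _ h => h.2.1)

lemma amortized_cleanStep (hP : Sizes P) (hG : G.verts.card ≤ P.n) (hγ : 2 ≤ γ) (u w : ℕ)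
    (s : State) : (cleanStep P G u s w).Amortized (pot s) pot γ := by
  unfold cleanStep
  refine (amortized_agreement hP hG hγ (pot s) w u).bind fun a =>
    (amortized_heavy hP hG (pot s + 2) w).bind fun b => ?_
  refine Amortized.bind (V₁ := fun s' => pot s' + 2) ?_ fun s₁ => ?_
  · split_ifs
    · exact amortized_pure le_rfl
    · exact (amortized_setSparse_le s (SimpleGraph.deleteEdges_le _)).add_const 2
  · refine Amortized.bind (V₁ := fun _ => pot s₁ + 1)
      ((amortized_chargeOps 1 (pot s₁ + 1) γ).mono ?_ (fun _ => le_rfl) le_rfl) fun _ => ?_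
    · rw [Nat.cast_one, add_assoc, one_add_one_eq_two]
    · split_ifs
      · refine ((amortized_setSparse_le s₁
          (SimpleGraph.deleteIncidenceSet_le _ _)).add_const 1).bind fun s₂ => ?_
        refine Amortized.bind (V₁ := fun _ => pot s₂)
          ((amortized_chargeOps 1 (pot s₂) γ).mono (by simp) (fun _ => le_rfl) le_rfl) fun _ => ?_
        exact amortized_pure le_rfl
      · exact amortized_pure le_self_add

lemma amortized_clean (hP : Sizes P) (hG : G.verts.card ≤ P.n) (hγ : 2 ≤ γ) (u : ℕ) (s : State) :
    (clean P G s u).Amortized (pot s) pot γ := by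
  rw [clean_eq]
  exact amortized_foldlM (fun s w _ => amortized_cleanStep hP hG hγ u w s) s

lemma sure_chargeQuery_pays : (chargeQuery G).Sure fun _ k => k.ops = 0 ∧ 1 ≤ k.cq :=
  sure_charge ⟨rfl, by simp⟩

lemma amortized_anchorStep (hP : Sizes P) (hG : G.verts.card ≤ P.n) (hγ : 2 ≤ γ) (u v : ℕ)
    (s : State) : (anchorStep P G u s v).Amortized (pot s) pot γ := by
  unfold anchorStep
  refine (amortized_of_ops_eq_zero (sure_chargeQuery_pays.mono fun _ _ h => h.1)).bind fun _ =>
    (amortized_agreement hP hG hγ (pot s) u v).bind fun a => ?_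
  split_ifs
  · exact amortized_setSparse_edge s u v
  · exact amortized_pure le_self_add

/-- The operations at the end of the iteration that are caused by a node of degree `d`. -/
def dues (d : ℕ) (X : Bool) : ℝ≥0∞ := if X then d + 2 else 1

lemma ex_dues_le (hP : Sizes P) (d : ℕ) : ex (coin (anchorProb P d)) (dues d) ≤ P.K + 3 := by
  rw [ex_coin]
  simp only [dues, if_true, Bool.false_eq_true, if_false, mul_add]
  calc _ ≤ (P.K : ℝ≥0∞) + 1 * 2 + 1 * 1 := by
        gcongr
        · exact min_anchorProb_mul_le hP d
        · exact min_le_right _ _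
        · exact tsub_le_self
    _ = _ := by rw [add_assoc]; norm_num

/-- The degree query prepays `K + 4`: one operation for the coin and the expected dues `K + 3`. The
dues are one for sorting `u` into `on` or `off` and, for a new anchor, at most `deg u + 1` for
recording its sparse neighborhood. -/
lemma amortized_anchor (hP : Sizes P) (hG : G.verts.card ≤ P.n) (hγ : P.K + 4 ≤ γ) (u : ℕ)
    (s : State) :
    (anchor P G s u).Amortized (pot s) (fun y => pot y.1 + dues (G.deg u) y.2) γ := by
  have hγ2 : 2 ≤ γ := le_trans (by
    calc (2 : ℝ≥0∞) ≤ 4 := by norm_num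
      _ ≤ _ := le_add_self) hγ
  have hd : (degreeQuery G u).Sure fun d k => d = G.deg u ∧ k.ops = 0 ∧ 1 ≤ k.cq := by
    unfold degreeQuery
    exact sure_bind (sure_charge (sure_pure (by simp)))
  rw [anchor_eq]
  refine (amortized_pays (r := P.K + 4) (hd.mono fun _ _ h => h.2) hγ).bind_sure hd fun d _ hd => ?_
  obtain ⟨rfl, _⟩ := hd
  refine Amortized.bind (V₁ := fun _ => pot s + (P.K + 3))
    ((amortized_chargeOps 1 _ γ).mono ?_ (fun _ => le_rfl) le_rfl) fun _ => ?_
  · rw [Nat.cast_one, add_assoc, add_assoc]; norm_num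
  refine Amortized.bind (V₁ := fun X => pot s + dues (G.deg u) X) (amortized_sample ?_) fun X => ?_
  · rw [ex_add, ex_const]
    gcongr
    exact ex_dues_le hP _
  refine Amortized.bind (V₁ := fun s' => pot s' + dues (G.deg u) X) ?_ fun s₁ => ?_
  · unfold anchorReset
    split_ifs
    · exact (amortized_setSparse_le s (SimpleGraph.deleteEdges_le _)).add_const _
    · exact amortized_pure le_rfl
  refine (amortized_heavy hP hG _ u).bind fun b => ?_
  refine Amortized.bind (V₁ := fun s' => pot s' + dues (G.deg u) X) ?_ fun s₂ =>
    amortized_pure le_rfl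
  split_ifs
  · exact (amortized_foldlM (fun s v _ => amortized_anchorStep hP hG hγ2 u v s) s₁).add_const _
  · exact amortized_pure le_rfl

lemma amortized_connectStep (hP : Sizes P) (hG : G.verts.card ≤ P.n) (hγ : 2 ≤ γ) (u r : ℕ)
    (s : State) : (connectStep P G u s r).Amortized (pot s) pot γ := by
  unfold connectStep
  have he : (edgeQuery G r u).Sure fun _ k => k.ops = 0 := by
    unfold edgeQuery
    exact sure_bind (sure_charge (sure_pure rfl))
  refine (amortized_of_ops_eq_zero he).bind fun _ => (amortized_heavy hP hG _ r).bind fun _ =>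
    (amortized_agreement hP hG hγ (pot s) r u).bind fun a => ?_
  split_ifs
  · exact amortized_setSparse_edge s r u
  · exact amortized_pure le_self_add

lemma amortized_connect (hP : Sizes P) (hG : G.verts.card ≤ P.n) (hγ : 2 ≤ γ) (u : ℕ)
    (s : State) : (connect P G s u).Amortized (pot s) pot γ := by
  rw [connect_eq]
  refine (amortized_of_ops_eq_zero ((sure_sampleSet u _).mono fun _ _ h => h.2.2.2)).bind fun J => ?_
  exact amortized_foldlM (fun s w _ =>
    amortized_foldlM (fun s r _ => amortized_connectStep hP hG hγ u r s) s) s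

/-- The operations at the end of the iteration. -/
def totalDues (G : NodeGraph) (x : Finset ℕ × Finset ℕ) : ℝ≥0∞ :=
  ((∑ u ∈ x.1, (G.deg u + 2) + x.2.card : ℕ) : ℝ≥0∞)

lemma totalDues_insert (u : ℕ) (x : Finset ℕ × Finset ℕ) (X : Bool) :
    totalDues G (if X then (insert u x.1, x.2) else (x.1, insert u x.2)) ≤
      totalDues G x + dues (G.deg u) X := by
  have hle : ∀ {a b c : ℕ}, a ≤ b + c → (a : ℝ≥0∞) ≤ b + c := fun h => by exact_mod_cast h
  unfold totalDues dues
  cases X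
  · simp only [Bool.false_eq_true, if_false]
    have := Finset.card_insert_le u x.2
    rw [← Nat.cast_one]
    exact hle (by omega)
  · simp only [if_true]
    have : ∑ v ∈ insert u x.1, (G.deg v + 2) ≤ (G.deg u + 2) + ∑ v ∈ x.1, (G.deg v + 2) := by
      by_cases hu : u ∈ x.1
      · rw [Finset.insert_eq_of_mem hu]; omega
      · rw [Finset.sum_insert hu]
    rw [show ((G.deg u : ℝ≥0∞) + 2) = ((G.deg u + 2 : ℕ) : ℝ≥0∞) by push_cast; rfl]
    exact hle (by omega)

lemma amortized_processStep (hP : Sizes P) (hG : G.verts.card ≤ P.n) (hγ : P.K + 4 ≤ γ) (u : ℕ)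
    (acc : State × Finset ℕ × Finset ℕ) : (processStep P G acc u).Amortized
      (pot acc.1 + totalDues G acc.2) (fun a => pot a.1 + totalDues G a.2) γ := by
  have hγ2 : 2 ≤ γ := le_trans (by
    calc (2 : ℝ≥0∞) ≤ 4 := by norm_num
      _ ≤ _ := le_add_self) hγ
  unfold processStep
  refine ((amortized_clean hP hG hγ2 u acc.1).add_const _).bind fun s₁ => ?_
  refine ((amortized_anchor hP hG hγ u s₁).add_const _).bind fun y => ?_
  refine Amortized.bind (V₁ := fun s => pot s + (dues (G.deg u) y.2 + totalDues G acc.2))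
    (((amortized_connect hP hG hγ2 u y.1).add_const _).mono (add_assoc _ _ _).ge
      (fun _ => le_rfl) le_rfl) fun s₂ => amortized_pure ?_
  gcongr
  rw [add_comm]
  exact totalDues_insert u acc.2 y.2

lemma amortized_finish (hP : Sizes P) (s : State) (hs : s.sparse ≤ G.graph)
    (on off : Finset ℕ) :
    (finish P G s on off).Amortized (pot s + totalDues G (on, off)) pot γ := by
  rw [finish_eq]
  set r : ℝ≥0∞ := ((∑ u ∈ on, (G.deg u + 1) : ℕ) : ℝ≥0∞) with hr
  refine Amortized.bind (V₁ := fun _ => pot s + r)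
    ((amortized_chargeOps _ (pot s + r) γ).mono ?_ (fun _ => le_rfl) le_rfl) fun _ => ?_
  · rw [add_assoc]
    gcongr
    rw [hr, totalDues, ← Nat.cast_add]
    refine Nat.cast_le.2 ?_
    have : ∑ u ∈ on, (G.deg u + 2) = ∑ u ∈ on, (G.deg u + 1) + on.card := by
      rw [Finset.card_eq_sum_ones, ← Finset.sum_add_distrib]
    simp only [this]
    omega
  refine ((amortized_setSparse_le s (SimpleGraph.deleteEdges_le _)).add_const r).bind_sure
    (sure_setSparse _ _) fun s₁ _ hs₁ => ?_
  obtain ⟨rfl, _⟩ := hs₁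
  have key : ∀ (l : List ℕ) (s : State), s.sparse ≤ G.graph →
      (l.foldlM (recordStep G) s).Amortized
        (pot s + (((l.map fun u => G.deg u + 1).sum : ℕ) : ℝ≥0∞)) pot γ := by
    intro l
    induction l with
    | nil => intro s _; exact amortized_pure (by simp)
    | cons u l ih =>
      intro s hs
      rw [List.foldlM_cons]
      have hcard : (s.sparseNbhd G u).card ≤ G.deg u := by
        refine Finset.card_le_card fun v hv => ?_
        simp only [State.sparseNbhd, Finset.mem_filter] at hv
        exact NodeGraph.mem_nbhd.2 ⟨hv.1, hs hv.2⟩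
      have hrec : (recordStep G s u).Sure fun s' _ => s'.sparse = s.sparse := by
        unfold recordStep
        exact sure_bind_val (sure_true _) fun _ _ => sure_pure rfl
      refine Amortized.bind_sure (V₁ := fun s' =>
        pot s' + (((l.map fun u => G.deg u + 1).sum : ℕ) : ℝ≥0∞)) ?_ hrec fun s' _ hs' =>
          ih s' (hs'.le.trans hs)
      unfold recordStep
      refine Amortized.bind (V₁ := fun _ => pot s +
        (((l.map fun u => G.deg u + 1).sum : ℕ) : ℝ≥0∞)) ((amortized_chargeOps _ _ γ).mono ?_
          (fun _ => le_rfl) le_rfl) fun _ => amortized_pure le_rfl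
      rw [add_assoc, ← Nat.cast_add]
      gcongr
      rw [List.map_cons, List.sum_cons]
      omega
  have hsum : ((P.order on).map fun u => G.deg u + 1).sum = ∑ u ∈ on, (G.deg u + 1) := by
    rw [← List.sum_toFinset _ (hP.nodup_order on), (hP.order on).2]
  have := key (P.order on) { s with
    sparse := s.sparse.deleteEdges {e | ∀ v ∈ e, v ∉ newAnchors s on off},
    anchors := newAnchors s on off } ((SimpleGraph.deleteEdges_le _).trans hs)
  rw [hsum, ← hr] at this
  exact this

lemma amortized_processAll (hP : Sizes P) (hG : G.verts.card ≤ P.n) (hγ : P.K + 4 ≤ γ)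
    (s : State) (hs : s.sparse ≤ G.graph) (𝓘 : Finset ℕ) :
    (processAll P G s 𝓘).Amortized (pot s) pot γ := by
  rw [processAll_eq]
  have hloop := amortized_foldlM (V := fun a : State × Finset ℕ × Finset ℕ =>
    pot a.1 + totalDues G a.2) (l := P.order 𝓘)
    (fun acc u _ => amortized_processStep hP hG hγ u acc) (s, ∅, ∅)
  refine (hloop.mono ?_ (fun _ => le_rfl) le_rfl).bind_sure (sure_processLoop hP s 𝓘)
    fun acc _ hacc => amortized_finish hP acc.1 (hacc.1.2.2 hs) _ _
  simp [totalDues]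

variable {e : Event} {h : History} {s : State}

lemma sum_deletion_le (hP : Sizes P) {I : Store} (hI : StoreOK P I) (v : ℕ) :
    1 + ∑ i ∈ Finset.range P.levels, ((I v i).card + (backSet G I v i).card) ≤
      1 + P.K * (P.K + (receivers P G I v).card) := by
  gcongr
  calc _ ≤ ∑ i ∈ Finset.range P.levels, (P.K + (receivers P G I v).card) := by
        refine Finset.sum_le_sum fun i hi => add_le_add (hI v i) (Finset.card_le_card ?_)
        exact Finset.subset_biUnion_of_mem (backSet G I v) hi
    _ ≤ _ := by
        rw [Finset.sum_const, Finset.card_range, smul_eq_mul]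
        exact Nat.mul_le_mul_right _ hP.levels_le

/-- The amortized number of operations of an iteration. -/
lemma amortized_stepC (hP : Sizes P) (hv : Valid P.n (e :: h)) (hs : StateOK P h s) :
    (stepC P e h s).Amortized (pot s + (1 + P.K * (P.K + load P e h s.I) : ℕ)) pot (2 * P.K) := by
  have hK := hP.hundred_le_K
  have hγ : (P.K + 4 : ℝ≥0∞) ≤ 2 * P.K := by
    exact_mod_cast (by omega : P.K + 4 ≤ 2 * P.K)
  have hγ3 : ((3 : ℕ) : ℝ≥0∞) ≤ 2 * P.K := by
    exact_mod_cast (by omega : 3 ≤ 2 * P.K)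
  have hG : (graphOf (e :: h)).verts.card ≤ P.n := hv.card_le
  cases e with
  | arrival S =>
    refine Amortized.mono (V₀ := pot s) ?_ le_self_add (fun _ => le_rfl) le_rfl
    unfold stepC onArrival
    have h₁ := sure_refresh (P := P) (G := graphOf (.arrival S :: h)) s.I hs.store (arrivals h)
    refine (amortized_of_ops_le (b := 3) (h₁.mono fun _ k hk => ?_) hγ3).bind_sure h₁
      fun x _ hx => ?_
    · rw [hk.2.2.2.1]
      refine hk.2.2.2.2.trans ?_
      calc 3 * P.K + 1 ≤ 3 * ((P.K + 1) * 1) := by omega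
        _ ≤ _ := by gcongr; omega
    · have h₂ := sure_notifyLoop hP hG x.1 hx.1 x.2 (hx.2.1.trans (NodeGraph.nbhd_subset _ _))
      exact (amortized_of_ops_le (b := 3) (h₂.mono fun _ k hk => hk.2.2.2.2) hγ3).bind fun y =>
        amortized_processAll hP hG hγ { s with I := y.1 } (hs.base_sparse (e := .arrival S)) _
  | deletion v =>
    unfold stepC onDeletion
    refine Amortized.bind (V₁ := fun _ => pot s) ((amortized_chargeOps _ (pot s) _).mono ?_
      (fun _ => le_rfl) le_rfl) fun _ => ?_
    · exact add_le_add le_rfl (Nat.cast_le.2 (sum_deletion_le hP hs.store v))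
    · refine (amortized_setSparse_le s (SimpleGraph.deleteIncidenceSet_le _ v)).bind_sure
        (sure_setSparse _ _) fun s₁ _ hs₁ => ?_
      obtain ⟨rfl, _⟩ := hs₁
      have hI : StoreOK P (Function.update s.I v fun _ => ∅) := by
        intro w l
        by_cases hw : w = v
        · subst hw; simp
        · rw [Function.update_of_ne hw]; exact hs.store w l
      have h₂ := sure_notifyLoop hP hG _ hI
        (receivers P (graphOf (.deletion v :: h)) s.I v) (receivers_subset _ _)
      exact (amortized_of_ops_le (b := 3) (h₂.mono fun _ k hk => hk.2.2.2.2) hγ3).bind fun y =>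
        amortized_processAll hP hG hγ (G := graphOf (.deletion v :: h)) { s with
          I := y.1, anchors := s.anchors.erase v, sparse := s.sparse.deleteIncidenceSet v }
          (hs.base_sparse (e := .deletion v)) _

end
end DynCC
end

noncomputable section
namespace DynCC
open DynCC.Comp

/-! ### The stream -/

/-- The law of the next event (`none` if a deletion is requested and no node is present). -/
def eventLaw (adv : Adversary) (h : History) : PMF (Option Event) :=
  match adv h with
  | .insert S => PMF.pure (some (.arrival S))
  | .delete =>
    if hne : (graphOf h).verts.Nonempty then
      PMF.map (fun v => some (.deletion v)) (PMF.uniformOfFinset (graphOf h).verts hne)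
    else PMF.pure none

section
variable {P : Params} {adv : Adversary} {n T t : ℕ} {h : History} {e : Event}

lemma ex_record (ω : Run) (e : Event) (c : Comp State) (g : Run → ℝ≥0∞) :
    ex (ω.record e c) g = c.wp fun s m =>
      g ⟨e :: ω.history, s, Function.update ω.cost ω.history.length m⟩ := ex_map _ _ _

lemma ex_next (ω : Run) (g : Run → ℝ≥0∞) :
    ex (ω.next P adv) g = ex (eventLaw adv ω.history) fun o => o.elim (g ω) fun e =>
      (stepC P e ω.history ω.state).wp fun s m =>
        g ⟨e :: ω.history, s, Function.update ω.cost ω.history.length m⟩ := by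
  unfold Run.next eventLaw
  cases adv ω.history with
  | insert S =>
    simp only [ex_pure, ex_record]
    rfl
  | delete =>
    dsimp only
    split_ifs with hne
    · rw [ex_bind, ex_map]
      simp only [ex_record]
      rfl
    · simp only [ex_pure, Option.elim_none]

lemma ex_execution_succ (g : Run → ℝ≥0∞) :
    ex (execution P adv (t + 1)) g = ex (execution P adv t) fun ω =>
      ex (eventLaw adv ω.history) fun o => o.elim (g ω) fun e =>
        (stepC P e ω.history ω.state).wp fun s m =>
          g ⟨e :: ω.history, s, Function.update ω.cost ω.history.length m⟩ := by
  rw [execution, ex_bind]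
  simp only [ex_next]

lemma ex_stateLaw_cons_fst (e : Event) (h : History) (f : State → ℝ≥0∞) :
    ex (stateLaw P (e :: h)) (fun x => f x.1) =
      ex (stateLaw P h) fun x => ev (stepC P e h x.1) f := by
  rw [ex_stateLaw_cons]
  simp only [ev_stepC]

/-- Given the stream, the state has the law `stateLaw`. -/
lemma ex_execution (t : ℕ) (F : History → State → ℝ≥0∞) :
    ex (execution P adv t) (fun ω => F ω.history ω.state) =
      ex (execution P adv t) fun ω => ex (stateLaw P ω.history) fun x => F ω.history x.1 := by
  induction t generalizing F with
  | zero => simp [execution, ex_pure, Run.initial, stateLaw]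
  | succ t ih =>
    rw [ex_execution_succ, ex_execution_succ]
    refine (ih fun h s => ex (eventLaw adv h) fun o => o.elim (F h s) fun e =>
      ev (stepC P e h s) (F (e :: h))).trans ?_
    congr 1
    funext ω
    -- The next event depends on the stream alone, so it may be drawn before the state.
    rw [ex_comm]
    congr 1
    funext o
    cases o with
    | none => rfl
    | some e =>
      simp only [Option.elim_some, wp_const]
      exact (ex_stateLaw_cons_fst e ω.history (F (e :: ω.history))).symm

lemma reachable_cons (hh : adv.Reachable h) (he : some e ∈ (eventLaw adv h).support) :
    adv.Reachable (e :: h) := by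
  unfold eventLaw at he
  cases hr : adv h with
  | insert S =>
    rw [hr] at he
    obtain rfl := Option.some.inj ((PMF.mem_support_pure_iff _ _).1 he)
    exact .arrive h S hh hr
  | delete =>
    rw [hr] at he
    dsimp only at he
    split_ifs at he with hne
    · obtain ⟨v, hv, hve⟩ := (PMF.mem_support_map_iff _ _ _).1 he
      obtain rfl := Option.some.inj hve
      exact .remove h v hh hr ((PMF.mem_support_uniformOfFinset_iff hne v).1 hv)
    · exact absurd ((PMF.mem_support_pure_iff _ _).1 he) (by simp)

lemma eventLaw_none (hadm : adv.Admissible n T) (hh : adv.Reachable h) (hl : h.length < T) :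
    none ∉ (eventLaw adv h).support := by
  intro he
  have ha := hadm h hh hl
  unfold eventLaw at he
  cases hr : adv h with
  | insert S =>
    rw [hr] at he
    exact absurd ((PMF.mem_support_pure_iff _ _).1 he) (by simp)
  | delete =>
    rw [hr] at he ha
    dsimp only at he ha
    rw [dif_pos ha] at he
    obtain ⟨v, _, hve⟩ := (PMF.mem_support_map_iff _ _ _).1 he
    exact absurd hve (by simp)

lemma Adversary.Reachable.valid (hadm : adv.Admissible n T) (hh : adv.Reachable h)
    (hl : h.length ≤ T) : Valid n h := by
  induction hh with
  | start => trivial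
  | arrive h S hh hr ih =>
    have := hadm h hh hl
    rw [hr] at this
    exact ⟨ih (Nat.le_of_succ_le hl), this⟩
  | remove h v hh hr hv ih => exact ⟨ih (Nat.le_of_succ_le hl), hv⟩

/-- Turns identities between expectations into statements that hold for every possible execution. -/
lemma of_ex_ind_eq_zero {α : Type*} {p : PMF α} {Q : α → Prop} (h : ex p (fun a => ind (Q a)) = 0)
    {a : α} (ha : a ∈ p.support) : ¬ Q a := by
  intro hQ
  have h0 : p a * ind (Q a) = 0 := ENNReal.tsum_eq_zero.1 h a
  rw [ind_of hQ, mul_one] at h0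
  exact (PMF.mem_support_iff _ _).1 ha h0

lemma execution_support (hadm : adv.Admissible n T) (ht : t ≤ T) {ω : Run}
    (hω : ω ∈ (execution P adv t).support) : adv.Reachable ω.history ∧ ω.history.length = t := by
  classical
  induction t generalizing ω with
  | zero =>
    rw [execution, PMF.mem_support_pure_iff] at hω
    subst hω
    exact ⟨.start, rfl⟩
  | succ t ih =>
    by_contra hn
    have key : ex (execution P adv (t + 1)) (fun ω => ind (¬ (adv.Reachable ω.history ∧
        ω.history.length = t + 1))) = 0 := by
      rw [ex_execution_succ]
      refine le_antisymm (ex_le_of_le fun ω' hω' => ex_le_of_le fun o ho => ?_) zero_le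
      obtain ⟨h₁, h₂⟩ := ih (by omega) hω'
      cases o with
      | none => exact absurd ho (eventLaw_none hadm h₁ (by omega))
      | some e =>
        simp only [Option.elim_some, wp_const]
        exact (ind_of_not (not_not.2 ⟨reachable_cons h₁ ho, by simp [h₂]⟩)).le
    have h0 := of_ex_ind_eq_zero key hω
    exact h0 hn

lemma stateOK_execution (hP : Sizes P) (hadm : adv.Admissible P.n T) (ht : t ≤ T) {ω : Run}
    (hω : ω ∈ (execution P adv t).support) : StateOK P ω.history ω.state := by
  refine not_not.1 (of_ex_ind_eq_zero (Q := fun ω : Run => ¬ StateOK P ω.history ω.state) ?_ hω)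
  rw [ex_execution t fun h s => ind (¬ StateOK P h s)]
  refine le_antisymm (ex_le_of_le fun ω' hω' => ex_le_of_le fun x hx => ?_) zero_le
  obtain ⟨h₁, h₂⟩ := execution_support hadm ht hω'
  exact (ind_of_not (not_not.2 (stateOK_of_mem_support hP (h₁.valid hadm (by omega)) hx))).le

/-! ### The expected number of notifications -/

/-- Double counting of the pairs of a node and a member of one of its stored samples. -/
lemma sum_receivers_le {V : Finset ℕ} {I : Store} (hI : StoreOK P I) :
    ∑ v ∈ V, ((V.filter fun x => ∃ i < P.levels, v ∈ I x i)).card ≤ V.card * (P.levels * P.K) := by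
  calc _ = ∑ x ∈ V, (V.filter fun v => ∃ i < P.levels, v ∈ I x i).card :=
        Finset.sum_card_bipartiteAbove_eq_sum_card_bipartiteBelow
          (fun v x => ∃ i < P.levels, v ∈ I x i)
    _ ≤ ∑ _x ∈ V, P.levels * P.K := by
        refine Finset.sum_le_sum fun x _ => ?_
        have : (V.filter fun v => ∃ i < P.levels, v ∈ I x i) ⊆
            (Finset.range P.levels).biUnion (I x) := by
          intro v hv
          obtain ⟨_, i, hi, hvi⟩ := Finset.mem_filter.1 hv
          exact Finset.mem_biUnion.2 ⟨i, Finset.mem_range.2 hi, hvi⟩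
        refine (Finset.card_le_card this).trans ?_
        simpa using Finset.card_biUnion_le_card_mul (Finset.range P.levels) (I x) P.K
          fun i _ => hI x i
    _ = _ := by rw [Finset.sum_const, smul_eq_mul]

/-- A uniformly random node is stored in few samples. -/
lemma ex_load_le (hP : Sizes P) {I : Store} (hI : StoreOK P I) (adv : Adversary) (h : History) :
    ex (eventLaw adv h) (fun o => o.elim 0 fun e => load P e h I) ≤ P.K ^ 2 := by
  have hK : 1 ≤ P.K := le_trans (by norm_num) hP.hundred_le_K
  unfold eventLaw
  cases adv h with
  | insert S =>
    simp only [ex_pure, Option.elim_some]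
    exact_mod_cast (by nlinarith : P.K ≤ P.K ^ 2)
  | delete =>
    dsimp only
    split_ifs with hne
    · rw [ex_map, ex_uniformOfFinset]
      refine ENNReal.div_le_of_le_mul ?_
      simp only [Option.elim_some, load]
      rw [← Nat.cast_sum, mul_comm]
      have : ∑ v ∈ (graphOf h).verts, (receivers P (graphOf (.deletion v :: h)) I v).card ≤
          (graphOf h).verts.card * P.K ^ 2 := by
        refine (Finset.sum_le_sum fun v _ => Finset.card_le_card ?_).trans
          ((sum_receivers_le (V := (graphOf h).verts) hI).trans ?_)
        · intro x hx
          obtain ⟨hx₁, hx₂⟩ := mem_receivers.1 hx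
          exact Finset.mem_filter.2 ⟨Finset.mem_of_mem_erase hx₁, hx₂⟩
        · rw [sq]
          gcongr
          exact hP.levels_le
      exact_mod_cast this
    · simp only [ex_pure, Option.elim_none]
      exact zero_le

/-! ### The expected cost of an update -/

/-- The expectation of a function of the next event. -/
def onEvent (adv : Adversary) (h : History) (f : Event → ℝ≥0∞) : ℝ≥0∞ :=
  ex (eventLaw adv h) fun o => o.elim 0 f

lemma onEvent_add (f g : Event → ℝ≥0∞) :
    onEvent adv h (fun e => f e + g e) = onEvent adv h f + onEvent adv h g := by
  unfold onEvent
  rw [← ex_add]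
  congr 1
  funext o
  cases o <;> simp

lemma onEvent_const_mul (c : ℝ≥0∞) (f : Event → ℝ≥0∞) :
    onEvent adv h (fun e => c * f e) = c * onEvent adv h f := by
  unfold onEvent
  rw [← ex_const_mul]
  congr 1
  funext o
  cases o <;> simp

lemma onEvent_const_le (c : ℝ≥0∞) : onEvent adv h (fun _ => c) ≤ c :=
  ex_le_of_le fun o _ => by cases o <;> simp

lemma onEvent_mono {f g : Event → ℝ≥0∞}
    (hfg : ∀ e, some e ∈ (eventLaw adv h).support → f e ≤ g e) :
    onEvent adv h f ≤ onEvent adv h g :=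
  ex_mono_support fun o ho => by
    cases o with
    | none => exact le_rfl
    | some e => exact hfg e ho

lemma ex_onEvent {α : Type*} (p : PMF α) (f : α → Event → ℝ≥0∞) :
    ex p (fun x => onEvent adv h (f x)) = onEvent adv h fun e => ex p fun x => f x e := by
  unfold onEvent
  rw [ex_comm]
  congr 1
  funext o
  cases o <;> simp [ex_const]

lemma ex_onEvent_load_le (hP : Sizes P) (hv : Valid P.n h) :
    ex (stateLaw P h) (fun x => onEvent adv h fun e => load P e h x.1.I) ≤ P.K ^ 2 :=
  ex_le_of_le fun _ hx => ex_load_le hP (stateOK_of_mem_support hP hv hx).store adv h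

lemma ex_onEvent_ec_le (hP : Sizes P) (hadm : adv.Admissible P.n T) (hh : adv.Reachable h)
    (hl : h.length < T) :
    ex (stateLaw P h) (fun x => onEvent adv h fun e => ec (stepC P e h x.1)) ≤ 600 * P.K ^ 9 := by
  have hK : (1 : ℝ≥0∞) ≤ P.K := by exact_mod_cast le_trans (by norm_num) hP.hundred_le_K
  have hv := hh.valid hadm hl.le
  rw [ex_onEvent]
  refine (onEvent_mono fun e he =>
    ex_ec_stepC_le hP ((reachable_cons hh he).valid hadm hl)).trans ?_
  -- The cost was bounded for each event with the state averaged; the load is bounded for each state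
  -- with the event averaged, since the deleted node is uniform given the store.
  rw [onEvent_const_mul, onEvent_add, ← ex_onEvent]
  refine (mul_le_mul_right (add_le_add (ex_onEvent_load_le hP hv) (onEvent_const_le 1)) _).trans ?_
  unfold Params.testCost
  push_cast
  calc 37 * (P.K : ℝ≥0∞) ^ 4 * (8 * P.K ^ 3) * (P.K ^ 2 + 1)
      = 296 * (P.K : ℝ≥0∞) ^ 9 + 296 * (P.K : ℝ≥0∞) ^ 7 := by ring
    _ ≤ 304 * (P.K : ℝ≥0∞) ^ 9 + 296 * (P.K : ℝ≥0∞) ^ 9 := by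
        gcongr <;> norm_num
    _ = _ := by ring

lemma ex_execution_ec_le (hP : Sizes P) (hadm : adv.Admissible P.n T) (ht : t < T) :
    ex (execution P adv t) (fun ω => onEvent adv ω.history fun e =>
      ec (stepC P e ω.history ω.state)) ≤ 600 * P.K ^ 9 := by
  rw [ex_execution t fun h s => onEvent adv h fun e => ec (stepC P e h s)]
  refine ex_le_of_le fun ω hω => ?_
  obtain ⟨h₁, h₂⟩ := execution_support hadm ht.le hω
  exact ex_onEvent_ec_le hP hadm h₁ (by omega)

lemma ex_execution_load_le (hP : Sizes P) (hadm : adv.Admissible P.n T) (ht : t < T) :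
    ex (execution P adv t) (fun ω => onEvent adv ω.history fun e =>
      load P e ω.history ω.state.I) ≤ P.K ^ 2 := by
  rw [ex_execution t fun h s => onEvent adv h fun e => (load P e h s.I : ℝ≥0∞)]
  refine ex_le_of_le fun ω hω => ?_
  obtain ⟨h₁, h₂⟩ := execution_support hadm ht.le hω
  exact ex_onEvent_load_le hP (h₁.valid hadm (by omega))

/-- One more update, for executions of an admissible adversary. -/
lemma ex_execution_succ_of_admissible (hadm : adv.Admissible n T) (ht : t < T)
    (g : Run → ℝ≥0∞) :
    ex (execution P adv (t + 1)) g = ex (execution P adv t) fun ω => onEvent adv ω.history fun e =>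
      (stepC P e ω.history ω.state).wp fun s m =>
        g ⟨e :: ω.history, s, Function.update ω.cost t m⟩ := by
  rw [ex_execution_succ]
  refine ex_congr_support fun ω hω => ex_congr_support fun o ho => ?_
  obtain ⟨h₁, h₂⟩ := execution_support hadm ht.le hω
  cases o with
  | none => exact absurd ho (eventLaw_none hadm h₁ (by omega))
  | some e => rw [h₂]; rfl

lemma onEvent_const (hadm : adv.Admissible n T) (hh : adv.Reachable h) (hl : h.length < T)
    (c : ℝ≥0∞) : onEvent adv h (fun _ => c) = c := by
  refine (ex_congr_support fun o ho => ?_).trans (ex_const (eventLaw adv h) c)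
  cases o with
  | none => exact absurd ho (eventLaw_none hadm hh hl)
  | some e => rfl

/-- The cost of an update does not change later. -/
lemma ex_execution_cost (hadm : adv.Admissible n T) (ht : t < T) (f : Cost → ℝ≥0∞) :
    ex (execution P adv T) (fun ω => f (ω.cost t)) =
      ex (execution P adv (t + 1)) fun ω => f (ω.cost t) := by
  have key : ∀ k, t + 1 + k ≤ T → ex (execution P adv (t + 1 + k)) (fun ω => f (ω.cost t)) =
      ex (execution P adv (t + 1)) fun ω => f (ω.cost t) := by
    intro k
    induction k with
    | zero => intro _; rfl
    | succ k ih =>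
      intro hk
      rw [← ih (by omega), ← add_assoc, ex_execution_succ_of_admissible hadm (by omega)]
      refine ex_congr_support fun ω hω => ?_
      obtain ⟨h₁, h₂⟩ := execution_support hadm (by omega) hω
      have : t ≠ t + 1 + k := by omega
      simp only [Function.update_of_ne this, wp_const]
      exact onEvent_const hadm h₁ (by omega) _
  have := key (T - (t + 1)) (by omega)
  rwa [Nat.add_sub_cancel' ht] at this

lemma ex_cq_le (hP : Sizes P) (hadm : adv.Admissible P.n T) (ht : t < T) :
    ex (execution P adv T) (fun ω => ((ω.cost t).cq : ℝ≥0∞)) ≤ 600 * P.K ^ 9 := by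
  rw [ex_execution_cost hadm ht fun c => (c.cq : ℝ≥0∞), ex_execution_succ_of_admissible hadm ht]
  simp only [Function.update_self]
  exact ex_execution_ec_le hP hadm ht

/-- The work of an update and the change of the potential. -/
lemma wp_work_add_pot_le (hP : Sizes P) (hv : Valid P.n (e :: h)) {s : State}
    (hs : StateOK P h s) (r : ℝ≥0∞) :
    ((stepC P e h s).wp fun s' m => (r + (m.work : ℕ)) + pot s') ≤
      (r + pot s + (1 + P.K * P.K)) +
        (P.K * load P e h s.I + (1 + 2 * P.K) * ec (stepC P e h s)) := by
  have ha := amortized_stepC hP hv hs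
  unfold Amortized at ha
  calc _ ≤ (stepC P e h s).wp fun s' m => r + ((m.cq : ℝ≥0∞) + ((m.ops : ℝ≥0∞) + pot s')) := by
        refine wp_mono fun s' m => ?_
        rw [add_assoc, ← add_assoc (m.cq : ℝ≥0∞)]
        gcongr
        unfold Cost.work Cost.cq
        exact_mod_cast (by omega : m.query + m.ops ≤ m.calcs + m.query + m.ops)
    _ ≤ r + (ec (stepC P e h s) + (pot s + (1 + P.K * (P.K + load P e h s.I) : ℕ) +
          2 * P.K * ec (stepC P e h s))) := by
        rw [wp_add, wp_const, wp_add]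
        exact add_le_add le_rfl (add_le_add le_rfl ha)
    _ = _ := by push_cast; ring

/-- The total work and the potential. -/
lemma ex_work_add_pot_le (hP : Sizes P) (hadm : adv.Admissible P.n T) (ht : t ≤ T) :
    ex (execution P adv t) (fun ω =>
      ((∑ i ∈ Finset.range t, (ω.cost i).work : ℕ) : ℝ≥0∞) + pot ω.state) ≤
        t * (1803 * P.K ^ 10) := by
  have hK : (1 : ℝ≥0∞) ≤ P.K := by exact_mod_cast le_trans (by norm_num) hP.hundred_le_K
  induction t with
  | zero =>
    rw [execution, ex_pure]
    simp [pot, Run.initial, State.initial]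
  | succ t ih =>
    rw [ex_execution_succ_of_admissible hadm (by omega)]
    calc _ ≤ ex (execution P adv t) (fun ω =>
          (((∑ i ∈ Finset.range t, (ω.cost i).work : ℕ) : ℝ≥0∞) + pot ω.state) +
          ((1 + P.K * P.K) + (P.K * (onEvent adv ω.history fun e => load P e ω.history ω.state.I) +
            (1 + 2 * P.K) * onEvent adv ω.history fun e => ec (stepC P e ω.history ω.state)))) := by
          refine ex_mono_support fun ω hω => ?_
          obtain ⟨h₁, h₂⟩ := execution_support hadm (by omega) hω
          have hs := stateOK_execution hP hadm (by omega) hω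
          set r : ℝ≥0∞ := ((∑ i ∈ Finset.range t, (ω.cost i).work : ℕ) : ℝ≥0∞) with hr
          have hsum : ∀ m : Cost, ((∑ i ∈ Finset.range (t + 1),
              (Function.update ω.cost t m i).work : ℕ) : ℝ≥0∞) = r + (m.work : ℕ) := by
            intro m
            rw [Finset.sum_range_succ, Function.update_self, Nat.cast_add, hr]
            congr 2
            refine Finset.sum_congr rfl fun i hi => ?_
            rw [Function.update_of_ne (Finset.mem_range.1 hi).ne]
          simp only [hsum]
          refine (onEvent_mono fun e he => wp_work_add_pot_le hP
            ((reachable_cons h₁ he).valid hadm (by simp; omega)) hs r).trans ?_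
          rw [onEvent_add (fun _ => r + pot ω.state + (1 + P.K * P.K)),
            onEvent_add (fun e => (P.K : ℝ≥0∞) * load P e ω.history ω.state.I),
            onEvent_const_mul, onEvent_const_mul]
          exact (add_le_add (onEvent_const_le _) le_rfl).trans_eq (add_assoc _ _ _)
      _ ≤ t * (1803 * P.K ^ 10) + ((1 + P.K * P.K) + (P.K * P.K ^ 2 +
            (1 + 2 * P.K) * (600 * P.K ^ 9))) := by
          refine (ex_add _ _ _).trans_le (add_le_add (ih (by omega)) ?_)
          rw [ex_add _ (fun _ => 1 + (P.K : ℝ≥0∞) * P.K), ex_const, ex_add, ex_const_mul,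
            ex_const_mul]
          exact add_le_add le_rfl (add_le_add
            (mul_le_mul_right (ex_execution_load_le hP hadm (by omega)) _)
            (mul_le_mul_right (ex_execution_ec_le hP hadm (by omega)) _))
      _ = t * (1803 * P.K ^ 10) + (1 + P.K ^ 2 + P.K ^ 3 + 600 * P.K ^ 9 + 1200 * P.K ^ 10) := by
          ring
      _ ≤ t * (1803 * P.K ^ 10) + (P.K ^ 10 + P.K ^ 10 + P.K ^ 10 + 600 * P.K ^ 10 +
            1200 * P.K ^ 10) := by
          gcongr
          · exact one_le_pow₀ hK
          all_goals norm_num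
      _ = _ := by push_cast; ring

lemma ex_work_le (hP : Sizes P) (hadm : adv.Admissible P.n T) :
    expect (execution P adv T) (fun ω => ∑ t ∈ Finset.range T, (ω.cost t).work) ≤
      T * (1803 * P.K ^ 10) :=
  (ex_mono fun _ => le_self_add).trans (ex_work_add_pot_le hP hadm le_rfl)

/-- The sample sizes are logarithmic. -/
lemma Sizes.K_le (hP : Sizes P) :
    (P.K : ℝ) ≤ (10 ^ 10 / P.ε + 1) / Real.log 2 * Real.log P.n := by
  have h1 := hP.one_le_logb
  have hε := hP.eps_pos
  have hc : (P.K : ℝ) < 10 ^ 10 * Real.logb 2 P.n / P.ε + 1 := Nat.ceil_lt_add_one (by positivity)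
  -- The summand 1 from rounding up is absorbed by `Real.logb 2 n ≥ 1`.
  have he : (10 ^ 10 / P.ε + 1) / Real.log 2 * Real.log P.n =
      10 ^ 10 * Real.logb 2 P.n / P.ε + Real.logb 2 P.n := by
    rw [Real.logb]; ring
  linarith

/-- The bound for the expected cost of an update. -/
def costBound (ε : ℝ) : ℝ := 1803 * ((10 ^ 10 / ε + 1) / Real.log 2) ^ 10

lemma costBound_pos {ε : ℝ} (hε : 0 < ε) : 0 < costBound ε := by
  have := Real.log_pos (by norm_num : (1 : ℝ) < 2)
  unfold costBound
  positivity

lemma Sizes.K_pow_le (hP : Sizes P) :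
    1803 * (P.K : ℝ≥0∞) ^ 10 ≤ ENNReal.ofReal (costBound P.ε * Real.log P.n ^ 10) := by
  have h : 1803 * (P.K : ℝ) ^ 10 ≤ costBound P.ε * Real.log P.n ^ 10 := by
    calc 1803 * (P.K : ℝ) ^ 10
        ≤ 1803 * ((10 ^ 10 / P.ε + 1) / Real.log 2 * Real.log P.n) ^ 10 := by
          gcongr
          exact hP.K_le
      _ = _ := by unfold costBound; ring
  calc 1803 * (P.K : ℝ≥0∞) ^ 10 = ENNReal.ofReal ((1803 * P.K ^ 10 : ℕ) : ℝ) := by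
        rw [ENNReal.ofReal_natCast]; push_cast; rfl
    _ ≤ _ := ENNReal.ofReal_le_ofReal (by push_cast; exact h)

lemma ex_calcs_query_le (hP : Sizes P) (hadm : adv.Admissible P.n T) (ht : t < T) {f : Cost → ℕ}
    (hf : ∀ c, f c ≤ c.cq) :
    expect (execution P adv T) (fun ω => f (ω.cost t)) ≤
      ENNReal.ofReal (costBound P.ε * Real.log P.n ^ 10) := by
  have hK : (1 : ℝ≥0∞) ≤ P.K := by exact_mod_cast le_trans (by norm_num) hP.hundred_le_K
  refine le_trans (ex_mono fun ω => Nat.cast_le.2 (hf _)) ((ex_cq_le hP hadm ht).trans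
    (le_trans ?_ hP.K_pow_le))
  gcongr <;> norm_num

end
end DynCC
end

theorem mainTheorem2 :
    ∃ (k : ℕ) (ε₀ : ℝ), 0 < ε₀ ∧ ∀ ε : ℝ, 0 < ε → ε < ε₀ →
      ∃ C : ℝ, 0 < C ∧
        ∀ (n T : ℕ) (order : Finset ℕ → List ℕ) (adv : DynCC.Adversary),
          2 ≤ n → DynCC.Params.OrderOK ⟨n, ε, order⟩ → adv.Admissible n T →
          (∀ t < T,
            DynCC.expect (DynCC.execution ⟨n, ε, order⟩ adv T) (fun ω => (ω.cost t).calcs)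
              ≤ ENNReal.ofReal (C * Real.log n ^ k)) ∧
          (∀ t < T,
            DynCC.expect (DynCC.execution ⟨n, ε, order⟩ adv T) (fun ω => (ω.cost t).query)
              ≤ ENNReal.ofReal (C * Real.log n ^ k)) ∧
          DynCC.expect (DynCC.execution ⟨n, ε, order⟩ adv T)
              (fun ω => ∑ t ∈ Finset.range T, (ω.cost t).work)
            ≤ ENNReal.ofReal (T * (C * Real.log n ^ k)) := by
  -- The exponent collects `K ^ 3` for a test, `K ^ 4` per first notification, `K ^ 2` for their
  -- expected number and `K` for the prepaid operations.
  refine ⟨10, 1 / 1000, by norm_num, fun ε hε hε' => ⟨DynCC.costBound ε, DynCC.costBound_pos hε,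
    fun n T order adv hn hord hadm => ?_⟩⟩
  have hP : DynCC.Sizes ⟨n, ε, order⟩ := ⟨hn, hε, hε', hord⟩
  refine ⟨fun t ht => DynCC.ex_calcs_query_le (f := DynCC.Cost.calcs) hP hadm ht fun c =>
      Nat.le_add_right _ _,
    fun t ht => DynCC.ex_calcs_query_le (f := DynCC.Cost.query) hP hadm ht fun c =>
      Nat.le_add_left _ _, (DynCC.ex_work_le hP hadm).trans ?_⟩
  rw [ENNReal.ofReal_mul (Nat.cast_nonneg T), ENNReal.ofReal_natCast]
  exact mul_le_mul_right hP.K_pow_le _
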